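/- **Notation.** Let $r\ge 0$, $n\ge 1$, $\Lambda=\mathbb Z^{r+1}$, $\alpha_i=e_i-e_{i+1}$ $(1\le i\le r)$, $\rho=(r,r-1,\dots,1,0)$, $W=S_{r+1}$ with simple reflections $\sigma_i=(i\ i{+}1)$ and long element $w_0$; $W$ permutes the coordinates of weights. Let $\mathcal K=\mathbb C(x_1,\dots,x_{r+1})$, $\mathbf x^{\mu}=\prod_i x_i^{\mu_i}$, and let $w.f$ be the action of $W$ on $\mathcal K$ by permuting variables, $w.\mathbf x^\mu=\mathbf x^{w\mu}$. Let $v,g_0,\dots,g_{n-1}\in\mathbb C$ satisfy $g_0=-1$ and $g_jg_{n-j}=v^{-1}$ for $0<j<n$, and extend $g_j$ to $j\in\mathbb Z$ with period $n$. *Operators.* Let $\Lambda_0=\{\mu\in\Lambda:\mu_i\equiv\mu_j \bmod n\ \forall i,j\}$. A character $\xi$ of $\Lambda/\Lambda_0$ acts on $\mathcal K$ by the field automorphism $\mathbf x^\mu\mapsto\xi(\mu)\mathbf x^\mu$, and $\mathcal K=\bigoplus_{\bar\mu\in\Lambda/\Lambda_0}\mathcal K_{\bar\mu}$ with $\mathcal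 K_{\bar\mu}=\{f:\xi(f)=\xi(\bar\mu)f\ \forall\xi\}$. The additive map $\sigma_i:\mathcal K\to\mathcal K$ (Chinta–Gunnells action) is given on $f\in\mathcal K_{\bar\mu}$, with $y=x_i/x_{i+1}$ and $d=\mu_{i+1}-\mu_i$, by $$\sigma_i(f)=\frac{\sigma_i.f}{1-vy^n}\Big[y^{-(d\bmod n)}(1-v)-v\,g_{1+d}\,y^{1-n}(1-y^n)\Big],\qquad 0\le d\bmod n\le n-1 .$$ Put $\mathcal D_i(f)=\dfrac{f-\mathbf x^{n\alpha_i}\sigma_i(f)}{1-\mathbf x^{n\alpha_i}}$, $\ \mathcal T_i(f)=(1-v\mathbf x^{n\alpha_i})\mathcal D_i(f)-f$, and $\mathcal T_u=\mathcal T_{i_1}\cdots\mathcal T_{i_l}$ for a reduced word $u=\sigma_{i_1}\cdots\sigma_{i_l}$ (any reduced word may be used for each $u$). *Crystal.* For a weight $\mu=(\mu_1\ge\dots\ge\mu_{r+1}\ge0)$ let $\mathcal C_\mu$ be the type $A_r$ crystal of highest weight $\mu$ (semistandard tableaux of shape $\mu$ with entries in $\{1,\dots,r+1\}$ and Kashiwara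 operators $f_i$ given by the signature rule), with weight function $\mathrm{wt}$. Let $\Omega_1,\dots,\Omega_N$ be the indices of the reduced word $w_0=\sigma_1\,\sigma_2\sigma_1\cdots\sigma_r\cdots\sigma_1$. For $b\in\mathcal C_\mu$ put $b_{(0)}=b$, let $b_k$ be the largest integer with $f_{\Omega_k}^{b_k}b_{(k-1)}\ne0$ and $b_{(k)}=f_{\Omega_k}^{b_k}b_{(k-1)}$. Arrange these numbers as $\Gamma_{ij}(b)=b_{\binom{r+1-i}{2}+j-i+1}$ $(1\le i\le j\le r)$, with $\Gamma_{i,r+1}=0$, and let $(a_{ij})_{0\le i\le j\le r}$ be the array with $a_{0,j}=\mu_{j+1}$ and $a_{ij}=a_{i-1,j}+\Gamma_{ij}-\Gamma_{i,j+1}$. *Coefficients.* For functions $g^\flat,h^\flat:\mathbb Z_{\ge 0}\to\mathbb C$ let $G^{(n,\mu)}(b)=\prod_{1\le i\le j\le r}g_{ij}$, where with $m=\Gamma_{i,j+1}$ and $M=\Gamma_{i,j+1}+a_{i-1,j-1}-a_{i-1,j}$ $$g_{ij}=\begin{cases}1&m=\Gamma_{ij}<M\\ h^\flat(\Gamma_{ij})&m<\Gamma_{ij}<M\\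 g^\flat(\Gamma_{ij})&m<\Gamma_{ij}=M\\ 0&m=\Gamma_{ij}=M.\end{cases}$$ **Theorem (Metaplectic Tokuyama theorem, type $A_r$).** Let $\lambda=(\lambda_1\ge\dots\ge\lambda_{r+1}\ge0)$ be a dominant effective weight. 1. With $g^\flat(a)=v\,g_a$, and $h^\flat(a)=1-v$ if $n\mid a$, $h^\flat(a)=0$ otherwise, $$\Big(\sum_{u\in W}\mathcal T_u\Big)(\mathbf x^{w_0\lambda})=\mathbf x^{-w_0\rho}\sum_{b\in\mathcal C_{\lambda+\rho}}G^{(n,\lambda+\rho)}(b)\,\mathbf x^{\mathrm{wt}(b)} .$$ 2. In particular the same identity holds for Gauss sums: if $k$ is a finite field with $q\equiv1\pmod{2n}$ elements, $\chi:k^\times\to\mathbb C^\times$ is a character of order $n$ (with $\chi^a(0)=0$ for all $a$) and $\psi$ is a nontrivial additive character of $k$, it holds with $v=q^{-1}$, $g_j=\sum_{b\in k}\chi(b)^j\psi(b)$ $(0\le j<n)$, $g^\flat(a)=q^{-1}\sum_{b\in k}\chi(b)^a\psi(b)$ and $h^\flat(a)=q^{-1}\sum_{b\in k}\chi(b)^a$.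 3. For $n=1$ this recovers Tokuyama's deformation of the Weyl character formula: for every $v\in\mathbb C$, with $g^\flat=-v$, $h^\flat=1-v$ and the Schur function $s_\lambda=\sum_{w\in W}\mathrm{sgn}(w)\,\mathbf x^{w(\lambda+\rho)}\big/\prod_{i<j}(x_i-x_j)$, $$\prod_{1\le i<j\le r+1}(x_j-v\,x_i)\cdot s_\lambda(\mathbf x)=\sum_{b\in\mathcal C_{\lambda+\rho}}G^{(1,\lambda+\rho)}(b)\,\mathbf x^{\mathrm{wt}(b)} .$$ -/

import Mathlib

namespace MetaplecticTokuyama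

/-! ### Weights, rational functions and the ordinary action of the Weyl group -/

/-- The weight lattice `ℤ^{r+1}` of type `A_r`; coordinates are numbered `0, …, r`. -/
abbrev Weight (r : ℕ) : Type := Fin (r + 1) → ℤ

/-- The Weyl group of type `A_r`, the symmetric group on the `r + 1` coordinates. -/
abbrev Weyl (r : ℕ) : Type := Equiv.Perm (Fin (r + 1))

/-- The field `ℂ(x_0, …, x_r)`, i.e. the fraction field of the group algebra of the weight
lattice. -/
abbrev RatFun (r : ℕ) : Type := FractionRing (MvPolynomial (Fin (r + 1)) ℂ)

/-- The variable `x_i`. -/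
noncomputable def var {r : ℕ} (i : Fin (r + 1)) : RatFun r :=
  algebraMap (MvPolynomial (Fin (r + 1)) ℂ) (RatFun r) (MvPolynomial.X i)

/-- The monomial `x^μ = ∏ x_i ^ μ_i`. -/
noncomputable def monomial {r : ℕ} (μ : Weight r) : RatFun r := ∏ i, var i ^ μ i

/-- The constant rational function `c`. -/
noncomputable def const {r : ℕ} (c : ℂ) : RatFun r := algebraMap ℂ (RatFun r) c

/-- The Weyl group permutes the coordinates of a weight. -/
def weightAct {r : ℕ} (w : Weyl r) (μ : Weight r) : Weight r := fun i => μ (w⁻¹ i)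

/-- The long element `w_0`, which reverses the coordinates. -/
def longElement (r : ℕ) : Weyl r := Fin.revPerm

/-- `ρ = (r, r - 1, …, 1, 0)`. -/
def rho (r : ℕ) : Weight r := fun i => (r : ℤ) - (i : ℤ)

/-- The simple root `α_i = e_i - e_{i+1}`. -/
def simpleRoot {r : ℕ} (i : Fin r) : Weight r := Pi.single i.castSucc 1 - Pi.single i.succ 1

/-- The simple reflection `σ_i`. -/
def simpleReflection {r : ℕ} (i : Fin r) : Weyl r := Equiv.swap i.castSucc i.succ

/-- The ordinary (nonmetaplectic) action `f ↦ w.f` of the Weyl group on rational functions, by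
field automorphisms permuting the variables. -/
noncomputable def ordinaryAct {r : ℕ} (w : Weyl r) : RatFun r ≃ₐ[ℂ] RatFun r :=
  IsFractionRing.fieldEquivOfAlgEquiv ℂ (RatFun r) (RatFun r) (MvPolynomial.renameEquiv ℂ w)

/-! ### The grading of the rational functions by `Λ/Λ₀` -/

/-- The sublattice `Λ₀` of the weights all of whose coordinates are congruent modulo `n`. -/
def sublattice (n r : ℕ) : AddSubgroup (Weight r) where
  carrier := {μ | ∀ i j, (n : ℤ) ∣ μ i - μ j}
  zero_mem' := by simp
  add_mem' := by
    intro a b ha hb i j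
    have := dvd_add (ha i j) (hb i j)
    simpa [sub_add_sub_comm] using this
  neg_mem' := by
    intro a ha i j
    have := (ha j i)
    simpa [sub_eq_add_neg, add_comm] using this

instance finite_quotient (n r : ℕ) [NeZero n] : Finite (Weight r ⧸ sublattice n r) := by
  let F : Weight r → (Fin (r + 1) → ZMod n) := fun μ i => ((μ i - μ 0 : ℤ) : ZMod n)
  refine Finite.of_injective (fun q : Weight r ⧸ sublattice n r => F q.out) ?_
  intro p q h
  rw [← Quotient.out_eq' p, ← Quotient.out_eq' q, Quotient.eq'', QuotientAddGroup.leftRel_apply]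
  intro i j
  have key : ∀ i, (n : ℤ) ∣ (p.out i - p.out 0) - (q.out i - q.out 0) := by
    intro i
    have hi := congrFun h i
    simp only [F] at hi
    exact (ZMod.intCast_eq_intCast_iff_dvd_sub _ _ _).1 hi.symm
  refine (dvd_sub (key j) (key i)).trans (dvd_of_eq ?_)
  change _ = (-p.out i + q.out i) - (-p.out j + q.out j)
  ring

noncomputable instance fintype_quotient (n r : ℕ) [NeZero n] :
    Fintype (Weight r ⧸ sublattice n r) := Fintype.ofFinite _

/-- The algebra endomorphism `x_i ↦ ξ(e_i) x_i` of polynomials. -/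
noncomputable def twistHom {n r : ℕ} (ξ : AddChar (Weight r ⧸ sublattice n r) ℂ) :
    MvPolynomial (Fin (r + 1)) ℂ →ₐ[ℂ] MvPolynomial (Fin (r + 1)) ℂ :=
  MvPolynomial.aeval fun i =>
    MvPolynomial.C (ξ (QuotientAddGroup.mk (Pi.single i 1))) * MvPolynomial.X i

theorem twistHom_comp_neg {n r : ℕ} (ξ ξ' : AddChar (Weight r ⧸ sublattice n r) ℂ)
    (h : ∀ a, ξ a * ξ' a = 1) : (twistHom ξ).comp (twistHom ξ') = AlgHom.id ℂ _ := by
  ext1 i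
  simp only [twistHom, AlgHom.comp_apply, MvPolynomial.aeval_X, map_mul, AlgHom.id_apply]
  rw [← MvPolynomial.algebraMap_eq, AlgHom.commutes, ← mul_assoc, ← map_mul, mul_comm (ξ' _), h]
  simp

/-- The field automorphism of `ℂ(x)` attached to a character `ξ` of `Λ/Λ₀`; it sends `x^μ` to
`ξ(μ) x^μ`. -/
noncomputable def twist {n r : ℕ} (ξ : AddChar (Weight r ⧸ sublattice n r) ℂ) :
    RatFun r ≃ₐ[ℂ] RatFun r :=
  IsFractionRing.fieldEquivOfAlgEquiv ℂ (RatFun r) (RatFun r)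
    (AlgEquiv.ofAlgHom (twistHom ξ) (twistHom (-ξ))
      (twistHom_comp_neg _ _ fun a => by
        rw [AddChar.neg_apply, ← AddChar.map_add_eq_mul]; simp)
      (twistHom_comp_neg _ _ fun a => by
        rw [AddChar.neg_apply, ← AddChar.map_add_eq_mul]; simp))

/-- The component `K_μ = {f : ξ(f) = ξ(μ) f for all characters ξ of Λ/Λ₀}` of `K = ℂ(x)`. -/
def component {n r : ℕ} (μ : Weight r ⧸ sublattice n r) : Set (RatFun r) :=
  {f | ∀ ξ : AddChar (Weight r ⧸ sublattice n r) ℂ, twist ξ f = ξ μ • f}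

/-- The projection of `K = ⨁ K_μ` onto `K_μ`, obtained by averaging over the characters. -/
noncomputable def proj {n r : ℕ} [NeZero n] (μ : Weight r ⧸ sublattice n r) :
    RatFun r →ₗ[ℂ] RatFun r :=
  (Fintype.card (Weight r ⧸ sublattice n r) : ℂ)⁻¹ •
    ∑ ξ : AddChar (Weight r ⧸ sublattice n r) ℂ, ξ (-μ) • (twist ξ).toLinearMap

open Classical in
theorem proj_of_mem {n r : ℕ} [NeZero n] {μ ν : Weight r ⧸ sublattice n r} {f : RatFun r}
    (hf : f ∈ component ν) : proj μ f = if μ = ν then f else 0 := by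
  have h : ∀ ξ : AddChar (Weight r ⧸ sublattice n r) ℂ,
      ξ (-μ) • twist ξ f = ξ (ν - μ) • f := by
    intro ξ
    rw [hf ξ, smul_smul, ← AddChar.map_add_eq_mul, neg_add_eq_sub]
  have hc : (Fintype.card (Weight r ⧸ sublattice n r) : ℂ) ≠ 0 :=
    Nat.cast_ne_zero.2 Fintype.card_ne_zero
  simp only [proj, LinearMap.smul_apply, LinearMap.sum_apply, AlgEquiv.toLinearMap_apply]
  simp_rw [h, ← Finset.sum_smul]
  rw [AddChar.sum_apply_eq_ite]
  by_cases hμ : μ = ν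
  · simp [hμ, smul_smul, hc]
  · simp [hμ, sub_eq_zero, Ne.symm hμ]

/-- The components span: every rational function is the sum of its projections. -/
theorem sum_proj {n r : ℕ} [NeZero n] (f : RatFun r) :
    ∑ μ : Weight r ⧸ sublattice n r, proj μ f = f := by
  classical
  have hc : (Fintype.card (Weight r ⧸ sublattice n r) : ℂ) ≠ 0 :=
    Nat.cast_ne_zero.2 Fintype.card_ne_zero
  have hs : ∀ ξ : AddChar (Weight r ⧸ sublattice n r) ℂ,
      ∑ μ, ξ (-μ) = if ξ = 0 then (Fintype.card (Weight r ⧸ sublattice n r) : ℂ) else 0 := by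
    intro ξ
    rw [← AddChar.sum_eq_ite]
    exact Fintype.sum_equiv (Equiv.neg _) _ _ fun _ => rfl
  have ht : twist (0 : AddChar (Weight r ⧸ sublattice n r) ℂ) f = f := by
    have : (AlgEquiv.ofAlgHom (twistHom (0 : AddChar (Weight r ⧸ sublattice n r) ℂ))
        (twistHom (-0)) (twistHom_comp_neg _ _ fun a => by simp)
        (twistHom_comp_neg _ _ fun a => by simp)) = AlgEquiv.refl := by
      apply AlgEquiv.ext
      intro p
      change twistHom 0 p = p
      have h0 : twistHom (0 : AddChar (Weight r ⧸ sublattice n r) ℂ) = AlgHom.id ℂ _ := by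
        ext1 i
        simp [twistHom]
      rw [h0]
      rfl
    unfold twist
    rw [this, IsFractionRing.fieldEquivOfAlgEquiv_refl]
    rfl
  simp only [proj, LinearMap.smul_apply, LinearMap.sum_apply, AlgEquiv.toLinearMap_apply]
  rw [← Finset.smul_sum, Finset.sum_comm]
  simp_rw [← Finset.sum_smul, hs]
  simp [ht, smul_smul, hc]

/-! ### The Chinta-Gunnells action and the Demazure-Lusztig operators -/

/-- The conditions `g_0 = -1` and `g_j g_{n-j} = v⁻¹` (`0 < j < n`) on the complex parameters
`v, g_0, …, g_{n-1}`.  The convention that `g_j` depends only on `j` modulo `n` is built in by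
indexing with `ZMod n`. The second condition is written without division. -/
def IsMetaplecticParameters (n : ℕ) (v : ℂ) (g : ZMod n → ℂ) : Prop :=
  g 0 = -1 ∧ ∀ j : ZMod n, j ≠ 0 → v * (g j * g (-j)) = 1

/-- The factor by which `σ_i . f` is multiplied in the Chinta-Gunnells action, for `f` in the
component of `μ`. With `y = x_i / x_{i+1}` and `d = μ_{i+1} - μ_i` it is
`(1 - v y^n)⁻¹ (y^{-(d mod n)} (1 - v) - v g_{1+d} y^{1-n} (1 - y^n))`. -/
noncomputable def chintaGunnellsFactor (n : ℕ) {r : ℕ} (v : ℂ) (g : ZMod n → ℂ) (i : Fin r)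
    (μ : Weight r) : RatFun r :=
  let y : RatFun r := var i.castSucc / var i.succ
  let d : ℤ := μ i.succ - μ i.castSucc
  (y ^ (-(d % (n : ℤ))) * const (1 - v)
      - const (v * g ((1 + d : ℤ) : ZMod n)) * y ^ (1 - (n : ℤ)) * (1 - y ^ n))
    / (1 - const v * y ^ n)

/-- The metaplectic (Chinta-Gunnells) action of `σ_i`: on the component `K_μ` it is
`f ↦ (σ_i . f) * chintaGunnellsFactor n v g i μ`, extended additively to `K = ⨁ K_μ`.
The factor does not depend on the lift of `μ` to a weight. -/
noncomputable def chintaGunnells (n : ℕ) {r : ℕ} [NeZero n] (v : ℂ) (g : ZMod n → ℂ)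
    (i : Fin r) : RatFun r →ₗ[ℂ] RatFun r :=
  ∑ μ : Weight r ⧸ sublattice n r,
    LinearMap.mulRight ℂ (chintaGunnellsFactor n v g i μ.out) ∘ₗ
      (ordinaryAct (simpleReflection i)).toLinearMap ∘ₗ proj μ

/-- The defining property of the action, with an arbitrary lift `μ`. -/
theorem chintaGunnells_of_mem (n : ℕ) {r : ℕ} [NeZero n] (v : ℂ) (g : ZMod n → ℂ)
    (i : Fin r) (μ : Weight r) {f : RatFun r}
    (hf : f ∈ component (QuotientAddGroup.mk μ : Weight r ⧸ sublattice n r)) :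
    chintaGunnells n v g i f =
      ordinaryAct (simpleReflection i) f * chintaGunnellsFactor n v g i μ := by
  classical
  have hlift : chintaGunnellsFactor n v g i
      (QuotientAddGroup.mk μ : Weight r ⧸ sublattice n r).out =
        chintaGunnellsFactor n v g i μ := by
    set ν := (QuotientAddGroup.mk μ : Weight r ⧸ sublattice n r).out with hν
    have h1 : -ν + μ ∈ sublattice n r := by
      rw [← QuotientAddGroup.leftRel_apply, ← Quotient.eq'', hν, Quotient.out_eq']
    have h2 := h1 i.succ i.castSucc
    have h3 : (n : ℤ) ∣ (μ i.succ - μ i.castSucc) - (ν i.succ - ν i.castSucc) := by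
      refine h2.trans (dvd_of_eq ?_)
      change (-ν i.succ + μ i.succ) - (-ν i.castSucc + μ i.castSucc) = _
      ring
    have h4 : (ν i.succ - ν i.castSucc) % (n : ℤ) = (μ i.succ - μ i.castSucc) % (n : ℤ) :=
      (Int.modEq_iff_dvd).2 h3
    have h5 : ((1 + (ν i.succ - ν i.castSucc) : ℤ) : ZMod n)
        = ((1 + (μ i.succ - μ i.castSucc) : ℤ) : ZMod n) := by
      rw [ZMod.intCast_eq_intCast_iff_dvd_sub]
      simpa using h3
    unfold chintaGunnellsFactor
    simp only [h4, h5]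
  simp only [chintaGunnells, LinearMap.sum_apply, LinearMap.comp_apply, proj_of_mem hf]
  rw [Finset.sum_eq_single (QuotientAddGroup.mk μ : Weight r ⧸ sublattice n r)]
  · simp [hlift]
  · intro b _ hb
    simp [hb]
  · simp

/-- The Demazure operator `D_i f = (f - x^{n α_i} σ_i(f)) / (1 - x^{n α_i})`. -/
noncomputable def demazure (n : ℕ) {r : ℕ} [NeZero n] (v : ℂ) (g : ZMod n → ℂ) (i : Fin r) :
    Module.End ℂ (RatFun r) :=
  LinearMap.mulLeft ℂ (1 - monomial (n • simpleRoot i))⁻¹ *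
    (1 - LinearMap.mulLeft ℂ (monomial (n • simpleRoot i)) * chintaGunnells n v g i)

/-- The Demazure-Lusztig operator `T_i f = (1 - v x^{n α_i}) D_i f - f`. -/
noncomputable def demazureLusztig (n : ℕ) {r : ℕ} [NeZero n] (v : ℂ) (g : ZMod n → ℂ)
    (i : Fin r) : Module.End ℂ (RatFun r) :=
  LinearMap.mulLeft ℂ (1 - const v * monomial (n • simpleRoot i)) * demazure n v g i - 1

/-- `l = [i_1, …, i_l]` is a reduced word of `u`, i.e. `u = σ_{i_1} ⋯ σ_{i_l}` with `l` minimal. -/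
def IsReducedWord {r : ℕ} (l : List (Fin r)) (u : Weyl r) : Prop :=
  (l.map simpleReflection).prod = u ∧
    ∀ l' : List (Fin r), (l'.map simpleReflection).prod = u → l.length ≤ l'.length

/-- The operator `T_{i_1} ⋯ T_{i_l}` attached to a word; for a reduced word of `u` this is
`T_u`. -/
noncomputable def demazureLusztigWord (n : ℕ) {r : ℕ} [NeZero n] (v : ℂ) (g : ZMod n → ℂ)
    (l : List (Fin r)) : Module.End ℂ (RatFun r) :=
  (l.map (demazureLusztig n v g)).prod

/-! ### The highest weight crystal

The crystal of highest weight `μ` (a partition) is the crystal of semistandard tableaux of shape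
`μ` with entries in `{1, …, r+1}`, with the Kashiwara operators given by the signature rule for
the row reading word. A tableau is recorded by its Gelfand-Tsetlin pattern: row `i` of the pattern
is the shape of the part of the tableau that is filled with the letters `1, …, r + 1 - i`. -/

/-- Semistandard tableaux of shape `μ`, as Gelfand-Tsetlin patterns `(a_{ij})_{0 ≤ i ≤ j ≤ r}`
with top row `μ`; the entries outside the triangle are `0`. -/
structure Crystal (r : ℕ) (μ : Weight r) where
  /-- The entries of the pattern. -/
  a : ℕ → ℕ → ℤ
  top : ∀ j : Fin (r + 1), a 0 j = μ j
  interleave : ∀ i j, i ≤ j → j < r → a (i + 1) (j + 1) ≤ a i j ∧ a i (j + 1) ≤ a (i + 1) (j + 1)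
  outside : ∀ i j, ¬(i ≤ j ∧ j ≤ r) → a i j = 0

namespace Crystal

variable {r : ℕ} {μ : Weight r}

theorem ext_a {S T : Crystal r μ} (h : S.a = T.a) : S = T := by
  cases S; cases T; simp_all

theorem abs_le (T : Crystal r μ) (i j : ℕ) : |T.a i j| ≤ ∑ k, |μ k| := by
  have h0 : (0 : ℤ) ≤ ∑ k, |μ k| := Finset.sum_nonneg fun _ _ => abs_nonneg _
  induction i generalizing j with
  | zero =>
    by_cases hj : j ≤ r
    · have := T.top ⟨j, by omega⟩
      simp only at this
      rw [this]
      exact Finset.single_le_sum (f := fun k => |μ k|) (fun _ _ => abs_nonneg _)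
        (Finset.mem_univ _)
    · rw [T.outside 0 j (by omega)]; simpa using h0
  | succ i ih =>
    by_cases hj : i + 1 ≤ j ∧ j ≤ r
    · obtain ⟨j, rfl⟩ : ∃ j', j = j' + 1 := ⟨j - 1, by omega⟩
      have h := T.interleave i j (by omega) (by omega)
      have h1 := _root_.abs_le.1 (ih j)
      have h2 := _root_.abs_le.1 (ih (j + 1))
      exact _root_.abs_le.2 ⟨by linarith [h.2, h2.1], by linarith [h.1, h1.2]⟩
    · rw [T.outside _ _ hj]; simpa using h0

instance instFinite : Finite (Crystal r μ) := by
  let M : ℤ := ∑ k, |μ k|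
  let F : Crystal r μ → (Fin (r + 1) → Fin (r + 1) → Set.Icc (-M) M) := fun T i j =>
    ⟨T.a i j, _root_.abs_le.1 (T.abs_le i j)⟩
  refine Finite.of_injective F ?_
  intro S T h
  apply ext_a
  funext i j
  by_cases hij : i ≤ j ∧ j ≤ r
  · have := congrFun (congrFun h ⟨i, by omega⟩) ⟨j, by omega⟩
    exact congrArg Subtype.val this
  · rw [S.outside _ _ hij, T.outside _ _ hij]

noncomputable instance instFintype : Fintype (Crystal r μ) := Fintype.ofFinite _

/-- The sum of row `i` of the pattern: the number of letters `≤ r + 1 - i` of the tableau. -/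
def rowSum (T : Crystal r μ) (i : ℕ) : ℤ := ∑ j ∈ Finset.Icc i r, T.a i j

/-- The weight `(d_r, d_{r-1} - d_r, …, d_0 - d_1)`: the numbers of letters `1, …, r+1`. -/
def wt (T : Crystal r μ) : Weight r := fun m =>
  T.rowSum (r - (m : ℕ)) - T.rowSum (r - (m : ℕ) + 1)

/-- The signature count for the letters `c = r - i` and `c + 1`. The entry `j` of row `i + 1` of
the pattern belongs to one row of the tableau, which contains
`a_{i+1,j} - a_{i+2,j+1}` letters `c`, while the next row below it in the tableau contains
`a_{i,j} - a_{i+1,j+1}` letters `c + 1`. The count is the number of `c` minus the number of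
`c + 1` in the initial part of the row reading word (rows from bottom to top, each from left to
right) that ends with the letters `c` of this tableau row. -/
def signature (T : Crystal r μ) (i j : ℕ) : ℤ :=
  ∑ k ∈ Finset.Icc j r,
    ((T.a (i + 1) k - T.a (i + 2) (k + 1)) - (T.a i k - T.a (i + 1) (k + 1)))

/-- In the bracketing of the letters `c + 1` with later letters `c` of the reading word, the
rightmost unbracketed `c` lies in the tableau row belonging to `j`: the first time that the
signature count attains its maximum, which is positive (`j = r + 1` is the empty initial part,
with count `0`), is at `j`. -/
def IsPivot (T : Crystal r μ) (i j : ℕ) : Prop :=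
  i + 1 ≤ j ∧ j ≤ r ∧ (∀ k, j < k → k ≤ r + 1 → T.signature i k < T.signature i j) ∧
    ∀ k, i + 1 ≤ k → k ≤ j → T.signature i k ≤ T.signature i j

theorem IsPivot.lt {T : Crystal r μ} {i j : ℕ} (h : T.IsPivot i j) :
    T.a i j - T.a (i + 1) (j + 1) < T.a (i + 1) j - T.a (i + 2) (j + 1) := by
  obtain ⟨_, h2, h3, _⟩ := h
  have h4 := h3 (j + 1) (by omega) (by omega)
  unfold signature at h4
  rw [← Finset.add_sum_Ioc_eq_sum_Icc (a := j) (b := r) h2] at h4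
  have h5 : Finset.Ioc j r = Finset.Icc (j + 1) r := by ext; simp only [Finset.mem_Ioc, Finset.mem_Icc]; omega
  rw [h5] at h4
  linarith

/-- Decrease the entry `(i+1, j)` by one: one letter `r - i` of the tableau becomes
`r - i + 1`. -/
def lower (T : Crystal r μ) (i j : ℕ) (h : T.IsPivot i j) : Crystal r μ where
  a := fun i' j' => if i' = i + 1 ∧ j' = j then T.a i' j' - 1 else T.a i' j'
  top := by
    intro j'
    simpa using T.top j'
  outside := by
    intro i' j' hij
    have h1 := h.1
    have h2 := h.2.1
    rw [if_neg (by omega)]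
    exact T.outside i' j' hij
  interleave := by
    intro i' j' hi' hj'
    have h1 := h.1
    have h2 := h.2.1
    have hlt := h.lt
    have hI := T.interleave i' j' hi' hj'
    by_cases hA : i' = i ∧ j' + 1 = j
    · obtain ⟨rfl, rfl⟩ := hA
      rw [if_pos ⟨rfl, rfl⟩, if_neg (by omega), if_neg (by omega)]
      refine ⟨by linarith [hI.1], ?_⟩
      by_cases hr : j' + 1 < r
      · have hJ := T.interleave (i' + 1) (j' + 1) (by omega) hr
        linarith [hJ.2]
      · rw [T.outside (i' + 1) (j' + 1 + 1) (by omega),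
          T.outside (i' + 2) (j' + 1 + 1) (by omega)] at hlt
        linarith
    · by_cases hB : i' = i + 1 ∧ j' = j
      · obtain ⟨rfl, rfl⟩ := hB
        rw [if_neg (by omega), if_pos ⟨rfl, rfl⟩, if_neg (by omega)]
        refine ⟨?_, hI.2⟩
        have hJ := T.interleave i j' (by omega) hj'
        have : T.a (i + 1 + 1) (j' + 1) = T.a (i + 2) (j' + 1) := rfl
        linarith [hJ.1]
      · rw [if_neg (by omega), if_neg hB]
        by_cases hC : i' = i + 1 ∧ j' + 1 = j
        · rw [if_pos hC]
          exact ⟨hI.1, by linarith [hI.2]⟩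
        · rw [if_neg hC]
          exact hI

open Classical in
/-- The Kashiwara operator `f_s`; `none` stands for `0`. It changes the rightmost unbracketed
letter `s` into `s + 1` (with the simple roots numbered from `1`); here `s : Fin r` is numbered
from `0`, so that the entry to be changed is in row `r - s` of the pattern. -/
noncomputable def kashiwara (s : Fin r) (T : Crystal r μ) : Option (Crystal r μ) :=
  if h : ∃ j, T.IsPivot (s.rev : ℕ) j then some (T.lower _ _ h.choose_spec) else none

/-- `f_s ^ k`. -/
noncomputable def kashiwaraPow (s : Fin r) (k : ℕ) (T : Crystal r μ) : Option (Crystal r μ) :=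
  (fun x => x.bind (kashiwara s))^[k] (some T)

/-- `φ_s(T)`, the largest `k` with `f_s ^ k T ≠ 0`. -/
noncomputable def phi (s : Fin r) (T : Crystal r μ) : ℕ :=
  sSup {k | kashiwaraPow s k T ≠ none}

/-- The end `f_s ^ {φ_s(T)} T` of the `s`-string of `T`. -/
noncomputable def stringEnd (s : Fin r) (T : Crystal r μ) : Crystal r μ :=
  (kashiwaraPow s (phi s T) T).getD T

/-- The lengths of the segments of the path that starts at `T` and runs to the ends of the
strings with the labels listed in a word. -/
noncomputable def pathLengths : List (Fin r) → Crystal r μ → List ℕ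
  | [], _ => []
  | s :: l, T => phi s T :: pathLengths l (stringEnd s T)

end Crystal

/-- The reduced word `σ_1 σ_2 σ_1 ⋯ σ_{r-1} ⋯ σ_1 σ_r ⋯ σ_1` of the long element (the indices
are numbered from `0`). -/
def favouriteWord (r : ℕ) : List (Fin r) :=
  (List.finRange r).flatMap fun m => ((List.finRange r).filter (fun s => s ≤ m)).reverse

/-- The Berenstein-Zelevinsky-Littelmann array of a vertex: its row `i`
(`1 ≤ i ≤ r`) has the entries `b_{binom(r+1-i,2)+1}, …, b_{binom(r+2-i,2)}`, in the columns
`j = i, …, r`. Outside of the triangle the array is `0`. -/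
noncomputable def Crystal.bzl {r : ℕ} {μ : Weight r} (T : Crystal r μ) (i j : ℕ) : ℕ :=
  if 1 ≤ i ∧ i ≤ j ∧ j ≤ r then
    (Crystal.pathLengths (favouriteWord r) T).getD ((r + 1 - i).choose 2 + (j - i)) 0
  else 0

/-! ### Gelfand-Tsetlin coefficients -/

/-- The Gelfand-Tsetlin pattern `(a_{ij})` with top row `μ` and `Γ`-array `Γ`, recovered from
`Γ_{ij} = ∑_{k ≥ j} (a_{ik} - a_{i-1,k})`. -/
def patternOfArray {r : ℕ} (μ : Weight r) (Γ : ℕ → ℕ → ℕ) : ℕ → ℕ → ℤ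
  | 0, j => if h : j < r + 1 then μ ⟨j, h⟩ else 0
  | i + 1, j => patternOfArray μ Γ i j + (Γ (i + 1) j : ℤ) - (Γ (i + 1) (j + 1) : ℤ)

/-- The factor `g_{ij}` of the Gelfand-Tsetlin coefficient: with
`m = Γ_{i,j+1}` and `M = Γ_{i,j+1} + a_{i-1,j-1} - a_{i-1,j}` it is
`1` if `m = Γ_{ij} < M`, `h♭(Γ_{ij})` if `m < Γ_{ij} < M`, `g♭(Γ_{ij})` if `m < Γ_{ij} = M` and
`0` if `m = Γ_{ij} = M`. -/
noncomputable def gtFactor {r : ℕ} (gFlat hFlat : ℕ → ℂ) (μ : Weight r) (Γ : ℕ → ℕ → ℕ)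
    (i j : ℕ) : ℂ :=
  let m : ℤ := (Γ i (j + 1) : ℤ)
  let x : ℤ := (Γ i j : ℤ)
  let M : ℤ := (Γ i (j + 1) : ℤ) + patternOfArray μ Γ (i - 1) (j - 1)
    - patternOfArray μ Γ (i - 1) j
  if m = x ∧ x < M then 1
  else if m < x ∧ x < M then hFlat (Γ i j)
  else if m < x ∧ x = M then gFlat (Γ i j)
  else 0

/-- The Gelfand-Tsetlin coefficient of the array `Γ` for the top row `μ`. -/
noncomputable def gtCoeff {r : ℕ} (gFlat hFlat : ℕ → ℂ) (μ : Weight r) (Γ : ℕ → ℕ → ℕ) : ℂ :=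
  ∏ i ∈ Finset.Icc 1 r, ∏ j ∈ Finset.Icc i r, gtFactor gFlat hFlat μ Γ i j

/-- `∑_{b} G(b) x^{wt(b)}`, the sum over the crystal of highest weight `μ`; the coefficient of a
vertex is that of its Berenstein-Zelevinsky-Littelmann array. -/
noncomputable def crystalSum {r : ℕ} (gFlat hFlat : ℕ → ℂ) (μ : Weight r) : RatFun r :=
  ∑ b : Crystal r μ, const (gtCoeff gFlat hFlat μ b.bzl) * monomial b.wt

/-- `g♭(a) = v g_a`, for parameters `v, g_0, …, g_{n-1}`. -/
def gFlatOf {n : ℕ} (v : ℂ) (g : ZMod n → ℂ) (a : ℕ) : ℂ := v * g (a : ZMod n)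

/-- `h♭(a) = 1 - v` if `n ∣ a`, and `h♭(a) = 0` otherwise. -/
def hFlatOf (n : ℕ) (v : ℂ) (a : ℕ) : ℂ := if n ∣ a then 1 - v else 0

/-- `g♭(a) = q⁻¹ ∑_b χ(b)^a ψ(b)`, a sum over a field `k` with `q` elements; in the application
`k` is the residue field of a prime `p`, `χ` is the power residue symbol modulo `p`, and
`χ(b)^a = 0` for `b = 0`. -/
noncomputable def gFlatGauss {k : Type*} [Field k] [Fintype k] (χ : MulChar k ℂ)
    (ψ : AddChar k ℂ) (a : ℕ) : ℂ :=
  (Fintype.card k : ℂ)⁻¹ * gaussSum (χ ^ a) ψ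

/-- `h♭(a) = q⁻¹ ∑_b χ(b)^a`. -/
noncomputable def hFlatGauss {k : Type*} [Field k] [Fintype k] (χ : MulChar k ℂ) (a : ℕ) : ℂ :=
  (Fintype.card k : ℂ)⁻¹ * ∑ b : k, (χ ^ a) b

/-- The parameters `g_j = ∑_b χ(b)^j ψ(b)`, `j = 0, …, n - 1`. -/
noncomputable def gaussParameters (n : ℕ) {k : Type*} [Field k] [Fintype k] (χ : MulChar k ℂ)
    (ψ : AddChar k ℂ) (j : ZMod n) : ℂ :=
  gaussSum (χ ^ j.val) ψ

/-- The Schur function `s_μ(x_0, …, x_r)`, by the Weyl character formula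
`(∑_w sgn(w) x^{w(μ+ρ)}) / ∏_{i<j} (x_i - x_j)`. -/
noncomputable def schur {r : ℕ} (μ : Weight r) : RatFun r :=
  (∑ w : Weyl r, ((Equiv.Perm.sign w : ℤ) : RatFun r) * monomial (weightAct w (μ + rho r))) /
    ∏ i : Fin (r + 1), ∏ j ∈ Finset.Ioi i, (var i - var j)

end MetaplecticTokuyama

open MetaplecticTokuyama

/-! Let `P_R` be the sum of the `T_u` over the permutations of the first `R` coordinates
(`symmetrizer`). The proof is an induction on the rank. Applied to a suitable antidominant monomial,
`P_{R+1}` produces one row of a Gelfand-Tsetlin pattern, and what remains is `P_R` applied to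
monomials of the same kind, which produces the next row.

Relations. Every rational function is a sum of products `h x^{ν+ρ}` with `h` in the component of `0`
and `0 ≤ ν_j < n`. The Bernstein relation carries `h` past `T_i`, so the commutation and braid
relations have to be checked only on the monomials `x^{ν+ρ}`, where the `T_i` act by constant
matrices on orbits of `ν` (`demazureLusztig_commute`, `demazureLusztig_braid`). Normal forms in the
symmetric group then identify `∑ T_u`, for any choice of reduced words, with a product of coset
sums, `P_{R+1} = P_R (1 + T_{R-1} + T_{R-1} T_{R-2} + ⋯)` (`sum_reducedWords`). Moreover `1 + T_i`
is a right factor of `P_R` for `i + 2 ≤ R` (`symmetrizer_dvd`).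

One row (`symmetrizer_initialMonomial`). By induction `P_{R+2}(x^κ x_{R+1}^e)` reduces to `P_{R+1}`
applied to an expression with a single `T_R`, which is expanded in powers of `x_{R+1}`. For `e =
κ_{R+1}` its coefficients differ from the wanted row polynomials by error terms, and `P_{R+1}` must
kill these. They are controlled by the exponent `e = κ_R - 1`: there `T_R` acts by `-1`, so the
right factor `1 + T_R` makes the whole expression vanish, and since `x_{R+1}` can be scaled
independently every coefficient vanishes. The hypotheses `g_0 = -1` and `g_j g_{n-j} = v⁻¹` are
exactly what turns this vanishing into that of the error terms.

Crystal. Along the path of the favourite word each string pushes one row of the pattern onto the row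
above it, so the path lengths are the sums `Γ_{ij} = ∑_{k ≥ j} (a_{ik} - a_{i-1,k})`
(`Crystal.bzl_eq_gam`). Removing the top row therefore gives the crystal sum the recursion satisfied
by the symmetrizer, and both sides vanish when the top row has equal neighbours
(`symmetrizer_eq_crystalPoly`).

Gauss sums satisfy the parameter conditions because `q ≡ 1 mod 2n` makes `-1` an `n`-th power. For
`n = 1` the symmetrizer is `P(1)` times the Weyl antisymmetrizer (`symmetrizer_unit`), and `P(1)` is
the deformed denominator, obtained from the row identity with `κ = 0`. -/

namespace MetaplecticTokuyama

/-! ### Explicit formulas for the Demazure-Lusztig operators on monomials. -/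

section

variable {n r : ℕ}

/-! ### Monomials and automorphisms -/

theorem var_ne_zero (i : Fin (r + 1)) : (var i : RatFun r) ≠ 0 := by
  unfold var
  rw [Ne, map_eq_zero_iff _ (IsFractionRing.injective (MvPolynomial (Fin (r + 1)) ℂ) (RatFun r))]
  exact MvPolynomial.X_ne_zero i

theorem monomial_ne_zero (μ : Weight r) : (monomial μ : RatFun r) ≠ 0 :=
  Finset.prod_ne_zero_iff.2 fun i _ => zpow_ne_zero _ (var_ne_zero i)

theorem monomial_zero : (monomial (0 : Weight r) : RatFun r) = 1 := by
  simp [monomial]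

theorem monomial_add (μ ν : Weight r) :
    (monomial (μ + ν) : RatFun r) = monomial μ * monomial ν := by
  unfold monomial
  rw [← Finset.prod_mul_distrib]
  exact Finset.prod_congr rfl fun i _ => zpow_add₀ (var_ne_zero i) _ _

theorem monomial_neg (μ : Weight r) : (monomial (-μ) : RatFun r) = (monomial μ)⁻¹ := by
  unfold monomial
  rw [← Finset.prod_inv_distrib]
  exact Finset.prod_congr rfl fun i _ => by simp

theorem monomial_sub (μ ν : Weight r) :
    (monomial (μ - ν) : RatFun r) = monomial μ / monomial ν := by
  rw [sub_eq_add_neg, monomial_add, monomial_neg, div_eq_mul_inv]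

theorem monomial_zsmul (k : ℤ) (μ : Weight r) :
    (monomial (k • μ) : RatFun r) = monomial μ ^ k := by
  unfold monomial
  rw [← Finset.prod_zpow]
  exact Finset.prod_congr rfl fun i _ => by
    rw [← zpow_mul, Pi.smul_apply, smul_eq_mul, mul_comm]

theorem monomial_nsmul (k : ℕ) (μ : Weight r) :
    (monomial (k • μ) : RatFun r) = monomial μ ^ k := by
  rw [← natCast_zsmul, monomial_zsmul, zpow_natCast]

theorem monomial_single (i : Fin (r + 1)) : (monomial (Pi.single i 1) : RatFun r) = var i := by
  unfold monomial
  rw [Finset.prod_eq_single i]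
  · simp
  · intro j _ hj
    simp [hj]
  · simp

theorem monomial_single_zsmul (i : Fin (r + 1)) (k : ℤ) :
    (monomial (Pi.single i k) : RatFun r) = var i ^ k := by
  rw [← monomial_single, ← monomial_zsmul]
  congr 1
  ext j
  by_cases h : j = i
  · subst h; simp
  · simp [h]

theorem monomial_simpleRoot (i : Fin r) :
    (monomial (simpleRoot i) : RatFun r) = var i.castSucc / var i.succ := by
  rw [simpleRoot, monomial_sub, monomial_single, monomial_single]

/-- Algebra homomorphisms from the rational functions are determined by the variables. -/
theorem ratFun_algHom_ext {A : Type*} [Semiring A] [Algebra ℂ A] {φ ψ : RatFun r →ₐ[ℂ] A}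
    (h : ∀ i, φ (var i) = ψ (var i)) : φ = ψ := by
  apply IsLocalization.algHom_ext (nonZeroDivisors (MvPolynomial (Fin (r + 1)) ℂ))
  apply MvPolynomial.algHom_ext
  intro i
  exact h i

theorem ratFun_algEquiv_comm {φ ψ φ' ψ' : RatFun r ≃ₐ[ℂ] RatFun r}
    (h : ∀ i, φ (ψ (var i)) = φ' (ψ' (var i))) (f : RatFun r) : φ (ψ f) = φ' (ψ' f) := by
  have := ratFun_algHom_ext (φ := φ.toAlgHom.comp ψ.toAlgHom) (ψ := φ'.toAlgHom.comp ψ'.toAlgHom) h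
  exact DFunLike.congr_fun this f

theorem map_monomial {F : Type*} [FunLike F (RatFun r) (RatFun r)]
    [RingHomClass F (RatFun r) (RatFun r)] (φ : F) (μ : Weight r) :
    φ (monomial μ) = ∏ i, φ (var i) ^ μ i := by
  unfold monomial
  rw [map_prod]
  exact Finset.prod_congr rfl fun i _ => map_zpow₀ _ _ _

theorem map_const {F : Type*} [FunLike F (RatFun r) (RatFun r)]
    [AlgHomClass F ℂ (RatFun r) (RatFun r)] (φ : F) (c : ℂ) : φ (const c) = const c :=
  AlgHomClass.commutes φ c

theorem const_smul (c : ℂ) (f : RatFun r) : c • f = const c * f := Algebra.smul_def c f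

theorem const_zero : (const 0 : RatFun r) = 0 := map_zero _

theorem const_one : (const 1 : RatFun r) = 1 := map_one _

theorem const_mul (a b : ℂ) : (const (a * b) : RatFun r) = const a * const b := map_mul _ _ _

theorem const_sub (a b : ℂ) : (const (a - b) : RatFun r) = const a - const b := map_sub _ _ _

theorem const_neg (a : ℂ) : (const (-a) : RatFun r) = -const a := map_neg _ _

theorem const_ne_zero {a : ℂ} (h : a ≠ 0) : (const a : RatFun r) ≠ 0 :=
  (map_ne_zero _).2 h

theorem ordinaryAct_var (w : Weyl r) (i : Fin (r + 1)) :
    ordinaryAct w (var i : RatFun r) = var (w i) := by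
  unfold ordinaryAct var
  rw [IsFractionRing.fieldEquivOfAlgEquiv_algebraMap]
  simp

theorem ordinaryAct_monomial (w : Weyl r) (μ : Weight r) :
    ordinaryAct w (monomial μ : RatFun r) = monomial (weightAct w μ) := by
  rw [map_monomial]
  unfold monomial weightAct
  rw [← Equiv.prod_comp w (fun i => var i ^ μ (w⁻¹ i))]
  exact Finset.prod_congr rfl fun i _ => by simp [ordinaryAct_var]

theorem ordinaryAct_mul (w w' : Weyl r) (f : RatFun r) :
    ordinaryAct (w * w') f = ordinaryAct w (ordinaryAct w' f) := by
  have := ratFun_algHom_ext (φ := (ordinaryAct (w * w')).toAlgHom)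
    (ψ := (ordinaryAct w).toAlgHom.comp (ordinaryAct w').toAlgHom) (fun i => by
      simp [ordinaryAct_var])
  exact DFunLike.congr_fun this f

theorem ordinaryAct_one (f : RatFun r) : ordinaryAct 1 f = f := by
  have := ratFun_algHom_ext (φ := (ordinaryAct (1 : Weyl r)).toAlgHom)
    (ψ := AlgHom.id ℂ _) (fun i => by simp [ordinaryAct_var])
  exact DFunLike.congr_fun this f

theorem twist_var (ξ : AddChar (Weight r ⧸ sublattice n r) ℂ) (i : Fin (r + 1)) :
    twist ξ (var i) = ξ (QuotientAddGroup.mk (Pi.single i 1)) • var i := by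
  unfold twist var
  rw [IsFractionRing.fieldEquivOfAlgEquiv_algebraMap]
  change algebraMap _ _ (twistHom ξ _) = _
  simp only [twistHom, MvPolynomial.aeval_X, map_mul]
  rw [← MvPolynomial.algebraMap_eq, ← IsScalarTower.algebraMap_apply, ← Algebra.smul_def]

theorem addChar_zsmul {G : Type*} [AddCommGroup G] (ξ : AddChar G ℂ) (k : ℤ) (a : G) :
    ξ (k • a) = ξ a ^ k := AddChar.map_zsmul_eq_zpow ξ k a

theorem twist_monomial (ξ : AddChar (Weight r ⧸ sublattice n r) ℂ) (μ : Weight r) :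
    twist ξ (monomial μ) = ξ (QuotientAddGroup.mk μ) • monomial μ := by
  have hμ : (QuotientAddGroup.mk μ : Weight r ⧸ sublattice n r) =
      ∑ i, μ i • QuotientAddGroup.mk (Pi.single i 1) := by
    conv_lhs => rw [← Finset.univ_sum_single μ]
    rw [← QuotientAddGroup.coe_mk', map_sum]
    refine Finset.sum_congr rfl fun i _ => ?_
    rw [← map_zsmul]
    congr 1
    ext j
    by_cases h : j = i
    · subst h; simp
    · simp [h]
  have hsum : ∀ s : Finset (Fin (r + 1)), ξ (∑ i ∈ s, μ i • QuotientAddGroup.mk (Pi.single i 1))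
      = ∏ i ∈ s, ξ (QuotientAddGroup.mk (Pi.single i 1)) ^ μ i := by
    intro s
    induction s using Finset.cons_induction with
    | empty => simp
    | cons a s ha ih =>
      rw [Finset.sum_cons, Finset.prod_cons, AddChar.map_add_eq_mul, ih, addChar_zsmul]
  rw [map_monomial, hμ, hsum, Algebra.smul_def, map_prod]
  unfold monomial
  rw [← Finset.prod_mul_distrib]
  refine Finset.prod_congr rfl fun i _ => ?_
  rw [twist_var, Algebra.smul_def, mul_zpow, map_zpow₀]

theorem monomial_mem_component (μ : Weight r) :
    (monomial μ : RatFun r) ∈ component (QuotientAddGroup.mk μ : Weight r ⧸ sublattice n r) :=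
  fun ξ => twist_monomial ξ μ

theorem monomial_mul_mem_component (η μ : Weight r) {f : RatFun r}
    (hf : f ∈ component (QuotientAddGroup.mk μ : Weight r ⧸ sublattice n r)) :
    monomial η * f ∈ component (QuotientAddGroup.mk (η + μ) : Weight r ⧸ sublattice n r) := by
  intro ξ
  rw [map_mul, twist_monomial, hf ξ, QuotientAddGroup.mk_add, AddChar.map_add_eq_mul,
    smul_mul_smul_comm]

theorem twist_smul (ξ : AddChar (Weight r ⧸ sublattice n r) ℂ) (c : ℂ) (f : RatFun r) :
    twist ξ (c • f) = c • twist ξ f := by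
  rw [const_smul, map_mul, map_const, const_smul]

theorem twist_add (ξ ξ' : AddChar (Weight r ⧸ sublattice n r) ℂ) (f : RatFun r) :
    twist (ξ + ξ') f = twist ξ (twist ξ' f) := by
  have := ratFun_algHom_ext (φ := (twist (ξ + ξ')).toAlgHom)
    (ψ := (twist ξ).toAlgHom.comp (twist ξ').toAlgHom) (fun i => by
      simp [twist_var, twist_smul, smul_smul, mul_comm])
  exact DFunLike.congr_fun this f

theorem proj_mem_component [NeZero n] (μ : Weight r ⧸ sublattice n r) (f : RatFun r) :
    proj μ f ∈ component μ := by
  intro ξ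
  simp only [proj, LinearMap.smul_apply, LinearMap.sum_apply, AlgEquiv.toLinearMap_apply,
    twist_smul, map_sum, ← twist_add]
  rw [smul_comm]
  congr 1
  rw [Finset.smul_sum]
  refine Fintype.sum_equiv (Equiv.addLeft ξ) _ _ fun ξ' => ?_
  rw [smul_smul]
  congr 1
  simp only [Equiv.coe_addLeft, AddChar.add_apply]
  rw [← mul_assoc, ← AddChar.map_add_eq_mul]
  simp

/-- A monomial `x_i^k` is not a constant multiple of `x_j^k`. -/
theorem var_pow_ne {i j : Fin (r + 1)} (hij : i ≠ j) {k : ℕ} (hk : k ≠ 0) (c : ℂ) :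
    (var i : RatFun r) ^ k ≠ const c * var j ^ k := by
  intro h
  have h' : (MvPolynomial.X i : MvPolynomial (Fin (r + 1)) ℂ) ^ k
      = MvPolynomial.C c * MvPolynomial.X j ^ k := by
    apply IsFractionRing.injective (MvPolynomial (Fin (r + 1)) ℂ) (RatFun r)
    rw [map_pow, map_mul, map_pow, ← MvPolynomial.algebraMap_eq,
      ← IsScalarTower.algebraMap_apply]
    exact h
  have := congrArg (MvPolynomial.eval (Pi.single i 1 : Fin (r + 1) → ℂ)) h'
  simp [hij.symm, hk] at this

theorem one_sub_const_mul_ne_zero {i j : Fin (r + 1)} (hij : i ≠ j) {k : ℕ} (hk : k ≠ 0) (c : ℂ) :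
    (1 : RatFun r) - const c * (var i / var j) ^ k ≠ 0 := by
  intro h
  rw [sub_eq_zero, div_pow, mul_div_assoc', eq_div_iff (pow_ne_zero _ (var_ne_zero _)), one_mul] at h
  exact var_pow_ne hij.symm hk c h

theorem one_sub_ne_zero {i j : Fin (r + 1)} (hij : i ≠ j) {k : ℕ} (hk : k ≠ 0) :
    (1 : RatFun r) - (var i / var j) ^ k ≠ 0 := by
  simpa [const_one] using one_sub_const_mul_ne_zero (r := r) hij hk 1

/-! ### The Demazure-Lusztig operators on components -/

theorem castSucc_ne_succ' (i : Fin r) : i.castSucc ≠ i.succ := by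
  simp [Fin.ext_iff]

theorem demazureLusztig_apply [NeZero n] (v : ℂ) (g : ZMod n → ℂ) (i : Fin r) (f : RatFun r) :
    demazureLusztig n v g i f = (1 - const v * (var i.castSucc / var i.succ) ^ n) *
      ((1 - (var i.castSucc / var i.succ) ^ n)⁻¹ *
        (f - (var i.castSucc / var i.succ) ^ n * chintaGunnells n v g i f)) - f := by
  simp only [demazureLusztig, demazure, monomial_nsmul, monomial_simpleRoot]
  rfl

theorem weightAct_simpleReflection (i : Fin r) (μ : Weight r) :
    weightAct (simpleReflection i) μ = μ + (μ i.succ - μ i.castSucc) • simpleRoot i := by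
  ext j
  simp only [weightAct, simpleReflection, Equiv.swap_inv, simpleRoot, Pi.add_apply, Pi.smul_apply,
    Pi.sub_apply, smul_eq_mul]
  by_cases h1 : j = i.castSucc
  · subst h1
    have := castSucc_ne_succ' i
    simp [this]
  · by_cases h2 : j = i.succ
    · subst h2
      simp [(castSucc_ne_succ' i).symm]
    · simp [Equiv.swap_apply_of_ne_of_ne h1 h2, h1, h2]

/-- The Demazure-Lusztig operator on a monomial. -/
theorem demazureLusztig_monomial [NeZero n] (v : ℂ) (g : ZMod n → ℂ) (i : Fin r) (μ : Weight r)
    (d : ℤ) (hd : d = μ i.succ - μ i.castSucc) :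
    demazureLusztig n v g i (monomial μ) =
      const (1 - v) * ((var i.castSucc / var i.succ) ^ n -
          ((var i.castSucc / var i.succ) ^ n) ^ (1 + d / (n : ℤ))) /
        (1 - (var i.castSucc / var i.succ) ^ n) * monomial μ
      + const (v * g ((1 + d : ℤ) : ZMod n)) * monomial (μ + (d + 1) • simpleRoot i) := by
  rw [demazureLusztig_apply, chintaGunnells_of_mem n v g i μ (monomial_mem_component μ),
    ordinaryAct_monomial, weightAct_simpleReflection, ← hd, monomial_add, monomial_add,
    monomial_zsmul, monomial_zsmul, monomial_simpleRoot, chintaGunnellsFactor, ← hd]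
  have hy : (var i.castSucc / var i.succ : RatFun r) ≠ 0 :=
    div_ne_zero (var_ne_zero _) (var_ne_zero _)
  have h1 := one_sub_ne_zero (castSucc_ne_succ' i) (NeZero.ne n)
  have h2 := one_sub_const_mul_ne_zero (castSucc_ne_succ' i) (NeZero.ne n) v
  set y : RatFun r := var i.castSucc / var i.succ with hydef
  -- Splitting `d` into quotient and remainder modulo `n` cancels the `y ^ (-(d mod n))` of the
  -- action against the `y ^ d` of the reflected monomial; only powers of `y ^ n` survive.
  have e1 : y ^ d = (y ^ n) ^ (d / (n : ℤ)) * y ^ (d % (n : ℤ)) := by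
    rw [← zpow_natCast y n, ← zpow_mul, ← zpow_add₀ hy, Int.mul_ediv_add_emod]
  have hX : y ^ n ≠ 0 := pow_ne_zero _ hy
  have e2 : y ^ (1 - (n : ℤ)) = y / y ^ n := by
    rw [zpow_sub₀ hy, zpow_one, zpow_natCast]
  have e3 : y ^ (-(d % (n : ℤ))) = (y ^ (d % (n : ℤ)))⁻¹ := zpow_neg _ _
  have e4 : y ^ (d + 1) = y ^ d * y := zpow_add_one₀ hy d
  have e5 : (y ^ n) ^ (1 + d / (n : ℤ)) = y ^ n * (y ^ n) ^ (d / (n : ℤ)) := by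
    rw [zpow_add₀ hX, zpow_one]
  have e6 : y ^ (d % (n : ℤ)) ≠ 0 := zpow_ne_zero _ hy
  rw [e2, e3, e4, e5, e1, const_sub, const_one]
  generalize y ^ (d % (n : ℤ)) = z at *
  generalize (y ^ n) ^ (d / (n : ℤ)) = Z at *
  generalize const (v * g ((1 + d : ℤ) : ZMod n)) = G at *
  generalize y ^ n = X at *
  generalize (const v : RatFun r) = V at *
  field_simp
  ring

/-- Multiplication by `x^η` commutes with the operator if `η_i = η_{i+1}`. -/
theorem demazureLusztig_monomial_mul [NeZero n] (v : ℂ) (g : ZMod n → ℂ) (i : Fin r)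
    (η : Weight r) (hη : η i.succ = η i.castSucc) (f : RatFun r) :
    demazureLusztig n v g i (monomial η * f) = monomial η * demazureLusztig n v g i f := by
  have key : chintaGunnells n v g i (monomial η * f)
      = monomial η * chintaGunnells n v g i f := by
    -- The action is explicit only on components. Passing from `μ` to `η + μ` changes the component
    -- but not `μ_{i+1} - μ_i`, hence not the factor.
    rw [← sum_proj (n := n) f, Finset.mul_sum, map_sum, map_sum, Finset.mul_sum]
    refine Finset.sum_congr rfl fun q _ => ?_
    obtain ⟨μ, rfl⟩ := QuotientAddGroup.mk_surjective q
    have hm := proj_mem_component (QuotientAddGroup.mk μ : Weight r ⧸ sublattice n r) f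
    rw [chintaGunnells_of_mem n v g i _ (monomial_mul_mem_component η μ hm),
      chintaGunnells_of_mem n v g i _ hm, map_mul, ordinaryAct_monomial,
      weightAct_simpleReflection, hη]
    have : chintaGunnellsFactor n v g i (η + μ) = chintaGunnellsFactor n v g i μ := by
      unfold chintaGunnellsFactor
      simp [hη]
    rw [this]
    simp [mul_assoc]
  rw [demazureLusztig_apply, demazureLusztig_apply, key]
  ring

end

/-! ### The Bernstein relation and its use in transporting Hecke relations. -/

section

variable {n r : ℕ}

/-! ### Multiplication by invariant functions -/

/-- The functions fixed by all the twists, i.e. the component of `0`. -/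
def IsInvariant (n : ℕ) {r : ℕ} (h : RatFun r) : Prop :=
  ∀ ξ : AddChar (Weight r ⧸ sublattice n r) ℂ, twist ξ h = h

theorem IsInvariant.mul {h k : RatFun r} (hh : IsInvariant n h) (hk : IsInvariant n k) :
    IsInvariant n (h * k) := fun ξ => by rw [map_mul, hh ξ, hk ξ]

theorem IsInvariant.sub {h k : RatFun r} (hh : IsInvariant n h) (hk : IsInvariant n k) :
    IsInvariant n (h - k) := fun ξ => by rw [map_sub, hh ξ, hk ξ]

theorem IsInvariant.div {h k : RatFun r} (hh : IsInvariant n h) (hk : IsInvariant n k) :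
    IsInvariant n (h / k) := fun ξ => by rw [map_div₀, hh ξ, hk ξ]

theorem isInvariant_const (c : ℂ) : IsInvariant n (const c : RatFun r) := fun _ => map_const _ c

theorem isInvariant_one : IsInvariant n (1 : RatFun r) := fun _ => map_one _

theorem isInvariant_monomial {η : Weight r} (hη : η ∈ sublattice n r) :
    IsInvariant n (monomial η : RatFun r) := fun ξ => by
  rw [twist_monomial, (QuotientAddGroup.eq_zero_iff η).2 hη, AddChar.map_zero_eq_one, one_smul]

theorem mem_sublattice_of_dvd {η : Weight r} (hη : ∀ i, (n : ℤ) ∣ η i) : η ∈ sublattice n r :=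
  fun i j => dvd_sub (hη i) (hη j)

theorem isInvariant_root (i : Fin r) :
    IsInvariant n ((var i.castSucc / var i.succ : RatFun r) ^ n) := by
  rw [← monomial_simpleRoot, ← monomial_nsmul]
  exact isInvariant_monomial (mem_sublattice_of_dvd fun k => by simp)

/-- The action of a permutation of the coordinates on `Λ/Λ₀`. -/
def quotientAct (w : Weyl r) :
    (Weight r ⧸ sublattice n r) →+ (Weight r ⧸ sublattice n r) :=
  QuotientAddGroup.map _ _
    { toFun := weightAct w, map_zero' := rfl, map_add' := fun _ _ => rfl }
    (fun _ hη i j => hη (w⁻¹ i) (w⁻¹ j))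

/-- Permutations of the variables permute the characters of `Λ/Λ₀`. The consequence needed is that
the field of invariant functions is stable under `W`. -/
theorem twist_ordinaryAct (ξ : AddChar (Weight r ⧸ sublattice n r) ℂ) (w : Weyl r)
    (f : RatFun r) :
    twist ξ (ordinaryAct w f) = ordinaryAct w (twist (ξ.compAddMonoidHom (quotientAct w)) f) := by
  refine ratFun_algEquiv_comm (fun i => ?_) f
  rw [ordinaryAct_var, twist_var, twist_var, const_smul, const_smul, map_mul, map_const,
    ordinaryAct_var]
  have hq : quotientAct w (QuotientAddGroup.mk (Pi.single i 1) : Weight r ⧸ sublattice n r)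
      = QuotientAddGroup.mk (Pi.single (w i) 1) := by
    change QuotientAddGroup.mk (weightAct w (Pi.single i 1)) = _
    congr 1
    ext j
    simp only [weightAct, Pi.single_apply]
    exact if_congr (by rw [Equiv.Perm.inv_eq_iff_eq]) rfl rfl
  rw [AddChar.compAddMonoidHom_apply, hq]

theorem IsInvariant.ordinaryAct {h : RatFun r} (hh : IsInvariant n h) (w : Weyl r) :
    IsInvariant n (ordinaryAct w h) := fun ξ => by rw [twist_ordinaryAct, hh]

theorem chintaGunnells_invariant_mul [NeZero n] (v : ℂ) (g : ZMod n → ℂ) (i : Fin r)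
    {h : RatFun r} (hh : IsInvariant n h) (f : RatFun r) :
    chintaGunnells n v g i (h * f) =
      ordinaryAct (simpleReflection i) h * chintaGunnells n v g i f := by
  -- Multiplication by a function of degree `0` preserves the grading, so it commutes with the
  -- projections.
  have hp : ∀ μ : Weight r ⧸ sublattice n r, proj μ (h * f) = h * proj μ f := by
    intro μ
    simp only [proj, LinearMap.smul_apply, LinearMap.sum_apply, AlgEquiv.toLinearMap_apply,
      map_mul, hh _, const_smul, Finset.mul_sum]
    exact Finset.sum_congr rfl fun _ _ => by ring
  simp only [chintaGunnells, LinearMap.sum_apply, LinearMap.comp_apply, hp,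
    AlgEquiv.toLinearMap_apply, map_mul, LinearMap.mulRight_apply, Finset.mul_sum, mul_assoc]

/-- The rational function in the Bernstein relation. -/
noncomputable def bernsteinFactor (n : ℕ) {r : ℕ} (v : ℂ) (i j : Fin (r + 1)) : RatFun r :=
  const (1 - v) * (var i / var j) ^ n / (1 - (var i / var j) ^ n)

/-- The Bernstein relation. -/
theorem demazureLusztig_invariant_mul [NeZero n] (v : ℂ) (g : ZMod n → ℂ) (i : Fin r)
    {h : RatFun r} (hh : IsInvariant n h) (f : RatFun r) :
    demazureLusztig n v g i (h * f) =
      ordinaryAct (simpleReflection i) h * demazureLusztig n v g i f +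
        (h - ordinaryAct (simpleReflection i) h) * bernsteinFactor n v i.castSucc i.succ * f := by
  rw [demazureLusztig_apply, demazureLusztig_apply, chintaGunnells_invariant_mul v g i hh,
    bernsteinFactor, const_sub, const_one]
  have h1 := one_sub_ne_zero (castSucc_ne_succ' i) (NeZero.ne n)
  generalize (var i.castSucc / var i.succ : RatFun r) ^ n = X at *
  field_simp
  ring

/-- Linear maps that agree on the products of invariant functions with the monomials
`x^{ν+ρ}`, `0 ≤ ν_j < n`, are equal. -/
theorem linearMap_ext_invariant [NeZero n] {A B : Module.End ℂ (RatFun r)}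
    (H : ∀ h : RatFun r, IsInvariant n h → ∀ ν : Weight r, (∀ j, 0 ≤ ν j ∧ ν j < n) →
      A (h * monomial (ν + rho r)) = B (h * monomial (ν + rho r))) : A = B := by
  ext f
  rw [← sum_proj (n := n) f, map_sum, map_sum]
  refine Finset.sum_congr rfl fun q _ => ?_
  obtain ⟨μ, rfl⟩ := QuotientAddGroup.mk_surjective q
  have hm := proj_mem_component (QuotientAddGroup.mk μ : Weight r ⧸ sublattice n r) f
  set p := proj (QuotientAddGroup.mk μ : Weight r ⧸ sublattice n r) f
  have hn : (0 : ℤ) < n := by exact_mod_cast NeZero.pos n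
  -- The representative of the class of `μ - ρ` in the box `[0, n)^{r+1}`; dividing by `x^{ν+ρ}`
  -- brings the component of `μ` into degree `0`.
  let ν : Weight r := fun j => (μ j - rho r j) % n
  have hinv : IsInvariant n (monomial (-(ν + rho r)) * p) := by
    have h1 := monomial_mul_mem_component (-(ν + rho r)) μ hm
    have h2 : -(ν + rho r) + μ ∈ sublattice n r := by
      refine mem_sublattice_of_dvd fun j => ?_
      have : (-(ν + rho r) + μ) j = (μ j - rho r j) - (μ j - rho r j) % n := by
        simp [ν]; ring
      rw [this]
      exact Int.dvd_self_sub_emod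
    rw [(QuotientAddGroup.eq_zero_iff _).2 h2] at h1
    intro ξ
    rw [h1 ξ, AddChar.map_zero_eq_one, one_smul]
  have := H _ hinv ν fun j => ⟨Int.emod_nonneg _ hn.ne', Int.emod_lt_of_pos _ hn⟩
  rwa [mul_right_comm, ← monomial_add, neg_add_cancel, monomial_zero, one_mul] at this

/-! ### The finite Hecke algebra action -/

/-- With `c = d + 1` in `(0, n]` the floor of `d / n` is `0`, so the fraction in the general formula
vanishes. -/
theorem demazureLusztig_monomial_pos [NeZero n] (v : ℂ) (g : ZMod n → ℂ) (i : Fin r)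
    (μ : Weight r) (c : ℤ) (hc : c = μ i.succ - μ i.castSucc + 1) (h0 : 0 < c) (hn : c ≤ n) :
    demazureLusztig n v g i (monomial μ) =
      const (v * g (c : ZMod n)) * monomial (μ + c • simpleRoot i) := by
  rw [demazureLusztig_monomial v g i μ (c - 1) (by omega),
    Int.ediv_eq_zero_of_lt (by omega) (by omega)]
  simp

/-- With `c = d + 1` in `(-n, 0]` the floor of `d / n` is `-1`, and the fraction becomes `(X - 1) /
(1 - X) = -1` for `X = y ^ n`. -/
theorem demazureLusztig_monomial_nonpos [NeZero n] (v : ℂ) (g : ZMod n → ℂ) (i : Fin r)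
    (μ : Weight r) (c : ℤ) (hc : c = μ i.succ - μ i.castSucc + 1) (h0 : c ≤ 0) (hn : -n < c) :
    demazureLusztig n v g i (monomial μ) = const (v - 1) * monomial μ +
      const (v * g (c : ZMod n)) * monomial (μ + c • simpleRoot i) := by
  have hd : (c - 1) / (n : ℤ) = -1 := by
    rw [Int.ediv_eq_iff_of_pos (by omega)]
    omega
  have h1 := one_sub_ne_zero (castSucc_ne_succ' i) (NeZero.ne n)
  rw [demazureLusztig_monomial v g i μ (c - 1) (by omega), hd]
  simp only [add_neg_cancel, zpow_zero, add_sub_cancel, sub_add_cancel]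
  congr 2
  generalize (var i.castSucc / var i.succ : RatFun r) ^ n = X at *
  simp only [const_sub, const_one]
  field_simp
  ring

/-- For `c = 0` both terms are multiples of the same monomial, with coefficients `v - 1` and `v g_0
= -v`. This eigenvalue `-1` is the source of every vanishing statement below: `1 + T_i` kills such
monomials. -/
theorem demazureLusztig_monomial_zero [NeZero n] {v : ℂ} {g : ZMod n → ℂ} (hg : g 0 = -1)
    (i : Fin r) (μ : Weight r) (hc : μ i.succ + 1 = μ i.castSucc) :
    demazureLusztig n v g i (monomial μ) = - monomial μ := by
  have hn : (0 : ℤ) < n := by exact_mod_cast NeZero.pos n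
  rw [demazureLusztig_monomial_nonpos v g i μ 0 (by omega) le_rfl (by omega)]
  simp only [Int.cast_zero, hg, zero_smul, add_zero, const_sub, const_one, mul_neg, mul_one,
    const_neg]
  ring

/-! ### Commutation and braid relations -/

/-- The Bernstein relations `hA`, `hB` are twisted Leibniz rules over the functions satisfying `I`,
so commutation at a generator `e` spreads to all `h * e`. It matters that each reflection fixes the
Bernstein factor of the other. -/
theorem commute_of_generators {K : Type*} [CommRing K] (A B : K →+ K) (s t : K →+* K)
    (I : K → Prop) (I_sub : ∀ h k, I h → I k → I (h - k)) (I_mul : ∀ h k, I h → I k → I (h * k))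
    (I_s : ∀ h, I h → I (s h)) (I_t : ∀ h, I h → I (t h)) (qa qb : K) (Iqa : I qa) (Iqb : I qb)
    (hA : ∀ h f, I h → A (h * f) = s h * A f + (h - s h) * qa * f)
    (hB : ∀ h f, I h → B (h * f) = t h * B f + (h - t h) * qb * f)
    (st : ∀ h, s (t h) = t (s h)) (sqb : s qb = qb) (tqa : t qa = qa)
    (e h : K) (hh : I h) (he : A (B e) = B (A e)) : A (B (h * e)) = B (A (h * e)) := by
  have h1 : I ((h - t h) * qb) := I_mul _ _ (I_sub _ _ hh (I_t _ hh)) Iqb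
  have h2 : I ((h - s h) * qa) := I_mul _ _ (I_sub _ _ hh (I_s _ hh)) Iqa
  rw [hB h e hh, hA h e hh, map_add, map_add, hA _ _ (I_t _ hh), hA _ _ h1, hB _ _ (I_s _ hh),
    hB _ _ h2]
  simp only [map_mul, map_sub, st, sqb, tqa, he]
  ring

/-- The rank two analogue. Moving `h` through three operators also produces `A (A e)` and `B (B e)`,
which is why the quadratic relations at `e` are assumed. The factor `qc` belongs to the sum of the
two simple roots, and `rel` links the three factors. -/
theorem braid_of_generators {K : Type*} [CommRing K] (A B : K →+ K) (s t : K →+* K)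
    (I : K → Prop) (I_sub : ∀ h k, I h → I k → I (h - k)) (I_mul : ∀ h k, I h → I k → I (h * k))
    (I_s : ∀ h, I h → I (s h)) (I_t : ∀ h, I h → I (t h)) (w v qa qb qc : K)
    (Iqa : I qa) (Iqb : I qb)
    (hA : ∀ h f, I h → A (h * f) = s h * A f + (h - s h) * qa * f)
    (hB : ∀ h f, I h → B (h * f) = t h * B f + (h - t h) * qb * f)
    (ss : ∀ h, s (s h) = h) (tt : ∀ h, t (t h) = h) (sts : ∀ h, s (t (s h)) = t (s (t h)))
    (sqa : s qa = -qa - w) (tqb : t qb = -qb - w) (sqb : s qb = qc) (tqa : t qa = qc)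
    (rel : qc * (w + qa + qb) = qa * qb)
    (e h : K) (hh : I h) (hAA : A (A e) = -w * A e + v * e) (hBB : B (B e) = -w * B e + v * e)
    (he : A (B (A e)) = B (A (B e))) : A (B (A (h * e))) = B (A (B (h * e))) := by
  have sqc : s qc = qb := by rw [← sqb, ss]
  have tqc : t qc = qa := by rw [← tqa, tt]
  have Iqc : I qc := by rw [← sqb]; exact I_s _ Iqb
  have a1 := I_s _ hh
  have a2 := I_t _ hh
  have a3 := I_t _ a1
  have a4 := I_s _ a2
  have c1 : I ((h - s h) * qa) := I_mul _ _ (I_sub _ _ hh a1) Iqa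
  have c2 : I ((h - t h) * qb) := I_mul _ _ (I_sub _ _ hh a2) Iqb
  have eBA : B (A (h * e)) = t (s h) * B (A e) + (s h - t (s h)) * qb * A e +
      (t h - t (s h)) * qc * B e + ((h - s h) * qa - (t h - t (s h)) * qc) * qb * e := by
    rw [hA h e hh, map_add, hB _ _ a1, hB _ _ c1]
    simp only [map_mul, map_sub, tqa]
    ring
  have eAB : A (B (h * e)) = s (t h) * A (B e) + (t h - s (t h)) * qa * B e +
      (s h - s (t h)) * qc * A e + ((h - t h) * qb - (s h - s (t h)) * qc) * qa * e := by
    rw [hB h e hh, map_add, hA _ _ a2, hA _ _ c2]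
    simp only [map_mul, map_sub, sqb]
    ring
  have d1 : I ((s h - t (s h)) * qb) := I_mul _ _ (I_sub _ _ a1 a3) Iqb
  have d2 : I ((t h - t (s h)) * qc) := I_mul _ _ (I_sub _ _ a2 a3) Iqc
  have d3 : I (((h - s h) * qa - (t h - t (s h)) * qc) * qb) := I_mul _ _ (I_sub _ _ c1 d2) Iqb
  have f1 : I ((t h - s (t h)) * qa) := I_mul _ _ (I_sub _ _ a2 a4) Iqa
  have f2 : I ((s h - s (t h)) * qc) := I_mul _ _ (I_sub _ _ a1 a4) Iqc
  have f3 : I (((h - t h) * qb - (s h - s (t h)) * qc) * qa) := I_mul _ _ (I_sub _ _ c2 f2) Iqa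
  rw [eBA, eAB, map_add, map_add, map_add, map_add, map_add, map_add, hA _ _ a3, hA _ _ d1,
    hA _ _ d2, hA _ _ d3, hB _ _ a4, hB _ _ f1, hB _ _ f2, hB _ _ f3]
  simp only [map_mul, map_sub, sqa, sqb, sqc, tqa, tqb, tqc, ss, tt, sts, hAA, hBB, he]
  -- The words in `A`, `B` of length two and three already agree; the coefficients of `A e`, `B e`
  -- and `e` differ by multiples of `rel`.
  linear_combination (A e * (t (s (t h)) - s h) - B e * (t (s (t h)) - t h)
    - e * (h * (qa - qb) - qa * s h + qb * t h)) * rel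

end

/-! ### The quadratic, commutation and braid relations of the operators. -/

section

variable {n r : ℕ}

theorem ordinaryAct_simpleReflection_self (i : Fin r) (f : RatFun r) :
    ordinaryAct (simpleReflection i) (ordinaryAct (simpleReflection i) f) = f := by
  rw [← ordinaryAct_mul, simpleReflection, Equiv.swap_mul_self, ordinaryAct_one]

theorem ordinaryAct_bernsteinFactor (w : Weyl r) (v : ℂ) (i j : Fin (r + 1)) :
    ordinaryAct w (bernsteinFactor n v i j) = bernsteinFactor n v (w i) (w j) := by
  simp only [bernsteinFactor, map_div₀, map_mul, map_sub, map_one, map_pow, map_const,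
    ordinaryAct_var]

theorem isInvariant_bernsteinFactor (v : ℂ) (i : Fin r) :
    IsInvariant n (bernsteinFactor n v i.castSucc i.succ) :=
  ((isInvariant_const _).mul (isInvariant_root i)).div (isInvariant_one.sub (isInvariant_root i))

theorem bernsteinFactor_swap [NeZero n] (v : ℂ) {i j : Fin (r + 1)} (h : i ≠ j) :
    bernsteinFactor n v j i = -bernsteinFactor n v i j - const (1 - v) := by
  have h1 := one_sub_ne_zero h (NeZero.ne n)
  have h2 := one_sub_ne_zero h.symm (NeZero.ne n)
  have e : (var j / var i : RatFun r) ^ n = ((var i / var j) ^ n)⁻¹ := by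
    rw [← inv_pow, inv_div]
  unfold bernsteinFactor
  rw [e] at h2 ⊢
  have h3 : (var i / var j : RatFun r) ^ n ≠ 0 :=
    pow_ne_zero _ (div_ne_zero (var_ne_zero _) (var_ne_zero _))
  generalize (var i / var j : RatFun r) ^ n = X at *
  have h4 : X - 1 ≠ 0 := by
    intro h; apply h1; linear_combination -h
  field_simp
  ring

/-- With `X`, `Y` for the two roots and `XY` for their sum, this rests on `1 + X/(1-X) + Y/(1-Y) =
(1 - XY)/((1-X)(1-Y))`, scaled by `(1 - v)^2`. -/
theorem bernsteinFactor_mul [NeZero n] (v : ℂ) {i j k : Fin (r + 1)} (hij : i ≠ j) (hjk : j ≠ k)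
    (hik : i ≠ k) :
    bernsteinFactor n v i k * (const (1 - v) + bernsteinFactor n v i j + bernsteinFactor n v j k) =
      bernsteinFactor n v i j * bernsteinFactor n v j k := by
  have h1 := one_sub_ne_zero hij (NeZero.ne n)
  have h2 := one_sub_ne_zero hjk (NeZero.ne n)
  have h3 := one_sub_ne_zero hik (NeZero.ne n)
  have e : (var i / var k : RatFun r) ^ n = (var i / var j) ^ n * (var j / var k) ^ n := by
    rw [← mul_pow, div_mul_div_cancel₀ (var_ne_zero _)]
  unfold bernsteinFactor
  rw [e] at h3 ⊢
  generalize (var i / var j : RatFun r) ^ n = X at *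
  generalize (var j / var k : RatFun r) ^ n = Y at *
  field_simp
  ring

/-- The values of the operator on the monomials `x^{ν+ρ}` with `0 ≤ ν_j < n`. -/
theorem demazureLusztig_box [NeZero n] {v : ℂ} {g : ZMod n → ℂ} (hg : g 0 = -1) (i : Fin r)
    {ν ν' : Weight r} (hν : ∀ j, 0 ≤ ν j ∧ ν j < n) (h' : ν' = weightAct (simpleReflection i) ν) :
    demazureLusztig n v g i (monomial (ν + rho r)) =
      (if ν i.castSucc < ν i.succ then 0 else
        if ν i.castSucc = ν i.succ then const (-1) else const (v - 1)) * monomial (ν + rho r) +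
      (if ν i.castSucc = ν i.succ then 0 else
        const (v * g ((ν i.succ - ν i.castSucc : ℤ) : ZMod n))) * monomial (ν' + rho r) := by
  have e : ν + rho r + (ν i.succ - ν i.castSucc) • simpleRoot i = ν' + rho r := by
    rw [h', weightAct_simpleReflection]; abel
  have hc : ν i.succ - ν i.castSucc = (ν + rho r) i.succ - (ν + rho r) i.castSucc + 1 := by
    simp [rho]; ring
  have h1 := hν i.succ
  have h2 := hν i.castSucc
  split_ifs with ha hb hb
  · omega
  · rw [demazureLusztig_monomial_pos v g i _ _ hc (by omega) (by omega), e, zero_mul, zero_add]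
  · rw [demazureLusztig_monomial_zero hg i _ (by omega)]
    simp [const_neg, const_one]
  · rw [demazureLusztig_monomial_nonpos v g i _ _ hc (by omega) (by omega), e]

theorem weightAct_box {ν : Weight r} (hν : ∀ j, 0 ≤ ν j ∧ ν j < n) (w : Weyl r) :
    ∀ j, 0 ≤ weightAct w ν j ∧ weightAct w ν j < n := fun j => hν (w⁻¹ j)

theorem weightAct_mul (w w' : Weyl r) (ν : Weight r) :
    weightAct (w * w') ν = weightAct w (weightAct w' ν) := by
  ext j; simp [weightAct, mul_inv_rev]

theorem weightAct_swap_eq {i : Fin r} {ν : Weight r} (h : ν i.castSucc = ν i.succ) :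
    weightAct (simpleReflection i) ν = ν := by
  rw [weightAct_simpleReflection, h]; simp

/-- The two off-diagonal entries of `T_i` between `x^{ν+ρ}` and `x^{σ_i ν+ρ}` multiply to `v`.
Distinct exponents in `[0, n)` have nonzero difference modulo `n`, so the condition on `g_j g_{-j}`
applies. -/
theorem parameter_mul [NeZero n] {v : ℂ} {g : ZMod n → ℂ} (hg : IsMetaplecticParameters n v g)
    {a b : ℤ} (ha : 0 ≤ a ∧ a < n) (hb : 0 ≤ b ∧ b < n) (hab : a ≠ b) :
    (const (v * g ((b - a : ℤ) : ZMod n)) * const (v * g ((a - b : ℤ) : ZMod n)) : RatFun r)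
      = const v := by
  have h0 : ((b - a : ℤ) : ZMod n) ≠ 0 := by
    intro h
    rw [ZMod.intCast_zmod_eq_zero_iff_dvd] at h
    obtain ⟨c, hc⟩ := h
    have hn : (0 : ℤ) < n := by exact_mod_cast NeZero.pos n
    have h1 : c < 1 := by nlinarith
    have h2 : -1 < c := by nlinarith
    have : c = 0 := by omega
    subst this
    apply hab; linarith
  have := hg.2 _ h0
  rw [← const_mul]
  congr 1
  have e : ((a - b : ℤ) : ZMod n) = -((b - a : ℤ) : ZMod n) := by push_cast; ring
  rw [e]
  linear_combination v * this

/-- On a pair of box monomials with `ν_i ≠ ν_{i+1}` the operator is a `2 × 2` matrix of trace `v -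
1` and determinant `-v`; for `ν_i = ν_{i+1}` it is the scalar `-1`. Both satisfy `T² = (v - 1) T +
v`. -/
theorem demazureLusztig_sq_box [NeZero n] {v : ℂ} {g : ZMod n → ℂ}
    (hg : IsMetaplecticParameters n v g) (i : Fin r) {ν : Weight r}
    (hν : ∀ j, 0 ≤ ν j ∧ ν j < n) :
    demazureLusztig n v g i (demazureLusztig n v g i (monomial (ν + rho r))) =
      -const (1 - v) * demazureLusztig n v g i (monomial (ν + rho r)) +
        const v * monomial (ν + rho r) := by
  set ν' := weightAct (simpleReflection i) ν with hν'
  have e1 := demazureLusztig_box (v := v) hg.1 i hν hν'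
  have e2 := demazureLusztig_box (v := v) (ν' := ν) hg.1 i (weightAct_box hν (simpleReflection i))
    (by rw [← weightAct_mul, simpleReflection, Equiv.swap_mul_self]; ext; simp [weightAct])
  rw [← hν'] at e2
  have p1 : ν' i.castSucc = ν i.succ := by simp [hν', weightAct, simpleReflection]
  have p2 : ν' i.succ = ν i.castSucc := by simp [hν', weightAct, simpleReflection]
  rw [p1, p2] at e2
  have hc : ∀ (c : ℂ) (f : RatFun r), demazureLusztig n v g i (const c * f) =
      const c * demazureLusztig n v g i f := by
    intro c f; rw [← const_smul, ← const_smul, map_smul]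
  rcases lt_trichotomy (ν i.castSucc) (ν i.succ) with h | h | h
  · have G := parameter_mul (r := r) hg (hν i.castSucc) (hν i.succ) h.ne
    simp only [h, h.ne, h.ne', h.not_gt, if_true, if_false, zero_mul, zero_add] at e1 e2
    rw [e1, hc, e2]
    simp only [const_sub, const_one] at G ⊢
    linear_combination monomial (ν + rho r) * G
  · simp only [h, lt_irrefl, if_true, if_false, zero_mul, add_zero] at e1
    rw [e1, hc, e1]
    simp only [const_sub, const_one, const_neg]
    ring
  · have G := parameter_mul (r := r) hg (hν i.succ) (hν i.castSucc) h.ne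
    simp only [h, h.ne, h.ne', h.not_gt, if_true, if_false, zero_mul, zero_add] at e1 e2
    rw [e1, map_add, hc, hc, e2, e1]
    simp only [const_sub, const_one] at G ⊢
    linear_combination monomial (ν + rho r) * G

theorem demazureLusztig_const_mul [NeZero n] (v : ℂ) (g : ZMod n → ℂ) (i : Fin r) (c : ℂ)
    (f : RatFun r) : demazureLusztig n v g i (const c * f) =
      const c * demazureLusztig n v g i f := by
  rw [← const_smul, ← const_smul, map_smul]

theorem demazureLusztig_commute [NeZero n] {v : ℂ} {g : ZMod n → ℂ}
    (hg : IsMetaplecticParameters n v g) (i j : Fin r) (hij : (i : ℕ) + 1 < j) :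
    demazureLusztig n v g i * demazureLusztig n v g j =
      demazureLusztig n v g j * demazureLusztig n v g i := by
  have n1 : j.castSucc ≠ i.castSucc := by simp [Fin.ext_iff]; omega
  have n2 : j.castSucc ≠ i.succ := by simp [Fin.ext_iff]; omega
  have n3 : j.succ ≠ i.castSucc := by simp [Fin.ext_iff]; omega
  have n4 : j.succ ≠ i.succ := by simp [Fin.ext_iff]; omega
  have comm : simpleReflection i * simpleReflection j = simpleReflection j * simpleReflection i :=
    (Equiv.Perm.disjoint_swap_swap (by simp [n1.symm, n2.symm, n3.symm, n4.symm,
      castSucc_ne_succ'])).commute.eq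
  apply linearMap_ext_invariant (n := n)
  intro h hh ν hν
  rw [Module.End.mul_apply, Module.End.mul_apply]
  refine commute_of_generators (demazureLusztig n v g i).toAddMonoidHom
    (demazureLusztig n v g j).toAddMonoidHom
    (ordinaryAct (simpleReflection i) : RatFun r →+* RatFun r)
    (ordinaryAct (simpleReflection j) : RatFun r →+* RatFun r) (IsInvariant n)
    (fun _ _ => IsInvariant.sub) (fun _ _ => IsInvariant.mul) (fun _ h => h.ordinaryAct _)
    (fun _ h => h.ordinaryAct _) _ _ (isInvariant_bernsteinFactor v i)
    (isInvariant_bernsteinFactor v j)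
    (fun _ f hk => demazureLusztig_invariant_mul v g i hk f)
    (fun _ f hk => demazureLusztig_invariant_mul v g j hk f)
    (fun k => by simp only [RingHom.coe_coe, ← ordinaryAct_mul, comm])
    ?_ ?_ _ h hh ?_
  · change ordinaryAct _ _ = _
    rw [ordinaryAct_bernsteinFactor, simpleReflection, Equiv.swap_apply_of_ne_of_ne n1 n2,
      Equiv.swap_apply_of_ne_of_ne n3 n4]
  · change ordinaryAct _ _ = _
    rw [ordinaryAct_bernsteinFactor, simpleReflection, Equiv.swap_apply_of_ne_of_ne n1.symm n3.symm,
      Equiv.swap_apply_of_ne_of_ne n2.symm n4.symm]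
  · change demazureLusztig n v g i (demazureLusztig n v g j _) =
      demazureLusztig n v g j (demazureLusztig n v g i _)
    have p1 : weightAct (simpleReflection i) ν j.castSucc = ν j.castSucc := by
      simp [weightAct, simpleReflection, Equiv.swap_apply_of_ne_of_ne n1 n2]
    have p2 : weightAct (simpleReflection i) ν j.succ = ν j.succ := by
      simp [weightAct, simpleReflection, Equiv.swap_apply_of_ne_of_ne n3 n4]
    have p3 : weightAct (simpleReflection j) ν i.castSucc = ν i.castSucc := by
      simp [weightAct, simpleReflection, Equiv.swap_apply_of_ne_of_ne n1.symm n3.symm]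
    have p4 : weightAct (simpleReflection j) ν i.succ = ν i.succ := by
      simp [weightAct, simpleReflection, Equiv.swap_apply_of_ne_of_ne n2.symm n4.symm]
    have ei := demazureLusztig_box (v := v) hg.1 i hν rfl
    have ej := demazureLusztig_box (v := v) hg.1 j hν rfl
    have eij := demazureLusztig_box (v := v) hg.1 j (weightAct_box hν (simpleReflection i)) rfl
    have eji := demazureLusztig_box (v := v) hg.1 i (weightAct_box hν (simpleReflection j)) rfl
    rw [p1, p2, ← weightAct_mul, ← comm] at eij
    rw [p3, p4, ← weightAct_mul] at eji
    -- With the case distinctions moved inside the constants, linearity applies and no splitting on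
    -- the order of the exponents is needed.
    have hif : ∀ (p q : ℤ) (a b c : ℂ),
        (if p < q then (0 : RatFun r) else if p = q then const a else const b) =
          const (if p < q then 0 else if p = q then a else b) := by
      intro p q a b c; split_ifs <;> simp [const_zero]
    have hif' : ∀ (p q : ℤ) (a : ℂ),
        (if p = q then (0 : RatFun r) else const a) = const (if p = q then 0 else a) := by
      intro p q a; split_ifs <;> simp [const_zero]
    simp only [hif _ _ _ _ 0, hif'] at ei ej eij eji
    rw [ei, ej, map_add, map_add]
    simp only [demazureLusztig_const_mul]
    rw [ei, ej, eij, eji]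
    ring

/-- After the reduction to box monomials both sides are explicit combinations of monomials in the
orbit of `ν` under `σ_i`, `σ_j`. Their coefficients depend on the relative order of three exponents
only in finitely many ways, and the thirteen weak orders are checked one by one. -/
theorem demazureLusztig_braid [NeZero n] {v : ℂ} {g : ZMod n → ℂ}
    (hg : IsMetaplecticParameters n v g) (i j : Fin r) (hij : (i : ℕ) + 1 = j) :
    demazureLusztig n v g i * demazureLusztig n v g j * demazureLusztig n v g i =
      demazureLusztig n v g j * demazureLusztig n v g i * demazureLusztig n v g j := by
  have hy : j.castSucc = i.succ := by simp [Fin.ext_iff]; omega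
  have n1 : i.castSucc ≠ i.succ := castSucc_ne_succ' i
  have n2 : i.succ ≠ j.succ := by simp [Fin.ext_iff]; omega
  have n3 : i.castSucc ≠ j.succ := by simp [Fin.ext_iff]; omega
  have braid : simpleReflection i * simpleReflection j * simpleReflection i =
      simpleReflection j * simpleReflection i * simpleReflection j := by
    unfold simpleReflection
    rw [hy, Equiv.swap_mul_swap_mul_swap n1 n3,
      Equiv.swap_comm i.castSucc i.succ, Equiv.swap_comm i.succ j.succ,
      Equiv.swap_mul_swap_mul_swap n2.symm n3.symm, Equiv.swap_comm]
  apply linearMap_ext_invariant (n := n)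
  intro h hh ν hν
  simp only [Module.End.mul_apply]
  refine braid_of_generators (demazureLusztig n v g i).toAddMonoidHom
    (demazureLusztig n v g j).toAddMonoidHom
    (ordinaryAct (simpleReflection i) : RatFun r →+* RatFun r)
    (ordinaryAct (simpleReflection j) : RatFun r →+* RatFun r) (IsInvariant n)
    (fun _ _ => IsInvariant.sub) (fun _ _ => IsInvariant.mul) (fun _ h => h.ordinaryAct _)
    (fun _ h => h.ordinaryAct _) (const (1 - v)) (const v) _ _
    (bernsteinFactor n v i.castSucc j.succ) (isInvariant_bernsteinFactor v i)
    (isInvariant_bernsteinFactor v j)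
    (fun _ f hk => demazureLusztig_invariant_mul v g i hk f)
    (fun _ f hk => demazureLusztig_invariant_mul v g j hk f)
    (ordinaryAct_simpleReflection_self i) (ordinaryAct_simpleReflection_self j)
    (fun k => by simp only [RingHom.coe_coe, ← ordinaryAct_mul, ← mul_assoc, braid])
    ?_ ?_ ?_ ?_ ?_ _ h hh (demazureLusztig_sq_box hg i hν) (demazureLusztig_sq_box hg j hν) ?_
  · change ordinaryAct _ _ = _
    rw [ordinaryAct_bernsteinFactor, simpleReflection, Equiv.swap_apply_left,
      Equiv.swap_apply_right, bernsteinFactor_swap v n1]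
  · change ordinaryAct _ _ = _
    rw [ordinaryAct_bernsteinFactor, simpleReflection, Equiv.swap_apply_left,
      Equiv.swap_apply_right, hy, bernsteinFactor_swap v n2]
  · change ordinaryAct _ _ = _
    rw [ordinaryAct_bernsteinFactor, simpleReflection, hy, Equiv.swap_apply_right,
      Equiv.swap_apply_of_ne_of_ne n3.symm n2.symm]
  · change ordinaryAct _ _ = _
    rw [ordinaryAct_bernsteinFactor, simpleReflection, hy, Equiv.swap_apply_left,
      Equiv.swap_apply_of_ne_of_ne n1 n3]
  · rw [hy]
    exact bernsteinFactor_mul v n1 n2 n3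
  · change demazureLusztig n v g i (demazureLusztig n v g j (demazureLusztig n v g i _)) =
      demazureLusztig n v g j (demazureLusztig n v g i (demazureLusztig n v g j _))
    set s := simpleReflection i with hs
    set t := simpleReflection j with ht
    have vals : ∀ κ : Weight r, weightAct s κ i.castSucc = κ i.succ ∧
        weightAct s κ i.succ = κ i.castSucc ∧ weightAct s κ j.succ = κ j.succ ∧
        weightAct t κ i.castSucc = κ i.castSucc ∧
        weightAct t κ i.succ = κ j.succ ∧ weightAct t κ j.succ = κ i.succ := by
      intro κ
      simp [weightAct, hs, ht, simpleReflection, hy, Equiv.swap_apply_of_ne_of_ne n3.symm n2.symm,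
        Equiv.swap_apply_of_ne_of_ne n1 n3]
    have ss : ∀ κ : Weight r, weightAct s (weightAct s κ) = κ := by
      intro κ; rw [← weightAct_mul, hs, simpleReflection, Equiv.swap_mul_self]; ext; simp [weightAct]
    have tt : ∀ κ : Weight r, weightAct t (weightAct t κ) = κ := by
      intro κ; rw [← weightAct_mul, ht, simpleReflection, Equiv.swap_mul_self]; ext; simp [weightAct]
    have sts : weightAct s (weightAct t (weightAct s ν)) =
        weightAct t (weightAct s (weightAct t ν)) := by
      simp only [← weightAct_mul, ← mul_assoc, braid]
    have A : ∀ κ : Weight r, (∀ j, 0 ≤ κ j ∧ κ j < n) → _ := fun κ hκ =>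
      demazureLusztig_box (v := v) hg.1 i hκ rfl
    have B : ∀ κ : Weight r, (∀ j, 0 ≤ κ j ∧ κ j < n) → _ := fun κ hκ =>
      demazureLusztig_box (v := v) hg.1 j hκ rfl
    have b1 := weightAct_box hν s
    have b2 := weightAct_box hν t
    have b3 := weightAct_box b1 t
    have b4 := weightAct_box b2 s
    have A1 := A _ hν
    have A2 := A _ b1
    have A3 := A _ b2
    have A4 := A _ b3
    have A5 := A _ b4
    have B1 := B _ hν
    have B2 := B _ b1
    have B3 := B _ b2
    have B4 := B _ b3
    have B5 := B _ b4
    clear A B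
    rw [← hs] at A1 A2 A3 A4 A5
    rw [← ht] at B1 B2 B3 B4 B5
    rw [sts] at A4
    simp only [hy, vals, ss, tt] at A1 A2 A3 A4 A5 B1 B2 B3 B4 B5
    -- If two of the three exponents coincide the orbit degenerates; `S0`, `T0`, `S1`, `T1` record
    -- which of its elements become equal.
    have S0 : ν i.castSucc = ν i.succ → weightAct s ν = ν := weightAct_swap_eq
    have T0 : ν i.succ = ν j.succ → weightAct t ν = ν := by
      rw [← hy]; exact weightAct_swap_eq
    have S1 : ν i.castSucc = ν j.succ → weightAct s (weightAct t ν) = weightAct t ν := by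
      intro h; apply weightAct_swap_eq; simp only [vals, h]
    have T1 : ν i.castSucc = ν j.succ → weightAct t (weightAct s ν) = weightAct s ν := by
      intro h; apply weightAct_swap_eq; simp only [hy, vals, h]
    have G1 := fun h => parameter_mul (r := r) hg (hν i.castSucc) (hν i.succ) h
    have G2 := fun h => parameter_mul (r := r) hg (hν i.succ) (hν j.succ) h
    have G3 := fun h => parameter_mul (r := r) hg (hν i.castSucc) (hν j.succ) h
    generalize ν i.castSucc = p at *
    generalize ν i.succ = q at *
    generalize ν j.succ = u at *
    generalize weightAct s (weightAct t ν) = ν4 at *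
    generalize weightAct t (weightAct s ν) = ν3 at *
    generalize weightAct t ν = ν2 at *
    generalize weightAct s ν = ν1 at *
    have tri : ∀ a b : ℤ, (a < b ∧ a ≠ b ∧ b ≠ a ∧ ¬ b < a) ∨ a = b ∨
        (b < a ∧ a ≠ b ∧ b ≠ a ∧ ¬ a < b) := by intro a b; omega
    have cm := fun i => demazureLusztig_const_mul v g (n := n) (r := r) i
    rcases tri p q with h1 | h1 | h1 <;> rcases tri q u with h2 | h2 | h2 <;>
      rcases tri p u with h3 | h3 | h3 <;> first | (exfalso; omega) | skip
    all_goals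
      try subst h1
      try subst h2
      try subst h3
      try (obtain rfl := S0 rfl)
      try (obtain rfl := T0 rfl)
      try (obtain rfl := S1 rfl)
      try (obtain rfl := T1 rfl)
      try (have g1 := G1 h1.2.1)
      try (have g2 := G2 h2.2.1)
      try (have g3 := G3 h3.2.1)
      clear G1 G2 G3 S0 S1 T0 T1 b1 b2 b3 b4 sts
      try simp only [h1] at A1 A2 A3 A4 A5 B1 B2 B3 B4 B5
      try simp only [h2] at A1 A2 A3 A4 A5 B1 B2 B3 B4 B5
      try simp only [h3] at A1 A2 A3 A4 A5 B1 B2 B3 B4 B5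
      simp only [lt_irrefl, if_true, if_false, zero_mul, zero_add,
        add_zero] at A1 A2 A3 A4 A5 B1 B2 B3 B4 B5
      simp only [A1, A2, A3, A4, B1, B2, B3, B5, map_add, cm]
    all_goals
      clear A1 A2 A3 A4 A5 B1 B2 B3 B4 B5
      try simp only [const_sub, const_one, const_neg, neg_mul, one_mul, mul_neg]
    -- What is left in each weak order is either an identity or a multiple of relations `g_j g_{-j}
    -- v² = v` between off-diagonal entries.
    all_goals
      first
      | ring1
      | linear_combination (const v - 1) * monomial (ν + rho r) * (g1 - g2)
      | linear_combination (const v - 1) * monomial (ν1 + rho r) * (-g2)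
      | linear_combination (const v - 1) * monomial (ν2 + rho r) * g1

end

/-! ### From sums over reduced words to a product of coset sums. -/

section

/-! ### Normal forms in monoids with braid relations -/

/-- The elements `t 0, …, t (r-1)` of a monoid satisfy the braid relations of type `A_r`. -/
structure BraidFamily {M : Type*} [Monoid M] (r : ℕ) (t : ℕ → M) : Prop where
  comm : ∀ i j, i + 1 < j → j < r → t i * t j = t j * t i
  braid : ∀ i, i + 1 < r → t i * t (i + 1) * t i = t (i + 1) * t i * t (i + 1)

section NormalForm

variable {M : Type*} [Monoid M]

/-- `t_{R-1} t_{R-2} ⋯`, with `k` factors. -/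
def segment (t : ℕ → M) : ℕ → ℕ → M
  | 0, _ => 1
  | _ + 1, 0 => 1
  | R + 1, k + 1 => t R * segment t R k

theorem segment_zero (t : ℕ → M) (R : ℕ) : segment t R 0 = 1 := by
  cases R <;> rfl

theorem segment_succ_succ (t : ℕ → M) (R k : ℕ) :
    segment t (R + 1) (k + 1) = t R * segment t R k := rfl

theorem segment_succ (t : ℕ → M) {R k : ℕ} (h : k < R) :
    segment t R (k + 1) = segment t R k * t (R - k - 1) := by
  induction R generalizing k with
  | zero => omega
  | succ R ih =>
    cases k with
    | zero => simp [segment_succ_succ, segment_zero]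
    | succ k =>
      rw [segment_succ_succ, segment_succ_succ, ih (by omega), mul_assoc]
      congr 3
      omega

theorem segment_comm {r : ℕ} {t : ℕ → M} (ht : BraidFamily r t) {R k i : ℕ} (hR : R ≤ r)
    (h : i + k + 1 < R) : segment t R k * t i = t i * segment t R k := by
  induction R generalizing k with
  | zero => omega
  | succ R ih =>
    cases k with
    | zero => simp [segment_zero]
    | succ k =>
      rw [segment_succ_succ, mul_assoc, ih (by omega) (by omega), ← mul_assoc,
        ← ht.comm i R (by omega) (by omega), mul_assoc]

/-- `t R` commutes with the products of the `t i`, `i + 1 < R`. -/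
theorem segment_comm_high {r : ℕ} {t : ℕ → M} (ht : BraidFamily r t) {R k i : ℕ} (hi : i < r)
    (h : R < i) : segment t R k * t i = t i * segment t R k := by
  induction R generalizing k with
  | zero => simp [segment]
  | succ R ih =>
    cases k with
    | zero => simp [segment_zero]
    | succ k =>
      rw [segment_succ_succ, mul_assoc, ih (by omega), ← mul_assoc,
        ht.comm R i (by omega) (by omega), mul_assoc]

/-- Here the segment contains the adjacent factors `t_{i+1} t_i`. The `t_{i+1}` on the right
commutes past the lower factors until it meets them, and the braid relation turns `t_{i+1} t_i
t_{i+1}` into `t_i t_{i+1} t_i`; the new `t_i` then commutes to the front. -/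
theorem segment_shift {r : ℕ} {t : ℕ → M} (ht : BraidFamily r t) {R k i : ℕ} (hR : R ≤ r)
    (hk : k ≤ R) (hi : i + 1 < R) (h : R < i + 1 + k) :
    segment t R k * t (i + 1) = t i * segment t R k := by
  induction R generalizing k with
  | zero => omega
  | succ R ih =>
    cases k with
    | zero => omega
    | succ k =>
      by_cases hiR : i + 1 < R
      · rw [segment_succ_succ, mul_assoc, ih (by omega) (by omega) hiR (by omega), ← mul_assoc,
          ← ht.comm i R (by omega) (by omega), mul_assoc]
      · obtain rfl : R = i + 1 := by omega
        cases k with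
        | zero => omega
        | succ k =>
          rw [segment_succ_succ, segment_succ_succ, mul_assoc, mul_assoc,
            segment_comm_high ht (by omega) (by omega), ← mul_assoc, ← mul_assoc,
            ← ht.braid i (by omega)]
          simp only [mul_assoc]

/-- Normal forms of the elements of `S_{R+1}`. -/
def NormalForm : ℕ → Type
  | 0 => Unit
  | R + 1 => NormalForm R × Fin (R + 2)

instance NormalForm.instFintype : (R : ℕ) → Fintype (NormalForm R)
  | 0 => inferInstanceAs (Fintype Unit)
  | R + 1 =>
    haveI := NormalForm.instFintype R
    inferInstanceAs (Fintype (NormalForm R × Fin (R + 2)))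

theorem NormalForm.card (R : ℕ) : Fintype.card (NormalForm R) = (R + 1).factorial := by
  induction R with
  | zero => rfl
  | succ R ih =>
    change Fintype.card (NormalForm R × Fin (R + 2)) = _
    rw [Fintype.card_prod, ih, Fintype.card_fin, Nat.factorial_succ (R + 1), mul_comm]

/-- The element of the monoid with a given normal form. -/
def NormalForm.eval (t : ℕ → M) : (R : ℕ) → NormalForm R → M
  | 0, _ => 1
  | R + 1, c => NormalForm.eval t R c.1 * segment t (R + 1) c.2

/-- The number of factors of a normal form. -/
def NormalForm.length : (R : ℕ) → NormalForm R → ℕ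
  | 0, _ => 0
  | R + 1, c => NormalForm.length R c.1 + c.2

/-- Compare `t_i` with the last segment, whose final factor is `t_{R+1-k}`. A much smaller index
commutes through, index `R - k` lengthens the segment, index `R + 1 - k` repeats its last factor,
and a larger index is shifted down by one. No quadratic relation is used, so the shortening case is
stated as a factorization of `c`. -/
theorem NormalForm.exists_mul {r : ℕ} {t : ℕ → M} (ht : BraidFamily r t) {R : ℕ} (hR : R ≤ r)
    (c : NormalForm R) {i : ℕ} (hi : i < R) : ∃ c' : NormalForm R,
      (c.eval t R * t i = c'.eval t R ∧ c'.length = c.length + 1) ∨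
      (c.eval t R = c'.eval t R * t i ∧ c.length = c'.length + 1) := by
  induction R generalizing i with
  | zero => omega
  | succ R ih =>
    obtain ⟨c, k, hk⟩ := c
    rcases lt_trichotomy (i + k) R with h | h | h
    · obtain ⟨c', hc'⟩ := ih (by omega) c (i := i) (by omega)
      refine ⟨(c', ⟨k, hk⟩), ?_⟩
      simp only [NormalForm.eval, NormalForm.length]
      rcases hc' with ⟨h1, h2⟩ | ⟨h1, h2⟩
      · left
        rw [mul_assoc, segment_comm ht hR (by omega), ← mul_assoc, h1]
        exact ⟨rfl, by omega⟩
      · right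
        rw [mul_assoc, segment_comm ht hR (by omega), ← mul_assoc, ← h1]
        exact ⟨rfl, by omega⟩
    · refine ⟨(c, ⟨k + 1, by omega⟩), Or.inl ?_⟩
      simp only [NormalForm.eval, NormalForm.length]
      rw [segment_succ t (by omega), mul_assoc, show R + 1 - k - 1 = i by omega]
      exact ⟨rfl, by omega⟩
    · by_cases h' : i + k = R + 1
      · obtain ⟨k, rfl⟩ : ∃ k', k = k' + 1 := ⟨k - 1, by omega⟩
        refine ⟨(c, ⟨k, by omega⟩), Or.inr ?_⟩
        simp only [NormalForm.eval, NormalForm.length]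
        rw [segment_succ t (by omega), mul_assoc, show R + 1 - k - 1 = i by omega]
        exact ⟨rfl, by omega⟩
      · obtain ⟨i, rfl⟩ : ∃ i', i = i' + 1 := ⟨i - 1, by omega⟩
        obtain ⟨c', hc'⟩ := ih (by omega) c (i := i) (by omega)
        refine ⟨(c', ⟨k, hk⟩), ?_⟩
        simp only [NormalForm.eval, NormalForm.length]
        rcases hc' with ⟨h1, h2⟩ | ⟨h1, h2⟩
        · left
          rw [mul_assoc, segment_shift ht hR (by omega) hi (by omega), ← mul_assoc, h1]
          exact ⟨rfl, by omega⟩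
        · right
          rw [mul_assoc, segment_shift ht hR (by omega) hi (by omega), ← mul_assoc, ← h1]
          exact ⟨rfl, by omega⟩

theorem segment_eq_prod (t : ℕ → M) {R : ℕ} : ∀ {k : ℕ}, k ≤ R →
    ∃ l : List ℕ, (∀ i ∈ l, i < R) ∧ l.length = k ∧ segment t R k = (l.map t).prod := by
  induction R with
  | zero =>
    intro k hk
    exact ⟨[], by simp, by simp; omega, by simp [segment]⟩
  | succ R ih =>
    intro k hk
    cases k with
    | zero => exact ⟨[], by simp, rfl, by simp [segment]⟩
    | succ k =>
      obtain ⟨l, h1, h2, h3⟩ := ih (k := k) (by omega)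
      refine ⟨R :: l, ?_, by simp [h2], by simp [segment_succ_succ, h3]⟩
      intro i hi
      rcases List.mem_cons.1 hi with rfl | hi
      · omega
      · exact (h1 i hi).trans (by omega)

theorem NormalForm.eval_eq_prod (t : ℕ → M) {R : ℕ} (c : NormalForm R) :
    ∃ l : List ℕ, (∀ i ∈ l, i < R) ∧ l.length = c.length ∧ c.eval t R = (l.map t).prod := by
  induction R with
  | zero => exact ⟨[], by simp, rfl, rfl⟩
  | succ R ih =>
    obtain ⟨l, h1, h2, h3⟩ := ih c.1
    obtain ⟨l', h1', h2', h3'⟩ := segment_eq_prod t (R := R + 1) (k := c.2) (by omega)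
    refine ⟨l ++ l', ?_, by simp [NormalForm.length, h2, h2'], by simp [NormalForm.eval, h3, h3']⟩
    intro i hi
    rcases List.mem_append.1 hi with hi | hi
    · exact (h1 i hi).trans (by omega)
    · exact h1' i hi

/-- Reading the word letter by letter, a shortening step needs `π (t i)² = 1` and loses two in
length. Equality of lengths thus means that only braid moves occurred, and then the identity holds
in `M` itself and not just after `π`. -/
theorem NormalForm.exists_of_word {r : ℕ} {t : ℕ → M} (ht : BraidFamily r t) {G : Type*} [Group G]
    (π : M →* G) (hπ : ∀ i < r, π (t i) * π (t i) = 1) (l : List ℕ) (hl : ∀ i ∈ l, i < r) :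
    ∃ c : NormalForm r, π (c.eval t r) = π (l.map t).prod ∧ c.length ≤ l.length ∧
      (c.length = l.length → c.eval t r = (l.map t).prod) := by
  induction l using List.reverseRecOn with
  | nil =>
    have h0 : ∀ R, ∃ c : NormalForm R, c.eval t R = 1 ∧ c.length = 0 := by
      intro R
      induction R with
      | zero => exact ⟨(), rfl, rfl⟩
      | succ R ih =>
        obtain ⟨c, h1, h2⟩ := ih
        exact ⟨(c, 0), by simp [NormalForm.eval, h1, segment_zero], by simp [NormalForm.length, h2]⟩
    obtain ⟨c, h1, h2⟩ := h0 r
    exact ⟨c, by simp [h1], by simp [h2], by simp [h1]⟩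
  | append_singleton l i ih =>
    obtain ⟨c, h1, h2, h3⟩ := ih fun j hj => hl j (by simp [hj])
    have hi : i < r := hl i (by simp)
    obtain ⟨c', ⟨h4, h5⟩ | ⟨h4, h5⟩⟩ := NormalForm.exists_mul ht le_rfl c hi
    · refine ⟨c', ?_, by simp; omega, ?_⟩
      · rw [← h4, map_mul, h1]; simp
      · intro h
        have : c.length = l.length := by simp at h; omega
        rw [← h4, h3 this]; simp
    · refine ⟨c', ?_, by simp; omega, ?_⟩
      · rw [List.map_append, List.prod_append, map_mul, ← h1, h4, map_mul]
        simp [mul_assoc, hπ i hi]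
      · intro h
        simp at h
        omega

end NormalForm

/-! ### The symmetrizers -/

section Symmetrizer

variable {A : Type*} [Ring A]

/-- `1 + t_{R-1} + t_{R-1} t_{R-2} + ⋯ + t_{R-1} ⋯ t_0`. -/
def cosetSum (t : ℕ → A) : ℕ → A
  | 0 => 1
  | R + 1 => 1 + t R * cosetSum t R

/-- `1 + t_{R-1} + t_{R-2} t_{R-1} + ⋯ + t_0 ⋯ t_{R-1}`. -/
def leftCosetSum (t : ℕ → A) : ℕ → A
  | 0 => 1
  | R + 1 => 1 + leftCosetSum t R * t R

/-- The sum of the elements attached to the permutations of the first `R` coordinates. -/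
def symmetrizer (t : ℕ → A) : ℕ → A
  | 0 => 1
  | R + 1 => symmetrizer t R * cosetSum t R

theorem sum_segment (t : ℕ → A) (R : ℕ) :
    ∑ k : Fin (R + 1), segment t R k = cosetSum t R := by
  induction R with
  | zero => simp [segment, cosetSum]
  | succ R ih =>
    rw [Fin.sum_univ_succ]
    simp only [Fin.val_zero, segment_zero, Fin.val_succ, segment_succ_succ]
    rw [← Finset.mul_sum, ih, cosetSum]

theorem sum_normalForm (t : ℕ → A) (R : ℕ) :
    ∑ c : NormalForm R, c.eval t R = symmetrizer t (R + 1) := by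
  induction R with
  | zero =>
    exact (by simp [symmetrizer, cosetSum] : ∑ _c : Unit, (1 : A) = symmetrizer t 1)
  | succ R ih =>
    rw [symmetrizer, ← ih, ← sum_segment, Finset.sum_mul_sum, ← Finset.sum_product']
    rfl

variable {r : ℕ} {t : ℕ → A}

theorem cosetSum_comm (ht : BraidFamily r t) {R i : ℕ} (hi : i < r) (h : R < i) :
    Commute (cosetSum t R) (t i) := by
  induction R with
  | zero => exact Commute.one_left _
  | succ R ih =>
    exact (Commute.one_left _).add_left (Commute.mul_left (ht.comm R i h hi) (ih (by omega)))

theorem leftCosetSum_comm (ht : BraidFamily r t) {R i : ℕ} (hi : i < r) (h : R < i) :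
    Commute (leftCosetSum t R) (t i) := by
  induction R with
  | zero => exact Commute.one_left _
  | succ R ih =>
    exact (Commute.one_left _).add_left (Commute.mul_left (ih (by omega)) (ht.comm R i h hi))

theorem symmetrizer_comm (ht : BraidFamily r t) {R i : ℕ} (hi : i < r) (h : R ≤ i) :
    Commute (symmetrizer t R) (t i) := by
  induction R with
  | zero => exact Commute.one_left _
  | succ R ih => exact Commute.mul_left (ih (by omega)) (cosetSum_comm ht hi (by omega))

/-- The factorization through the other system of cosets. It follows because `symmetrizer t R`
involves only `t_0, …, t_{R-2}` and so commutes with `t R`. -/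
theorem symmetrizer_succ (ht : BraidFamily r t) {R : ℕ} (hR : R ≤ r) :
    symmetrizer t (R + 1) = leftCosetSum t R * symmetrizer t R := by
  induction R with
  | zero => simp [symmetrizer, cosetSum, leftCosetSum]
  | succ R ih =>
    have hc := (symmetrizer_comm (R := R) ht (i := R) (by omega) le_rfl).eq
    calc symmetrizer t (R + 2) = symmetrizer t (R + 1) * (1 + t R * cosetSum t R) := rfl
      _ = symmetrizer t (R + 1) + leftCosetSum t R * (symmetrizer t R * t R) * cosetSum t R := by
        rw [mul_add, mul_one, ih (by omega)]; simp only [mul_assoc]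
      _ = symmetrizer t (R + 1) + leftCosetSum t R * t R * (symmetrizer t R * cosetSum t R) := by
        rw [hc]; simp only [mul_assoc]
      _ = leftCosetSum t (R + 1) * symmetrizer t (R + 1) := by
        rw [leftCosetSum, add_mul, one_mul]; rfl

/-- For group elements this would be the decomposition into cosets of `{1, σ_R}`. Here it is derived
from the braid relations alone, by induction. -/
theorem symmetrizer_dvd_last (ht : BraidFamily r t) {R : ℕ} (hR : R < r) :
    ∃ Y, symmetrizer t (R + 2) = Y * (1 + t R) := by
  induction R with
  | zero => exact ⟨1, by simp [symmetrizer, cosetSum]⟩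
  | succ R ih =>
    obtain ⟨Y, hY⟩ := ih (by omega)
    have e1 := symmetrizer_succ (R := R) ht (by omega)
    have e2 := symmetrizer_succ (R := R + 1) ht (by omega)
    have e3 := symmetrizer_succ (R := R + 2) ht (by omega)
    have e4 : symmetrizer t (R + 1) = symmetrizer t R * cosetSum t R := rfl
    have d2 : leftCosetSum t (R + 2) = 1 + leftCosetSum t (R + 1) * t (R + 1) := rfl
    have d1 : leftCosetSum t (R + 1) = 1 + leftCosetSum t R * t R := rfl
    have hb := ht.braid R (by omega)
    have c1 := (leftCosetSum_comm (R := R) ht (i := R + 1) (by omega) (by omega)).eq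
    have c2 := (cosetSum_comm (R := R) ht (i := R + 1) (by omega) (by omega)).eq
    have c3 := (symmetrizer_comm (R := R) ht (i := R) (by omega) (by omega)).eq
    have c4 := (symmetrizer_comm (R := R) ht (i := R + 1) (by omega) (by omega)).eq
    have c5 := (symmetrizer_comm (R := R + 1) ht (i := R + 1) (by omega) (by omega)).eq
    rw [d1] at d2 e2
    rw [d2, e2] at e3
    rw [e2] at hY
    generalize leftCosetSum t R = D at *
    generalize cosetSum t R = Q at *
    generalize symmetrizer t (R + 1) = P1 at *
    generalize symmetrizer t R = P0 at *
    generalize t (R + 1) = b at *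
    generalize t R = a at *
    -- The first summand collects the terms whose `b` commutes to the right end. The others have the
    -- form `Y (1 + a) b a Q` by induction, and `(1 + a) b a = b a + a b a = b a (1 + b)`, where `b`
    -- commutes with `Q`.
    refine ⟨(1 + D * a) * P1 + Y * b * a * Q, ?_⟩
    rw [e3]
    calc (1 + (1 + D * a) * b) * ((1 + D * a) * P1)
        = (1 + D * a) * P1 + (1 + D * a) * (b * P1) + (1 + D * a) * (b * D) * a * P1 := by
          noncomm_ring
      _ = (1 + D * a) * P1 * (1 + b) + (1 + D * a) * D * b * (a * P0) * Q := by
          rw [← c5, ← c1, e4]; noncomm_ring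
      _ = (1 + D * a) * P1 * (1 + b) + (1 + D * a) * D * (b * P0) * a * Q := by
          rw [← c3]; noncomm_ring
      _ = (1 + D * a) * P1 * (1 + b) + ((1 + D * a) * (D * P0)) * b * a * Q := by
          rw [← c4]; noncomm_ring
      _ = (1 + D * a) * P1 * (1 + b) + Y * (b * a + a * b * a) * Q := by
          rw [← e1, hY]; noncomm_ring
      _ = (1 + D * a) * P1 * (1 + b) + Y * (b * a) * (Q + b * Q) := by
          rw [hb]; noncomm_ring
      _ = _ := by rw [← c2]; noncomm_ring

theorem symmetrizer_dvd (ht : BraidFamily r t) {R i : ℕ} (hR : R ≤ r + 1) (hi : i + 2 ≤ R) :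
    ∃ Y, symmetrizer t R = Y * (1 + t i) := by
  induction R, hi using Nat.le_induction with
  | base => exact symmetrizer_dvd_last ht (by omega)
  | succ R hi ih =>
    obtain ⟨Y, hY⟩ := ih (by omega)
    exact ⟨leftCosetSum t R * Y, by rw [symmetrizer_succ ht (by omega), hY, mul_assoc]⟩

end Symmetrizer

/-! ### Sums over the Weyl group -/

/-- The role of Matsumoto's theorem: the value of a reduced word is that of the normal form of the
same permutation, so the choice of words is immaterial and the sum runs over normal forms. -/
theorem sum_reducedWords {r : ℕ} {A : Type*} [Ring A] (T : Fin r → A) (t : ℕ → A)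
    (hT : ∀ i : Fin r, t i = T i) (ht : BraidFamily r t) (word : Weyl r → List (Fin r))
    (hw : ∀ u, IsReducedWord (word u) u) :
    ∑ u, ((word u).map T).prod = symmetrizer t (r + 1) := by
  let s : ℕ → Weyl r := fun i => if h : i < r then simpleReflection ⟨i, h⟩ else 1
  have s_val : ∀ i : Fin r, s i = simpleReflection i := fun i => dif_pos i.2
  have s_comm : ∀ i j, i + 1 < j → j < r → s i * s j = s j * s i := by
    intro i j hij hj
    simp only [s, dif_pos hj, dif_pos (show i < r by omega)]
    unfold simpleReflection
    refine (Equiv.Perm.disjoint_swap_swap ?_).commute.eq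
    simp [Fin.ext_iff]
    omega
  have s_braid : ∀ i, i + 1 < r → s i * s (i + 1) * s i = s (i + 1) * s i * s (i + 1) := by
    intro i hi
    simp only [s, dif_pos hi, dif_pos (show i < r by omega)]
    unfold simpleReflection
    have hy : (⟨i + 1, hi⟩ : Fin r).castSucc = (⟨i, by omega⟩ : Fin r).succ := rfl
    have n1 : (⟨i, by omega⟩ : Fin r).castSucc ≠ (⟨i, by omega⟩ : Fin r).succ := by
      simp [Fin.ext_iff]
    have n2 : (⟨i, by omega⟩ : Fin r).succ ≠ (⟨i + 1, hi⟩ : Fin r).succ := by simp [Fin.ext_iff]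
    have n3 : (⟨i, by omega⟩ : Fin r).castSucc ≠ (⟨i + 1, hi⟩ : Fin r).succ := by
      simp [Fin.ext_iff]; omega
    rw [hy, Equiv.swap_mul_swap_mul_swap n1 n3,
      Equiv.swap_comm (⟨i, by omega⟩ : Fin r).castSucc (⟨i, by omega⟩ : Fin r).succ,
      Equiv.swap_comm (⟨i, by omega⟩ : Fin r).succ (⟨i + 1, hi⟩ : Fin r).succ,
      Equiv.swap_mul_swap_mul_swap n2.symm n3.symm, Equiv.swap_comm]
  -- Working in `A × W` follows a word in the algebra and in the Weyl group with the same normal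
  -- form.
  let ts : ℕ → A × Weyl r := fun i => (t i, s i)
  have hts : BraidFamily r ts :=
    ⟨fun i j h h' => Prod.ext (ht.comm i j h h') (s_comm i j h h'),
      fun i h => Prod.ext (ht.braid i h) (s_braid i h)⟩
  have s_sq : ∀ i < r, s i * s i = 1 := by
    intro i hi
    simp only [s, dif_pos hi, simpleReflection, Equiv.swap_mul_self]
  have hword : ∀ l : List (Fin r), ∃ c : NormalForm r,
      (c.eval ts r).2 = (l.map simpleReflection).prod ∧ c.length ≤ l.length ∧
        (c.length = l.length → (c.eval ts r).1 = (l.map T).prod) := by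
    intro l
    have e : ((l.map (fun i : Fin r => (i : ℕ))).map ts).prod
        = ((l.map T).prod, (l.map simpleReflection).prod) := by
      induction l with
      | nil => rfl
      | cons a l ih =>
        simp only [List.map_cons, List.prod_cons, ih]
        simp [ts, hT, s_val]
    obtain ⟨c, h1, h2, h3⟩ := NormalForm.exists_of_word hts (MonoidHom.snd A (Weyl r)) s_sq
      (l.map (fun i : Fin r => (i : ℕ))) (by simp)
    rw [e] at h1 h3
    refine ⟨c, h1, by simpa using h2, fun h => ?_⟩
    rw [h3 (by simpa using h)]
  have eval_fst : ∀ R (c : NormalForm R), (c.eval ts R).1 = c.eval t R := by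
    have seg : ∀ R k, (segment ts R k).1 = segment t R k := by
      intro R
      induction R with
      | zero => intro k; rfl
      | succ R ih =>
        intro k
        cases k with
        | zero => rfl
        | succ k => simp [segment_succ_succ, ih, ts]
    intro R
    induction R with
    | zero => intro c; rfl
    | succ R ih => intro c; simp [NormalForm.eval, ih, seg]
  let φ : NormalForm r → Weyl r := fun c => (c.eval ts r).2
  -- Every permutation has a word, so the normal forms map onto `W`; there are `(r + 1)!` of them.
  have hφ : Function.Bijective φ := by
    rw [Fintype.bijective_iff_surjective_and_card]
    refine ⟨fun u => ?_, ?_⟩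
    · obtain ⟨c, hc, -⟩ := hword (word u)
      exact ⟨c, hc.trans (hw u).1⟩
    · rw [NormalForm.card, Fintype.card_perm, Fintype.card_fin]
  rw [← sum_normalForm t r, ← hφ.sum_comp]
  refine Finset.sum_congr rfl fun c _ => ?_
  obtain ⟨c', h1, h2, h3⟩ := hword (word (φ c))
  have hc' : c' = c := hφ.1 (h1.trans (hw (φ c)).1)
  subst hc'
  -- The normal form is itself a word of its permutation, so a reduced word cannot be longer. The
  -- lengths agree and the values in `A` are equal.
  obtain ⟨l, hl, hlen, hprod⟩ := NormalForm.eval_eq_prod ts c'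
  have : (word (φ c')).length ≤ c'.length := by
    rw [← hlen]
    have := (hw (φ c')).2 (l.pmap (fun i hi => (⟨i, hi⟩ : Fin r)) hl) (by
      change _ = (c'.eval ts r).2
      rw [hprod]
      clear hprod hlen
      induction l with
      | nil => rfl
      | cons a l ih =>
        simp only [List.pmap, List.map_cons, List.prod_cons, Prod.snd_mul]
        rw [ih (fun i hi => hl i (by simp [hi])), ← s_val])
    simpa using this
  rw [← h3 (by omega), eval_fst]

end

/-! ### Operators on two-variable monomials, and extraction of coefficients by scaling a variable.
-/

section

variable {n r : ℕ}

/-! ### The operators and variables, indexed by natural numbers -/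

/-- The variable `x_k`, or `1` if there is none. -/
noncomputable def xvar (r k : ℕ) : RatFun r := if h : k < r + 1 then var ⟨k, h⟩ else 1

theorem xvar_ne_zero (k : ℕ) : xvar r k ≠ 0 := by
  unfold xvar
  split_ifs
  · exact var_ne_zero _
  · exact one_ne_zero

theorem xvar_coe (i : Fin (r + 1)) : xvar r i = var i := dif_pos i.2

/-- The operator `T_i`, or `0` if there is none. -/
noncomputable def heckeOp (n : ℕ) (r : ℕ) [NeZero n] (v : ℂ) (g : ZMod n → ℂ) (i : ℕ) :
    Module.End ℂ (RatFun r) :=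
  if h : i < r then demazureLusztig n v g ⟨i, h⟩ else 0

theorem heckeOp_coe [NeZero n] (v : ℂ) (g : ZMod n → ℂ) (i : Fin r) :
    heckeOp n r v g i = demazureLusztig n v g i := dif_pos i.2

theorem heckeOp_braidFamily [NeZero n] {v : ℂ} {g : ZMod n → ℂ}
    (hg : IsMetaplecticParameters n v g) : BraidFamily r (heckeOp n r v g) := by
  constructor
  · intro i j hij hj
    rw [heckeOp, heckeOp, dif_pos hj, dif_pos (by omega)]
    exact demazureLusztig_commute hg _ _ hij
  · intro i hi
    rw [heckeOp, heckeOp, dif_pos hi, dif_pos (by omega)]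
    exact demazureLusztig_braid hg _ _ rfl

theorem heckeOp_comm_xvar [NeZero n] (v : ℂ) (g : ZMod n → ℂ) {i j : ℕ} (h1 : j ≠ i)
    (h2 : j ≠ i + 1) (k : ℤ) :
    Commute (LinearMap.mulLeft ℂ (xvar r j ^ k)) (heckeOp n r v g i) := by
  unfold heckeOp xvar
  split_ifs with hj hi hi
  · ext f
    rw [Module.End.mul_apply, Module.End.mul_apply, LinearMap.mulLeft_apply,
      LinearMap.mulLeft_apply, ← monomial_single_zsmul, demazureLusztig_monomial_mul]
    rw [Pi.single_apply, Pi.single_apply, if_neg, if_neg]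
    · simp [Fin.ext_iff]; omega
    · simp [Fin.ext_iff]; omega
  · exact Commute.zero_right _
  · rw [one_zpow, LinearMap.mulLeft_one]
    exact Commute.one_left _
  · exact Commute.zero_right _

theorem commute_cosetSum {A : Type*} [Ring A] {t : ℕ → A} {a : A} {R : ℕ}
    (h : ∀ i < R, Commute a (t i)) : Commute a (cosetSum t R) := by
  induction R with
  | zero => exact Commute.one_right _
  | succ R ih =>
    exact (Commute.one_right _).add_right ((h R (by omega)).mul_right (ih fun i hi => h i (by omega)))

theorem commute_symmetrizer {A : Type*} [Ring A] {t : ℕ → A} {a : A} {R : ℕ}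
    (h : ∀ i, i + 1 < R → Commute a (t i)) : Commute a (symmetrizer t R) := by
  induction R with
  | zero => exact Commute.one_right _
  | succ R ih =>
    exact (ih fun i hi => h i (by omega)).mul_right
      (commute_cosetSum fun i hi => h i (by omega))

theorem commute_mulLeft_apply {T : Module.End ℂ (RatFun r)} {a : RatFun r}
    (h : Commute (LinearMap.mulLeft ℂ a) T) (f : RatFun r) : T (a * f) = a * T f :=
  (LinearMap.congr_fun h.eq f).symm

theorem commute_mulLeft_mul {T : Module.End ℂ (RatFun r)} {a b : RatFun r}
    (ha : Commute (LinearMap.mulLeft ℂ a) T) (hb : Commute (LinearMap.mulLeft ℂ b) T) :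
    Commute (LinearMap.mulLeft ℂ (a * b)) T := by
  rw [LinearMap.mulLeft_mul]
  exact Commute.mul_left ha hb

theorem commute_mulLeft_const {T : Module.End ℂ (RatFun r)} (c : ℂ) :
    Commute (LinearMap.mulLeft ℂ (const c)) T := by
  ext f
  simp only [Module.End.mul_apply, LinearMap.mulLeft_apply, ← const_smul, map_smul]

theorem commute_mulLeft_sum {T : Module.End ℂ (RatFun r)} {ι : Type*} (s : Finset ι)
    (a : ι → RatFun r) (h : ∀ k ∈ s, Commute (LinearMap.mulLeft ℂ (a k)) T) :
    Commute (LinearMap.mulLeft ℂ (∑ k ∈ s, a k)) T := by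
  ext f
  simp only [Module.End.mul_apply, LinearMap.mulLeft_apply, Finset.sum_mul, map_sum]
  exact Finset.sum_congr rfl fun k hk => (commute_mulLeft_apply (h k hk) f).symm

/-! ### The operator on monomials in two variables -/

/-- Only multiples of `n` contribute, so the sum is a geometric series in `y ^ n`. This is how `h♭`
arises from the fraction in the formula for `T_i`. -/
theorem sum_hFlat [NeZero n] (v : ℂ) {y : RatFun r} (hy : 1 - y ^ n ≠ 0) (d : ℕ) :
    ∑ k ∈ Finset.Icc 1 d, const (hFlatOf n v k) * y ^ k =
      const (1 - v) * (y ^ n - (y ^ n) ^ (1 + d / n)) / (1 - y ^ n) := by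
  induction d with
  | zero => simp
  | succ d ih =>
    rw [Finset.sum_Icc_succ_top (by omega), ih, Nat.succ_div, hFlatOf]
    split_ifs with h
    · obtain ⟨c, hc⟩ := h
      have e : d / n + 1 = c := by
        have : (d + 1) / n = d / n + 1 := Nat.succ_div_of_dvd ⟨c, hc⟩
        rw [← this, hc, Nat.mul_div_cancel_left _ (NeZero.pos n)]
      rw [hc, pow_mul, ← e]
      field_simp
      ring
    · simp [const_zero]

/-- The coefficient of `x_i^{m+k} x_{i+1}^{N-k}` in `T_i(x_i^m x_{i+1}^N)`, for
`d = N - m ≥ -1`. -/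
noncomputable def stepCoeff (n : ℕ) (v : ℂ) (g : ZMod n → ℂ) (d : ℤ) (k : ℕ) : ℂ :=
  if k = 0 then (if d = -1 then -1 else 0)
  else if (k : ℤ) ≤ d then hFlatOf n v k
  else if (k : ℤ) = d + 1 then gFlatOf v g k
  else 0

/-- For `d ≥ 0` the fraction in `T_i` is the sum of `h♭(k) y^k` over `1 ≤ k ≤ d`, and the remaining
term is `g♭(d+1) y^{d+1}`; for `d = -1` the monomial is an eigenvector. `N` is any bound beyond the
support, so that several such sums can share a range. -/
theorem heckeOp_pair [NeZero n] {v : ℂ} {g : ZMod n → ℂ} (hg : g 0 = -1) {i : ℕ} (hi : i < r)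
    (m e d : ℤ) (hd : e = m + d) (hd' : -1 ≤ d) (N : ℕ) (hN : d + 1 < N) :
    heckeOp n r v g i (xvar r i ^ m * xvar r (i + 1) ^ e) =
      ∑ k ∈ Finset.range N, const (stepCoeff n v g d k) *
        (xvar r i ^ (m + k) * xvar r (i + 1) ^ (e - k)) := by
  have h0 : xvar r i ≠ 0 := xvar_ne_zero i
  have h1 : xvar r (i + 1) ≠ 0 := xvar_ne_zero _
  have ei : xvar r i = var (⟨i, hi⟩ : Fin r).castSucc := dif_pos (by omega)
  have ei' : xvar r (i + 1) = var (⟨i, hi⟩ : Fin r).succ := dif_pos (by omega)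
  have hne := castSucc_ne_succ' (⟨i, hi⟩ : Fin r)
  set μ : Weight r := Pi.single (⟨i, hi⟩ : Fin r).castSucc m + Pi.single (⟨i, hi⟩ : Fin r).succ e
    with hμ
  have hmon : xvar r i ^ m * xvar r (i + 1) ^ e = monomial μ := by
    rw [hμ, monomial_add, monomial_single_zsmul, monomial_single_zsmul, ei, ei']
  have hμ0 : μ (⟨i, hi⟩ : Fin r).castSucc = m := by simp [hμ]
  have hμ1 : μ (⟨i, hi⟩ : Fin r).succ = e := by simp [hμ]
  clear_value μ
  clear hμ
  rcases eq_or_lt_of_le hd' with rfl | hd0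
  · rw [Finset.sum_eq_single 0]
    · rw [heckeOp, dif_pos hi, hmon, demazureLusztig_monomial_zero hg _ _ (by rw [hμ0, hμ1]; omega)]
      simp [stepCoeff, hmon, const_neg, const_one]
    · intro k _ hk
      rw [stepCoeff, if_neg hk, if_neg (by omega), if_neg (by omega), const_zero, zero_mul]
    · intro h
      exact absurd (Finset.mem_range.2 (by omega)) h
  · obtain ⟨d, rfl⟩ : ∃ d' : ℕ, d = d' := ⟨d.toNat, by omega⟩
    have hfac : ∀ k : ℕ, xvar r i ^ (m + k) * xvar r (i + 1) ^ (e - k) =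
        (xvar r i / xvar r (i + 1)) ^ k * monomial μ := by
      intro k
      rw [← hmon, zpow_add₀ h0, zpow_sub₀ h1, zpow_natCast, zpow_natCast, div_pow]
      field_simp
    have hsub : Finset.Icc 1 (d + 1) ⊆ Finset.range N := by
      intro k hk
      simp only [Finset.mem_Icc, Finset.mem_range] at hk ⊢
      omega
    rw [← Finset.sum_subset hsub, Finset.sum_Icc_succ_top (by omega)]
    · have e1 : ∀ k ∈ Finset.Icc 1 d, const (stepCoeff n v g (d : ℤ) k) *
          (xvar r i ^ (m + k) * xvar r (i + 1) ^ (e - k)) =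
          const (hFlatOf n v k) * (xvar r i / xvar r (i + 1)) ^ k * monomial μ := by
        intro k hk
        rw [Finset.mem_Icc] at hk
        rw [stepCoeff, if_neg (by omega), if_pos (by omega), hfac, mul_assoc]
      have hy : 1 - (xvar r i / xvar r (i + 1)) ^ n ≠ 0 := by
        rw [ei, ei']
        exact one_sub_ne_zero hne (NeZero.ne n)
      rw [Finset.sum_congr rfl e1, ← Finset.sum_mul, sum_hFlat v hy, hfac, hmon, heckeOp,
        dif_pos hi, demazureLusztig_monomial v g _ μ d (by rw [hμ0, hμ1]; omega), monomial_add,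
        monomial_zsmul, monomial_simpleRoot, ei, ei']
      have es : stepCoeff n v g (d : ℤ) (d + 1) = v * g ((1 + d : ℤ) : ZMod n) := by
        rw [stepCoeff, if_neg (by omega), if_neg (by omega), if_pos (by push_cast; ring), gFlatOf]
        congr 2
        push_cast
        ring
      have ez : ∀ y : RatFun r, y ^ ((d : ℤ) + 1) = y ^ (d + 1) := fun y => zpow_natCast y (d + 1)
      have eq : ∀ y : RatFun r, y ^ (1 + (d : ℤ) / (n : ℤ)) = y ^ (1 + d / n) := fun y =>
        zpow_natCast y (1 + d / n)
      rw [es, ez, eq]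
      ring
    · intro k _ hk
      simp only [Finset.mem_Icc] at hk
      by_cases hk0 : k = 0
      · rw [stepCoeff, if_pos hk0, if_neg (by omega), const_zero, zero_mul]
      · rw [stepCoeff, if_neg hk0, if_neg (by omega), if_neg (by omega), const_zero, zero_mul]

/-! ### Torus automorphisms and extraction of coefficients -/

/-- The algebra endomorphism `x_i ↦ t_i x_i` of polynomials. -/
noncomputable def torusHom (t : Fin (r + 1) → ℂˣ) :
    MvPolynomial (Fin (r + 1)) ℂ →ₐ[ℂ] MvPolynomial (Fin (r + 1)) ℂ :=
  MvPolynomial.aeval fun i => MvPolynomial.C (t i : ℂ) * MvPolynomial.X i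

theorem torusHom_comp {t t' : Fin (r + 1) → ℂˣ} (h : t * t' = 1) :
    (torusHom t).comp (torusHom t') = AlgHom.id ℂ _ := by
  ext1 i
  have hi : ((t i : ℂ)) * t' i = 1 := by
    rw [← Units.val_mul, ← Pi.mul_apply, h]; rfl
  simp only [torusHom, AlgHom.comp_apply, MvPolynomial.aeval_X, map_mul, AlgHom.id_apply]
  rw [← MvPolynomial.algebraMap_eq, AlgHom.commutes, ← mul_assoc, ← map_mul, mul_comm (t' i : ℂ),
    hi]
  simp

/-- The automorphism `x_i ↦ t_i x_i` of the field of rational functions. -/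
noncomputable def torus (t : Fin (r + 1) → ℂˣ) : RatFun r ≃ₐ[ℂ] RatFun r :=
  IsFractionRing.fieldEquivOfAlgEquiv ℂ (RatFun r) (RatFun r)
    (AlgEquiv.ofAlgHom (torusHom t) (torusHom t⁻¹)
      (torusHom_comp (mul_inv_cancel t)) (torusHom_comp (inv_mul_cancel t)))

theorem torus_var (t : Fin (r + 1) → ℂˣ) (i : Fin (r + 1)) :
    torus t (var i) = const (t i : ℂ) * var i := by
  unfold torus var
  rw [IsFractionRing.fieldEquivOfAlgEquiv_algebraMap]
  change algebraMap _ _ (torusHom t _) = _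
  simp only [torusHom, MvPolynomial.aeval_X, map_mul]
  rw [← MvPolynomial.algebraMap_eq, ← IsScalarTower.algebraMap_apply]
  rfl

/-- `T_i` is built from `x_i / x_{i+1}`, the reflection and the grading, and a diagonal scaling with
`t_i = t_{i+1}` respects all three. -/
theorem demazureLusztig_torus [NeZero n] (v : ℂ) (g : ZMod n → ℂ) (i : Fin r)
    (t : Fin (r + 1) → ℂˣ) (ht : t i.castSucc = t i.succ) (f : RatFun r) :
    demazureLusztig n v g i (torus t f) = torus t (demazureLusztig n v g i f) := by
  have hy : torus t (var i.castSucc / var i.succ) = var i.castSucc / var i.succ := by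
    rw [map_div₀, torus_var, torus_var, ht, mul_div_mul_left _ _ (const_ne_zero (Units.ne_zero _))]
  have htw : ∀ (ξ : AddChar (Weight r ⧸ sublattice n r) ℂ) (f : RatFun r),
      twist ξ (torus t f) = torus t (twist ξ f) := by
    intro ξ f
    refine ratFun_algEquiv_comm (fun j => ?_) f
    rw [torus_var, twist_var, const_smul, map_mul, map_mul, map_const, map_const, twist_var,
      torus_var, const_smul]
    ring
  have hord : ∀ f : RatFun r, ordinaryAct (simpleReflection i) (torus t f) =
      torus t (ordinaryAct (simpleReflection i) f) := by
    intro f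
    refine ratFun_algEquiv_comm (fun j => ?_) f
    rw [torus_var, map_mul, map_const, ordinaryAct_var, torus_var]
    congr 3
    unfold simpleReflection
    by_cases h1 : j = i.castSucc
    · rw [h1, Equiv.swap_apply_left, ht]
    · by_cases h2 : j = i.succ
      · rw [h2, Equiv.swap_apply_right, ht]
      · rw [Equiv.swap_apply_of_ne_of_ne h1 h2]
  have key : chintaGunnells n v g i (torus t f) = torus t (chintaGunnells n v g i f) := by
    rw [← sum_proj (n := n) f]
    simp only [map_sum]
    refine Finset.sum_congr rfl fun q _ => ?_
    obtain ⟨μ, rfl⟩ := QuotientAddGroup.mk_surjective q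
    have hm := proj_mem_component (QuotientAddGroup.mk μ : Weight r ⧸ sublattice n r) f
    have hm' : torus t (proj (QuotientAddGroup.mk μ : Weight r ⧸ sublattice n r) f) ∈
        component (QuotientAddGroup.mk μ : Weight r ⧸ sublattice n r) := by
      intro ξ
      rw [htw, hm ξ, const_smul, const_smul, map_mul, map_const]
    rw [chintaGunnells_of_mem n v g i _ hm', chintaGunnells_of_mem n v g i _ hm, map_mul, hord]
    congr 1
    simp only [chintaGunnellsFactor, map_div₀ (torus t) (_ - _), map_sub, map_mul, map_zpow₀,
      map_pow, map_const, map_one, hy]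
  rw [demazureLusztig_apply, demazureLusztig_apply, key]
  simp only [map_sub, map_mul, map_inv₀, map_pow, map_const, map_one, hy]

/-- The automorphism that multiplies `x_j` by `t`. -/
noncomputable def scale (j : ℕ) (t : ℂˣ) : RatFun r ≃ₐ[ℂ] RatFun r :=
  torus fun i => if (i : ℕ) = j then t else 1

theorem scale_xvar_self {j : ℕ} (hj : j ≤ r) (t : ℂˣ) :
    scale j t (xvar r j) = const (t : ℂ) * xvar r j := by
  rw [xvar, dif_pos (by omega), scale, torus_var]
  simp

theorem scale_xvar_ne {i j : ℕ} (h : i ≠ j) (t : ℂˣ) : scale j t (xvar r i) = xvar r i := by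
  unfold xvar
  split_ifs
  · rw [scale, torus_var]
    simp [h, const_one]
  · exact map_one _

theorem heckeOp_scale [NeZero n] (v : ℂ) (g : ZMod n → ℂ) {i j : ℕ} (h1 : j ≠ i)
    (h2 : j ≠ i + 1) (t : ℂˣ) :
    Commute (scale j t).toLinearMap (heckeOp n r v g i) := by
  unfold heckeOp
  split_ifs with hi
  · ext f
    refine (demazureLusztig_torus v g _ _ ?_ f).symm
    simp [h1.symm, h2.symm]
  · exact Commute.zero_right _

/-- The coefficients `B k` are rational functions unchanged by scaling `x_j`. Scaling the relation
by all `t` in `ℂˣ` gives a polynomial in `t` with infinitely many roots, whose coefficients must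
vanish. -/
theorem eq_zero_of_sum_zpow {j : ℕ} (hj : j ≤ r) (e : ℤ) (N : ℕ) (B : ℕ → RatFun r)
    (hB : ∀ (t : ℂˣ) k, scale j t (B k) = B k)
    (h : ∑ k ∈ Finset.range N, xvar r j ^ (e - k) * B k = 0) {k : ℕ} (hk : k < N) : B k = 0 := by
  let p : Polynomial (RatFun r) :=
    ∑ k ∈ Finset.range N, Polynomial.monomial k (xvar r j ^ (e - k) * B k)
  have hroot : ∀ t : ℂˣ, p.IsRoot (const (t : ℂ)) := by
    intro t
    have ht : (const (t : ℂ) : RatFun r) ≠ 0 := const_ne_zero t.ne_zero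
    -- The inverse scaling makes `x_j ^ (e - k)` contribute `t ^ (k - e)`, so that after removing `t
    -- ^ (-e)` only nonnegative powers remain.
    have h2 := congrArg (scale j t⁻¹) h
    rw [map_sum, map_zero] at h2
    have h3 : ∑ k ∈ Finset.range N, const (t : ℂ) ^ (-e) *
        (xvar r j ^ (e - k) * B k * const (t : ℂ) ^ k) = 0 := by
      rw [← h2]
      refine Finset.sum_congr rfl fun k _ => ?_
      rw [map_mul, map_zpow₀, scale_xvar_self hj, hB, mul_zpow]
      have : (const ((t⁻¹ : ℂˣ) : ℂ) : RatFun r) = (const (t : ℂ))⁻¹ := by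
        rw [Units.val_inv_eq_inv_val]
        exact map_inv₀ _ _
      rw [this, inv_zpow', ← zpow_natCast (const (t : ℂ)) k, neg_sub,
        show (k : ℤ) - e = -e + k by ring, zpow_add₀ ht]
      ring
    rw [← Finset.mul_sum] at h3
    have h4 := (mul_eq_zero.1 h3).resolve_left (zpow_ne_zero _ ht)
    simpa [p, Polynomial.IsRoot, Polynomial.eval_finsetSum] using h4
  have hinj : Function.Injective (fun t : ℂˣ => (const (t : ℂ) : RatFun r)) := fun a b hab =>
    Units.ext ((algebraMap ℂ (RatFun r)).injective hab)
  have : Infinite ℂˣ := by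
    refine Infinite.of_injective (fun m : ℕ => Units.mk0 ((m : ℂ) + 1) (by
      exact_mod_cast Nat.succ_ne_zero m)) fun a b hab => ?_
    have := congrArg Units.val hab
    simpa using this
  have hp : p = 0 := Polynomial.eq_zero_of_infinite_isRoot p
    ((Set.infinite_range_of_injective hinj).mono (by rintro _ ⟨t, rfl⟩; exact hroot t))
  have := congrArg (fun q => Polynomial.coeff q k) hp
  simp only [p, Polynomial.finsetSum_coeff, Polynomial.coeff_monomial, Polynomial.coeff_zero,
    Finset.sum_ite_eq', Finset.mem_range, hk, if_true] at this
  exact (mul_eq_zero.1 this).resolve_left (zpow_ne_zero _ (xvar_ne_zero j))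

end

/-! ### The symmetrizer of an antidominant monomial as a sum over one row. -/

section

variable {n r : ℕ}

/-! ### One row of a Gelfand-Tsetlin pattern -/

/-- The weight of an entry of a row: `k` and `γ` are the `Γ`-entries of this entry and of the one to
its right, and `k - γ` runs through `0, …, δ + 1`. -/
noncomputable def rowWeight (n : ℕ) (v : ℂ) (g : ZMod n → ℂ) (δ : ℤ) (γ k : ℕ) : ℂ :=
  if k = γ then 1
  else if (k : ℤ) < γ + δ + 1 then hFlatOf n v k
  else if (k : ℤ) = γ + δ + 1 then gFlatOf v g k
  else 0

/-- The sum over the rows below the row `κ_0, …, κ_R`, with first `Γ`-entry `k`. -/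
noncomputable def rowPoly (n r : ℕ) (v : ℂ) (g : ZMod n → ℂ) (κ : ℕ → ℤ) : ℕ → ℕ → RatFun r
  | 0, k => if k = 0 then 1 else 0
  | R + 1, k => ∑ γ ∈ Finset.range (k + 1), const (rowWeight n v g (κ (R + 1) - κ R) γ k) *
      (xvar r R ^ (κ R - γ + k) * rowPoly n r v g κ R γ)

/-- A bound for the first `Γ`-entry of a row. -/
def rowBound (κ : ℕ → ℤ) : ℕ → ℕ
  | 0 => 0
  | R + 1 => rowBound κ R + (κ (R + 1) - κ R).toNat + 1

/-- The monomial `x_0^{κ_0} ⋯ x_R^{κ_R}`. -/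
noncomputable def initialMonomial (r : ℕ) (κ : ℕ → ℤ) (R : ℕ) : RatFun r :=
  ∏ j ∈ Finset.range (R + 1), xvar r j ^ κ j

theorem initialMonomial_succ (κ : ℕ → ℤ) (R : ℕ) :
    initialMonomial r κ (R + 1) = initialMonomial r κ R * xvar r (R + 1) ^ κ (R + 1) :=
  Finset.prod_range_succ _ _

theorem rowPoly_eq_zero (v : ℂ) (g : ZMod n → ℂ) (κ : ℕ → ℤ) {R k : ℕ} (h : rowBound κ R < k) :
    rowPoly n r v g κ R k = 0 := by
  induction R generalizing k with
  | zero => rw [rowPoly, if_neg (by omega)]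
  | succ R ih =>
    rw [rowPoly]
    refine Finset.sum_eq_zero fun γ _ => ?_
    rw [rowBound] at h
    by_cases hγ : rowBound κ R < γ
    · rw [ih hγ, mul_zero, mul_zero]
    · rw [rowWeight, if_neg (by omega), if_neg (by omega), if_neg (by omega), const_zero, zero_mul]

/-- A first `Γ`-entry `0` forces all the others to be `0`, so the only surviving row has weight `1`
and gives the initial monomial. -/
theorem rowPoly_zero (v : ℂ) (g : ZMod n → ℂ) (κ : ℕ → ℤ) (R : ℕ) :
    rowPoly n r v g κ R 0 * xvar r R ^ κ R = initialMonomial r κ R := by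
  induction R with
  | zero => simp [rowPoly, initialMonomial]
  | succ R ih =>
    rw [initialMonomial_succ, ← ih, rowPoly]
    simp only [zero_add, Finset.range_one, Finset.sum_singleton, rowWeight, if_true, const_one,
      Nat.cast_zero, sub_zero, add_zero, one_mul]
    ring

theorem rowPoly_scale (v : ℂ) (g : ZMod n → ℂ) (κ : ℕ → ℤ) {R j : ℕ} (h : R ≤ j) (t : ℂˣ) (k : ℕ) :
    scale j t (rowPoly n r v g κ R k) = rowPoly n r v g κ R k := by
  induction R generalizing k with
  | zero => rw [rowPoly]; split_ifs <;> simp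
  | succ R ih =>
    rw [rowPoly, map_sum]
    refine Finset.sum_congr rfl fun γ _ => ?_
    rw [map_mul, map_mul, map_zpow₀, map_const, scale_xvar_ne (by omega), ih (by omega)]

theorem rowPoly_comm [NeZero n] (v : ℂ) (g : ZMod n → ℂ) (κ : ℕ → ℤ) {R i : ℕ} (h : R ≤ i) (k : ℕ) :
    Commute (LinearMap.mulLeft ℂ (rowPoly n r v g κ R k)) (heckeOp n r v g i) := by
  induction R generalizing k with
  | zero =>
    rw [rowPoly]
    split_ifs
    · rw [LinearMap.mulLeft_one]; exact Commute.one_left _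
    · rw [LinearMap.mulLeft_zero_eq_zero]; exact Commute.zero_left _
  | succ R ih =>
    rw [rowPoly]
    refine commute_mulLeft_sum _ _ fun γ _ => ?_
    exact commute_mulLeft_mul (commute_mulLeft_const _)
      (commute_mulLeft_mul (heckeOp_comm_xvar v g (by omega) (by omega) _) (ih (by omega) γ))

/-- The coefficient of `x_{R+1}^{e-k}` in `x^κ x_{R+1}^e + T_R(…)`, for `d = e - κ_R`. -/
noncomputable def stepPoly (n r : ℕ) (v : ℂ) (g : ZMod n → ℂ) (κ : ℕ → ℤ) (R : ℕ) (d : ℤ)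
    (k : ℕ) : RatFun r :=
  (if k = 0 then initialMonomial r κ R else 0) +
    ∑ γ ∈ Finset.range (rowBound κ R + 1), const (stepCoeff n v g (d + γ) k) *
      (xvar r R ^ (κ R - γ + k) * rowPoly n r v g κ R γ)

theorem stepPoly_scale (v : ℂ) (g : ZMod n → ℂ) (κ : ℕ → ℤ) {R j : ℕ} (h : R < j) (t : ℂˣ) (d : ℤ)
    (k : ℕ) : scale j t (stepPoly n r v g κ R d k) = stepPoly n r v g κ R d k := by
  rw [stepPoly, map_add, map_sum]
  congr 1
  · split_ifs
    · rw [initialMonomial, map_prod]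
      refine Finset.prod_congr rfl fun i hi => ?_
      rw [Finset.mem_range] at hi
      rw [map_zpow₀, scale_xvar_ne (by omega)]
    · exact map_zero _
  · refine Finset.sum_congr rfl fun γ _ => ?_
    rw [map_mul, map_mul, map_zpow₀, map_const, scale_xvar_ne (by omega),
      rowPoly_scale v g κ h.le]

/-- The row polynomial does not involve `x_R`, `x_{R+1}` and passes through `T_R`. What remains is
`heckeOp_pair` with exponent gap `d + γ`, sorted by powers of `x_{R+1}`. -/
theorem heckeOp_row [NeZero n] {v : ℂ} {g : ZMod n → ℂ} (hg : IsMetaplecticParameters n v g)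
    (κ : ℕ → ℤ) {R : ℕ} (hR : R < r) (e d : ℤ) (hd : e = κ R + d) (hd' : -1 ≤ d) (N : ℕ)
    (hN : rowBound κ R + d + 1 < N) (hN0 : 0 < N) :
    initialMonomial r κ R * xvar r (R + 1) ^ e + heckeOp n r v g R (xvar r (R + 1) ^ e *
      ∑ γ ∈ Finset.range (rowBound κ R + 1), rowPoly n r v g κ R γ * xvar r R ^ (κ R - γ)) =
    ∑ k ∈ Finset.range N, xvar r (R + 1) ^ (e - k) * stepPoly n r v g κ R d k := by
  have h1 : ∀ γ ∈ Finset.range (rowBound κ R + 1), heckeOp n r v g R (xvar r (R + 1) ^ e *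
      (rowPoly n r v g κ R γ * xvar r R ^ (κ R - γ))) =
      ∑ k ∈ Finset.range N, xvar r (R + 1) ^ (e - k) * (const (stepCoeff n v g (d + γ) k) *
        (xvar r R ^ (κ R - γ + k) * rowPoly n r v g κ R γ)) := by
    intro γ hγ
    rw [Finset.mem_range] at hγ
    rw [show xvar r (R + 1) ^ e * (rowPoly n r v g κ R γ * xvar r R ^ (κ R - γ)) =
      rowPoly n r v g κ R γ * (xvar r R ^ (κ R - γ) * xvar r (R + 1) ^ e) by ring,
      commute_mulLeft_apply (rowPoly_comm v g κ le_rfl γ),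
      heckeOp_pair hg.1 hR (κ R - γ) e (d + γ) (by omega) (by omega) N (by omega),
      Finset.mul_sum]
    exact Finset.sum_congr rfl fun k _ => by ring
  rw [Finset.mul_sum, map_sum, Finset.sum_congr rfl h1, Finset.sum_comm]
  simp only [stepPoly, mul_add, Finset.sum_add_distrib, Finset.mul_sum]
  congr 1
  rw [Finset.sum_eq_single 0]
  · simp [mul_comm]
  · intro k _ hk
    rw [if_neg hk, mul_zero]
  · intro h
    exact absurd (Finset.mem_range.2 hN0) h

theorem symmetrizer_comm_xvar [NeZero n] (v : ℂ) (g : ZMod n → ℂ) {R j : ℕ} (h : R ≤ j) (k : ℤ) :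
    Commute (LinearMap.mulLeft ℂ (xvar r j ^ k)) (symmetrizer (heckeOp n r v g) R) :=
  commute_symmetrizer fun i hi => heckeOp_comm_xvar v g (by omega) (by omega) k

theorem cosetSum_comm_xvar [NeZero n] (v : ℂ) (g : ZMod n → ℂ) {R j : ℕ} (h : R < j) (k : ℤ) :
    Commute (LinearMap.mulLeft ℂ (xvar r j ^ k)) (cosetSum (heckeOp n r v g) R) :=
  commute_cosetSum fun i hi => heckeOp_comm_xvar v g (by omega) (by omega) k

/-- Use `P_{R+2} = P_{R+1} (1 + T_R C)` with `C` the coset sum. The exponent `e` is left free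
because both `e = κ_{R+1}` and `e = κ_R - 1` are needed. -/
theorem symmetrizer_step [NeZero n] {v : ℂ} {g : ZMod n → ℂ} (hg : IsMetaplecticParameters n v g)
    (κ : ℕ → ℤ) {R : ℕ} (hR : R < r)
    (hB : symmetrizer (heckeOp n r v g) (R + 1) (initialMonomial r κ R) =
      symmetrizer (heckeOp n r v g) R (∑ γ ∈ Finset.range (rowBound κ R + 1),
        rowPoly n r v g κ R γ * xvar r R ^ (κ R - γ)))
    (e d : ℤ) (hd : e = κ R + d) (hd' : -1 ≤ d) (N : ℕ) (hN : rowBound κ R + d + 1 < N)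
    (hN0 : 0 < N) :
    symmetrizer (heckeOp n r v g) (R + 2) (initialMonomial r κ R * xvar r (R + 1) ^ e) =
      ∑ k ∈ Finset.range N, xvar r (R + 1) ^ (e - k) *
        symmetrizer (heckeOp n r v g) (R + 1) (stepPoly n r v g κ R d k) := by
  have ht := heckeOp_braidFamily (r := r) hg
  set t := heckeOp n r v g with ht'
  set S := ∑ γ ∈ Finset.range (rowBound κ R + 1), rowPoly n r v g κ R γ * xvar r R ^ (κ R - γ)
  -- Write the outer `P_{R+1}` as `L P_R`; then `P_R` passes `T_R` and joins the coset sum to form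
  -- `P_{R+1}` acting on `x^κ`. There `hB` applies, and the moves are undone.
  have e1 : symmetrizer t (R + 1) (t R (cosetSum t R (xvar r (R + 1) ^ e * initialMonomial r κ R)))
      = symmetrizer t (R + 1) (t R (xvar r (R + 1) ^ e * S)) := by
    have c := (symmetrizer_comm (R := R) ht (i := R) hR le_rfl).eq
    have c' : ∀ f, symmetrizer t R (t R f) = t R (symmetrizer t R f) := LinearMap.congr_fun c
    have hx := symmetrizer_comm_xvar (r := r) v g (R := R) (j := R + 1) (by omega) e
    rw [← ht'] at hx
    rw [symmetrizer_succ ht hR.le, Module.End.mul_apply, Module.End.mul_apply, c', c',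
      commute_mulLeft_apply (cosetSum_comm_xvar v g (by omega) e), commute_mulLeft_apply hx,
      commute_mulLeft_apply hx, ← hB]
    rfl
  have e2 : symmetrizer t (R + 2) (initialMonomial r κ R * xvar r (R + 1) ^ e) =
      symmetrizer t (R + 1) (initialMonomial r κ R * xvar r (R + 1) ^ e +
        t R (xvar r (R + 1) ^ e * S)) := by
    rw [map_add, ← e1, mul_comm (xvar r (R + 1) ^ e) (initialMonomial r κ R), ← map_add]
    rfl
  rw [e2, heckeOp_row hg κ hR e d hd hd' N hN hN0, map_sum]
  exact Finset.sum_congr rfl fun k _ =>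
    commute_mulLeft_apply (symmetrizer_comm_xvar v g le_rfl _) _

/-- The vanishing statement behind the theorem: it comes from `(1 + T_R)(x_R^a x_{R+1}^{a-1}) = 0`. -/
theorem symmetrizer_stepPoly_neg_one [NeZero n] {v : ℂ} {g : ZMod n → ℂ}
    (hg : IsMetaplecticParameters n v g) (κ : ℕ → ℤ) {R : ℕ} (hR : R < r)
    (hB : symmetrizer (heckeOp n r v g) (R + 1) (initialMonomial r κ R) =
      symmetrizer (heckeOp n r v g) R (∑ γ ∈ Finset.range (rowBound κ R + 1),
        rowPoly n r v g κ R γ * xvar r R ^ (κ R - γ))) (k : ℕ) :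
    symmetrizer (heckeOp n r v g) (R + 1) (stepPoly n r v g κ R (-1) k) = 0 := by
  have ht := heckeOp_braidFamily (r := r) hg
  have h0 : symmetrizer (heckeOp n r v g) (R + 2)
      (initialMonomial r κ R * xvar r (R + 1) ^ (κ R - 1)) = 0 := by
    obtain ⟨Y, hY⟩ := symmetrizer_dvd_last ht hR
    have h1 : heckeOp n r v g R (initialMonomial r κ R * xvar r (R + 1) ^ (κ R - 1)) =
        -(initialMonomial r κ R * xvar r (R + 1) ^ (κ R - 1)) := by
      rw [← rowPoly_zero v g κ R, mul_assoc, commute_mulLeft_apply (rowPoly_comm v g κ le_rfl 0),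
        heckeOp_pair hg.1 hR (κ R) (κ R - 1) (-1) (by ring) le_rfl 1 (by norm_num)]
      simp [stepCoeff, const_neg, const_one]
    rw [hY, Module.End.mul_apply, LinearMap.add_apply, Module.End.one_apply, h1, add_neg_cancel,
      map_zero]
  rw [symmetrizer_step hg κ hR hB _ (-1) (by ring) le_rfl (rowBound κ R + k + 1) (by omega)
    (by omega)] at h0
  -- `P_{R+1}` involves only `T_0, …, T_{R-1}`, so its values on the coefficients are still
  -- unchanged by scaling `x_{R+1}`.
  refine eq_zero_of_sum_zpow (r := r) (j := R + 1) hR _ _ _ (fun t k => ?_) h0 (by omega)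
  have hc : Commute (scale (r := r) (R + 1) t).toLinearMap (symmetrizer (heckeOp n r v g) (R + 1)) :=
    commute_symmetrizer fun i hi => heckeOp_scale v g (by omega) (by omega) t
  have := LinearMap.congr_fun hc.eq (stepPoly n r v g κ R (-1) k)
  simp only [Module.End.mul_apply, AlgEquiv.toLinearMap_apply] at this
  rw [this, stepPoly_scale v g κ (by omega)]

/-- Compare the terms in `γ` for `k > 0`: for `γ < k` the weights agree, for `γ = k` they are
`h♭(k)` and `1`, and for `γ > k` only `stepPoly` has a term, again with `h♭(k)`. For `k = 0` the
initial monomial is the term `γ = 0` of the row. -/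
theorem stepPoly_sub_rowPoly [NeZero n] (v : ℂ) (g : ZMod n → ℂ) (κ : ℕ → ℤ) {R : ℕ}
    (hκ : κ R ≤ κ (R + 1)) (k : ℕ) :
    stepPoly n r v g κ R (κ (R + 1) - κ R) k - rowPoly n r v g κ (R + 1) k =
      if k = 0 then 0 else
        const (hFlatOf n v k) * ∑ γ ∈ Finset.range (rowBound κ R + 1),
          (if k < γ then xvar r R ^ (κ R - γ + k) * rowPoly n r v g κ R γ else 0) +
        const (hFlatOf n v k - 1) * (xvar r R ^ κ R * rowPoly n r v g κ R k) := by
  set δ := κ (R + 1) - κ R with hδ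
  have hδ0 : 0 ≤ δ := by omega
  have hlong : ∀ F : ℕ → RatFun r, ∀ N, rowBound κ R < N →
      ∑ γ ∈ Finset.range (rowBound κ R + 1), F γ * rowPoly n r v g κ R γ =
        ∑ γ ∈ Finset.range N, F γ * rowPoly n r v g κ R γ := by
    intro F N hN
    refine Finset.sum_subset (Finset.range_subset_range.2 hN) fun γ _ hγ => ?_
    rw [Finset.mem_range] at hγ
    rw [rowPoly_eq_zero v g κ (by omega), mul_zero]
  have hrow : rowPoly n r v g κ (R + 1) k = ∑ γ ∈ Finset.range (rowBound κ R + k + 1),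
      (if γ ≤ k then const (rowWeight n v g δ γ k) * xvar r R ^ (κ R - γ + k) else 0) *
        rowPoly n r v g κ R γ := by
    rw [rowPoly, ← hδ, ← Finset.sum_subset (Finset.range_subset_range.2
      (show k + 1 ≤ rowBound κ R + k + 1 by omega))]
    · refine Finset.sum_congr rfl fun γ hγ => ?_
      rw [Finset.mem_range] at hγ
      rw [if_pos (by omega), mul_assoc]
    · intro γ _ hγ
      rw [Finset.mem_range] at hγ
      rw [if_neg (by omega), zero_mul]
  rw [stepPoly, hrow]
  simp only [← mul_assoc]
  rw [hlong _ (rowBound κ R + k + 1) (by omega)]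
  by_cases hk : k = 0
  · subst hk
    rw [if_pos rfl, if_pos rfl, add_sub_assoc, ← Finset.sum_sub_distrib, Finset.sum_eq_single 0,
      ← rowPoly_zero v g κ R]
    · simp only [stepCoeff, rowWeight, if_true, le_refl, const_one]
      rw [if_neg (by simp; omega)]
      simp [const_zero, mul_comm]
    · intro γ _ hγ
      rw [stepCoeff, if_pos rfl, if_neg (by omega), if_neg (by omega), const_zero]
      ring
    · simp
  · rw [if_neg hk, if_neg hk, zero_add]
    have e1 : ∑ γ ∈ Finset.range (rowBound κ R + 1),
        (if k < γ then xvar r R ^ (κ R - γ + k) * rowPoly n r v g κ R γ else 0) =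
        ∑ γ ∈ Finset.range (rowBound κ R + k + 1),
          (if k < γ then xvar r R ^ (κ R - γ + k) else 0) * rowPoly n r v g κ R γ := by
      rw [← hlong _ _ (by omega)]
      exact Finset.sum_congr rfl fun γ _ => by split_ifs <;> simp
    have e2 : xvar r R ^ κ R * rowPoly n r v g κ R k =
        ∑ γ ∈ Finset.range (rowBound κ R + k + 1),
          (if γ = k then xvar r R ^ (κ R - γ + k) else 0) * rowPoly n r v g κ R γ := by
      rw [Finset.sum_eq_single k]
      · rw [if_pos rfl, sub_add_cancel]
      · intro γ _ hγ
        rw [if_neg hγ, zero_mul]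
      · intro h
        exact absurd (Finset.mem_range.2 (by omega)) h
    rw [e1, mul_assoc (const _) (xvar r R ^ κ R), e2, Finset.mul_sum, Finset.mul_sum,
      ← Finset.sum_sub_distrib, ← Finset.sum_add_distrib]
    refine Finset.sum_congr rfl fun γ _ => ?_
    rcases lt_trichotomy γ k with h | h | h
    · rw [if_pos h.le, if_neg (by omega), if_neg (by omega)]
      have : stepCoeff n v g (δ + γ) k = rowWeight n v g δ γ k := by
        rw [stepCoeff, rowWeight, if_neg hk, if_neg (show ¬k = γ by omega)]
        by_cases c1 : (k : ℤ) ≤ δ + γ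
        · rw [if_pos c1, if_pos (by omega)]
        · rw [if_neg c1, if_neg (show ¬(k : ℤ) < γ + δ + 1 by omega)]
          by_cases c2 : (k : ℤ) = δ + γ + 1
          · rw [if_pos c2, if_pos (by omega)]
          · rw [if_neg c2, if_neg (by omega)]
      rw [this]
      ring
    · subst h
      rw [if_pos le_rfl, if_neg (lt_irrefl _), if_pos rfl, stepCoeff, if_neg hk,
        if_pos (by omega), rowWeight, if_pos rfl, const_sub]
      ring
    · rw [if_neg (by omega), if_pos h, if_neg (by omega), stepCoeff, if_neg hk, if_pos (by omega)]
      ring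

/-- With `d = -1` the gap is `γ - 1`: the weight is `h♭(k)` for `k < γ`, `g♭(k)` for `k = γ` and `0`
beyond. This is the error term of `stepPoly_sub_rowPoly` with `g♭(k)` in place of `h♭(k) - 1`. -/
theorem stepPoly_neg_one (v : ℂ) (g : ZMod n → ℂ) (κ : ℕ → ℤ) (R : ℕ) {k : ℕ} (hk : k ≠ 0) :
    stepPoly n r v g κ R (-1) k =
      const (hFlatOf n v k) * ∑ γ ∈ Finset.range (rowBound κ R + 1),
          (if k < γ then xvar r R ^ (κ R - γ + k) * rowPoly n r v g κ R γ else 0) +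
        const (gFlatOf v g k) * (xvar r R ^ κ R * rowPoly n r v g κ R k) := by
  have e2 : xvar r R ^ κ R * rowPoly n r v g κ R k =
      ∑ γ ∈ Finset.range (rowBound κ R + 1),
        (if γ = k then xvar r R ^ (κ R - γ + k) * rowPoly n r v g κ R γ else 0) := by
    rw [Finset.sum_ite_eq']
    split_ifs with h
    · rw [sub_add_cancel]
    · rw [Finset.mem_range] at h
      rw [rowPoly_eq_zero v g κ (by omega), mul_zero]
  rw [stepPoly, if_neg hk, zero_add, e2, Finset.mul_sum, Finset.mul_sum, ← Finset.sum_add_distrib]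
  refine Finset.sum_congr rfl fun γ _ => ?_
  rw [stepCoeff, if_neg hk]
  rcases lt_trichotomy γ k with h | h | h
  · rw [if_neg (by omega), if_neg (by omega), if_neg (by omega), if_neg (by omega), const_zero]
    ring
  · subst h
    rw [if_neg (by omega), if_pos (by omega), if_neg (by omega), if_pos rfl]
    ring
  · rw [if_pos (by omega), if_pos h, if_neg (by omega)]
    ring

/-- The symmetrizer on an antidominant monomial is a sum over one row. -/
theorem symmetrizer_initialMonomial [NeZero n] {v : ℂ} {g : ZMod n → ℂ}
    (hg : IsMetaplecticParameters n v g) (κ : ℕ → ℤ) {R : ℕ} (hR : R ≤ r)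
    (hκ : ∀ i < R, κ i ≤ κ (i + 1)) :
    symmetrizer (heckeOp n r v g) (R + 1) (initialMonomial r κ R) =
      symmetrizer (heckeOp n r v g) R (∑ γ ∈ Finset.range (rowBound κ R + 1),
        rowPoly n r v g κ R γ * xvar r R ^ (κ R - γ)) := by
  induction R with
  | zero => simp [symmetrizer, cosetSum, rowBound, rowPoly, initialMonomial]
  | succ R ih =>
    have hB := ih (by omega) fun i hi => hκ i (by omega)
    have hle := hκ R (by omega)
    have hz : ∀ k, symmetrizer (heckeOp n r v g) (R + 1)
        (stepPoly n r v g κ R (κ (R + 1) - κ R) k) =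
        symmetrizer (heckeOp n r v g) (R + 1) (rowPoly n r v g κ (R + 1) k) := by
      intro k
      rw [← sub_eq_zero, ← map_sub, stepPoly_sub_rowPoly v g κ hle]
      split_ifs with hk
      · exact map_zero _
      · have h1 := symmetrizer_stepPoly_neg_one hg κ (by omega) hB k
        rw [stepPoly_neg_one v g κ R hk] at h1
        -- If `n ∣ k` then `h♭(k) - 1 = -v = g♭(k)` and the error is the polynomial just shown to be
        -- killed. Otherwise `h♭(k) = 0` and `g♭(k) ≠ 0`, so the single remaining term is killed.
        by_cases hn : n ∣ k
        · have : hFlatOf n v k - 1 = gFlatOf v g k := by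
            rw [hFlatOf, if_pos hn, gFlatOf, (ZMod.natCast_eq_zero_iff k n).2 hn, hg.1]
            ring
          rw [this]
          exact h1
        · have hgk : gFlatOf v g k ≠ 0 := by
            have := hg.2 (k : ZMod n) (fun h => hn ((ZMod.natCast_eq_zero_iff k n).1 h))
            intro h0
            rw [gFlatOf] at h0
            rw [← mul_assoc, h0, zero_mul] at this
            exact zero_ne_one this
          rw [hFlatOf, if_neg hn, const_zero, zero_mul, zero_add] at h1 ⊢
          rw [commute_mulLeft_apply (commute_mulLeft_const _)] at h1 ⊢
          rw [(mul_eq_zero.1 h1).resolve_left (const_ne_zero hgk), mul_zero]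
    rw [initialMonomial_succ, symmetrizer_step hg κ (by omega) hB (κ (R + 1)) (κ (R + 1) - κ R)
      (by ring) (by omega) (rowBound κ (R + 1) + 1) (by rw [rowBound]; omega) (by omega), map_sum]
    refine Finset.sum_congr rfl fun k _ => ?_
    rw [hz, mul_comm (rowPoly n r v g κ (R + 1) k),
      commute_mulLeft_apply (symmetrizer_comm_xvar v g le_rfl _)]

end

/-! ### The crystal path of the favourite word in terms of patterns. -/

section

namespace Crystal

variable {r : ℕ} {μ : Weight r}

/-! ### Strings of Kashiwara operators -/

theorem sum_Icc_eq_add {M : Type*} [AddCommMonoid M] (f : ℕ → M) {j r : ℕ} (h : j ≤ r) :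
    ∑ k ∈ Finset.Icc j r, f k = f j + ∑ k ∈ Finset.Icc (j + 1) r, f k := by
  rw [← Finset.add_sum_Ioc_eq_sum_Icc h]
  congr 2
  ext
  simp only [Finset.mem_Ioc, Finset.mem_Icc]
  omega

theorem signature_eq_add (T : Crystal r μ) (i : ℕ) {j : ℕ} (hj : j ≤ r) :
    T.signature i j = T.signature i (j + 1) +
      ((T.a (i + 1) j - T.a (i + 2) (j + 1)) - (T.a i j - T.a (i + 1) (j + 1))) := by
  unfold signature
  rw [sum_Icc_eq_add _ hj, add_comm]

theorem signature_top (T : Crystal r μ) (i : ℕ) : T.signature i (r + 1) = 0 := by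
  unfold signature
  rw [Finset.Icc_eq_empty (by omega), Finset.sum_empty]

theorem le_below (T : Crystal r μ) {i j : ℕ} (hij : i + 1 ≤ j) (hj : j ≤ r) :
    T.a i j ≤ T.a (i + 1) j := by
  obtain ⟨j, rfl⟩ : ∃ j', j = j' + 1 := ⟨j - 1, by omega⟩
  exact (T.interleave i j (by omega) (by omega)).2

theorem IsPivot.unique {T : Crystal r μ} {i j j' : ℕ} (h : T.IsPivot i j) (h' : T.IsPivot i j') :
    j = j' := by
  rcases lt_trichotomy j j' with hlt | rfl | hlt
  · have h1 := h.2.2.1 j' hlt (by have := h'.2.1; omega)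
    have h2 := h'.2.2.2 j h.1 hlt.le
    omega
  · rfl
  · have h1 := h'.2.2.1 j hlt (by have := h.2.1; omega)
    have h2 := h.2.2.2 j' h'.1 hlt.le
    omega

/-- The shape of the patterns in the strings that occur on the paths of the favourite word: the
entries of row `i + 1` are moved down to those of row `i`, from the left to the right. -/
def IsChain (T : Crystal r μ) (i : ℕ) : Prop :=
  ∀ k l, i + 1 ≤ k → k < l → l ≤ r → T.a i k < T.a (i + 1) k → T.a (i + 1) l = T.a (i + 2) l

/-- If row `i + 1` equals row `i`, each signature step is `a_{i+1,k+1} - a_{i+2,k+1} ≤ 0`, whereas a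
pivot has positive signature. -/
theorem IsChain.not_isPivot {T : Crystal r μ} {i : ℕ}
    (h0 : ∀ k, i + 1 ≤ k → k ≤ r → T.a (i + 1) k = T.a i k) (j : ℕ) : ¬ T.IsPivot i j := by
  intro hj
  have key : ∀ d k, k + d = r + 1 → i + 1 ≤ k → T.signature i k ≤ 0 := by
    intro d
    induction d with
    | zero =>
      intro k hk _
      obtain rfl : k = r + 1 := by omega
      rw [signature_top]
    | succ d ih =>
      intro k hk hik
      rw [signature_eq_add T i (by omega), h0 k hik (by omega)]
      have h1 := ih (k + 1) (by omega) (by omega)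
      by_cases hkr : k + 1 ≤ r
      · have := T.le_below (i := i + 1) (j := k + 1) (by omega) hkr
        have e : T.a (i + 1 + 1) (k + 1) = T.a (i + 2) (k + 1) := rfl
        omega
      · rw [T.outside (i + 1) (k + 1) (by omega), T.outside (i + 2) (k + 1) (by omega)]
        omega
  have h1 := hj.2.2.1 (r + 1) (by have := hj.2.1; omega) le_rfl
  have h2 := key (r + 1 - j) j (by have := hj.2.1; omega) hj.1
  rw [signature_top] at h1
  omega

/-- Each signature step is `(a_{i+1,k} - a_{i,k}) + (a_{i+1,k+1} - a_{i+2,k+1})`. To the right of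
`j` the chain condition removes the second bracket, so the count never drops on the way to `j` and
rises strictly there; to the left of `j` the first bracket is `0` and the count cannot rise. -/
theorem IsChain.isPivot {T : Crystal r μ} {i : ℕ} (h : T.IsChain i) {j : ℕ} (hij : i + 1 ≤ j)
    (hj : j ≤ r) (hlt : T.a i j < T.a (i + 1) j)
    (hmin : ∀ k, i + 1 ≤ k → k < j → T.a (i + 1) k = T.a i k) : T.IsPivot i j := by
  have hnext : ∀ k, j ≤ k → k ≤ r → T.a (i + 1) (k + 1) = T.a (i + 2) (k + 1) := by
    intro k hjk hk
    by_cases hkr : k + 1 ≤ r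
    · exact h j (k + 1) hij (by omega) hkr hlt
    · rw [T.outside _ _ (by omega), T.outside _ _ (by omega)]
  refine ⟨hij, hj, ?_, ?_⟩
  · have key : ∀ d k, k = j + 1 + d → k ≤ r + 1 → T.signature i k < T.signature i j := by
      intro d
      induction d with
      | zero =>
        intro k hk hkr
        rw [hk, add_zero, signature_eq_add T i hj, hnext j le_rfl hj]
        omega
      | succ d ih =>
        intro k hk hkr
        have h1 := ih (k - 1) (by omega) (by omega)
        rw [signature_eq_add T i (by omega), show k - 1 + 1 = k by omega] at h1
        have h2 := hnext (k - 1) (by omega) (by omega)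
        rw [show k - 1 + 1 = k by omega] at h2
        have h3 := T.le_below (i := i) (j := k - 1) (by omega) (by omega)
        omega
    intro k hk hkr
    exact key (k - (j + 1)) k (by omega) hkr
  · have key : ∀ d k, k + d = j → i + 1 ≤ k → T.signature i k ≤ T.signature i j := by
      intro d
      induction d with
      | zero => intro k hk _; rw [← hk, add_zero]
      | succ d ih =>
        intro k hk hik
        have h1 := ih (k + 1) (by omega) (by omega)
        rw [signature_eq_add T i (by omega), hmin k hik (by omega)]
        have := T.le_below (i := i + 1) (j := k + 1) (by omega) (by omega)
        have e : T.a (i + 1 + 1) (k + 1) = T.a (i + 2) (k + 1) := rfl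
        omega
    intro k hik hk
    exact key (j - k) k (by omega) hik

theorem kashiwara_of_isPivot (s : Fin r) {T : Crystal r μ} {j : ℕ}
    (h : T.IsPivot (s.rev : ℕ) j) : kashiwara s T = some (T.lower _ _ h) := by
  have hex : ∃ j, T.IsPivot (s.rev : ℕ) j := ⟨j, h⟩
  have e : hex.choose = j := hex.choose_spec.unique h
  rw [kashiwara, dif_pos hex]
  congr 2

theorem kashiwaraPow_succ (s : Fin r) (k : ℕ) (T : Crystal r μ) :
    kashiwaraPow s (k + 1) T = (kashiwaraPow s k T).bind (kashiwara s) := by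
  unfold kashiwaraPow
  rw [Function.iterate_succ_apply']

theorem kashiwaraPow_succ_of_eq (s : Fin r) (k : ℕ) {T U : Crystal r μ}
    (h : kashiwara s T = some U) : kashiwaraPow s (k + 1) T = kashiwaraPow s k U := by
  unfold kashiwaraPow
  rw [Function.iterate_succ_apply, Option.bind_some, h]

theorem phi_eq (s : Fin r) {N : ℕ} {T U : Crystal r μ} (h : kashiwaraPow s N T = some U)
    (hU : kashiwara s U = none) : phi s T = N ∧ stringEnd s T = U := by
  have hnone : ∀ d, kashiwaraPow s (N + 1 + d) T = none := by
    intro d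
    induction d with
    | zero => rw [add_zero, kashiwaraPow_succ, h, Option.bind_some, hU]
    | succ d ih => rw [← add_assoc, kashiwaraPow_succ, ih, Option.bind_none]
  have hset : IsGreatest {k | kashiwaraPow s k T ≠ none} N := by
    refine ⟨by simp [h], fun k hk => ?_⟩
    by_contra hlt
    apply hk
    have := hnone (k - (N + 1))
    rwa [show N + 1 + (k - (N + 1)) = k by omega] at this
  have hphi : phi s T = N := hset.csSup_eq
  exact ⟨hphi, by rw [stringEnd, hphi, h, Option.getD_some]⟩

/-- Each application of the operator lowers the total excess of row `i + 1` over row `i` by one and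
keeps the chain condition. At total `0` no pivot is left. -/
theorem IsChain.exists_stringEnd (s : Fin r) {i : ℕ} (hs : (s.rev : ℕ) = i) (N : ℕ) :
    ∀ T : Crystal r μ, T.IsChain i →
      ∑ k ∈ Finset.Icc (i + 1) r, (T.a (i + 1) k - T.a i k) = N →
      ∃ U : Crystal r μ, kashiwaraPow s N T = some U ∧ kashiwara s U = none ∧
        ∀ i' j, U.a i' j = if i' = i + 1 ∧ i + 1 ≤ j ∧ j ≤ r then T.a i j else T.a i' j := by
  induction N with
  | zero =>
    intro T hT hsum
    have h0 : ∀ k ∈ Finset.Icc (i + 1) r, T.a (i + 1) k - T.a i k = 0 := by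
      refine (Finset.sum_eq_zero_iff_of_nonneg fun k hk => ?_).1 hsum
      rw [Finset.mem_Icc] at hk
      have := T.le_below hk.1 hk.2
      omega
    have h0' : ∀ k, i + 1 ≤ k → k ≤ r → T.a (i + 1) k = T.a i k := fun k h1 h2 => by
      have := h0 k (Finset.mem_Icc.2 ⟨h1, h2⟩)
      omega
    refine ⟨T, rfl, ?_, fun i' j => ?_⟩
    · rw [kashiwara, dif_neg]
      rintro ⟨j, hj⟩
      rw [hs] at hj
      exact IsChain.not_isPivot h0' j hj
    · split_ifs with h
      · rw [h.1, h0' j h.2.1 h.2.2]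
      · rfl
  | succ N ih =>
    intro T hT hsum
    have hex : ∃ j, (i + 1 ≤ j ∧ j ≤ r) ∧ T.a i j < T.a (i + 1) j := by
      by_contra hno
      have : ∑ k ∈ Finset.Icc (i + 1) r, (T.a (i + 1) k - T.a i k) ≤ 0 := by
        refine Finset.sum_nonpos fun k hk => ?_
        rw [Finset.mem_Icc] at hk
        by_contra hpos
        exact hno ⟨k, hk, by omega⟩
      rw [hsum] at this
      push_cast at this
      omega
    classical
    -- The pivot is the leftmost entry of row `i + 1` that still exceeds the entry above it.
    obtain ⟨⟨hij, hj⟩, hlt⟩ := Nat.find_spec hex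
    have hmin' : ∀ k, k < Nat.find hex → ¬((i + 1 ≤ k ∧ k ≤ r) ∧ T.a i k < T.a (i + 1) k) :=
      fun k hk => Nat.find_min hex hk
    generalize Nat.find hex = j at *
    have hmin : ∀ k, i + 1 ≤ k → k < j → T.a (i + 1) k = T.a i k := by
      intro k hik hkj
      have h1 := hmin' k hkj
      have h2 := T.le_below (i := i) (j := k) hik (by omega)
      by_contra hne
      exact h1 ⟨⟨hik, by omega⟩, by omega⟩
    have hp : T.IsPivot (s.rev : ℕ) j := by
      rw [hs]
      exact hT.isPivot hij hj hlt hmin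
    have ha : ∀ i' j', (T.lower _ _ hp).a i' j' =
        if i' = i + 1 ∧ j' = j then T.a i' j' - 1 else T.a i' j' := by
      intro i' j'
      rw [← hs]
      rfl
    obtain ⟨U, hU1, hU2, hU3⟩ := ih (T.lower _ _ hp) (by
      intro k l hik hkl hl hlt'
      rw [ha, ha, if_neg (by omega)] at hlt'
      rw [ha, ha, if_neg (show ¬(i + 2 = i + 1 ∧ l = j) by omega)]
      by_cases hkj : k < j
      · rw [if_neg (by omega), hmin k hik hkj] at hlt'
        exact absurd hlt' (lt_irrefl _)
      · rw [if_neg (by omega)]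
        by_cases hkj' : k = j
        · subst hkj'
          exact hT k l hik hkl hl hlt
        · rw [if_neg (by omega)] at hlt'
          exact hT k l hik hkl hl hlt') (by
      have e : ∀ k ∈ Finset.Icc (i + 1) r,
          (T.lower _ _ hp).a (i + 1) k - (T.lower _ _ hp).a i k =
            (T.a (i + 1) k - T.a i k) - if k = j then 1 else 0 := by
        intro k _
        rw [ha, ha, if_neg (show ¬(i = i + 1 ∧ k = j) by omega)]
        by_cases hk : k = j
        · rw [if_pos ⟨rfl, hk⟩, if_pos hk]; ring
        · rw [if_neg (by tauto), if_neg hk]; ring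
      rw [Finset.sum_congr rfl e, Finset.sum_sub_distrib, hsum, Finset.sum_ite_eq',
        if_pos (Finset.mem_Icc.2 ⟨hij, hj⟩)]
      push_cast
      ring)
    refine ⟨U, ?_, hU2, fun i' j' => ?_⟩
    · rw [kashiwaraPow_succ_of_eq s N (kashiwara_of_isPivot s hp), hU1]
    · rw [hU3, ha, ha]
      by_cases hc : i' = i + 1 ∧ i + 1 ≤ j' ∧ j' ≤ r
      · rw [if_pos hc, if_pos hc, if_neg (by omega)]
      · rw [if_neg hc, if_neg hc, if_neg (by omega)]

/-- A string for which row `i + 2` repeats row `i + 1`. -/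
theorem string_eq (s : Fin r) {i : ℕ} (hs : (s.rev : ℕ) = i) (T : Crystal r μ)
    (hT : ∀ l, i + 2 ≤ l → l ≤ r → T.a (i + 1) l = T.a (i + 2) l) :
    (phi s T : ℤ) = ∑ k ∈ Finset.Icc (i + 1) r, (T.a (i + 1) k - T.a i k) ∧
      ∀ i' j, (stringEnd s T).a i' j =
        if i' = i + 1 ∧ i + 1 ≤ j ∧ j ≤ r then T.a i j else T.a i' j := by
  have hnn : 0 ≤ ∑ k ∈ Finset.Icc (i + 1) r, (T.a (i + 1) k - T.a i k) := by
    refine Finset.sum_nonneg fun k hk => ?_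
    rw [Finset.mem_Icc] at hk
    have := T.le_below hk.1 hk.2
    omega
  obtain ⟨N, hN⟩ := Int.eq_ofNat_of_zero_le hnn
  obtain ⟨U, h1, h2, h3⟩ := IsChain.exists_stringEnd s hs N T
    (fun k l hk hkl hl _ => hT l (by omega) hl) hN
  obtain ⟨e1, e2⟩ := phi_eq s h1 h2
  rw [e1, e2, hN]
  exact ⟨rfl, h3⟩

/-! ### The path of the favourite word -/

/-- The end of the path with the labels of a word. -/
noncomputable def pathEnd : List (Fin r) → Crystal r μ → Crystal r μ
  | [], T => T
  | s :: l, T => pathEnd l (stringEnd s T)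

theorem pathLengths_append (l l' : List (Fin r)) (T : Crystal r μ) :
    pathLengths (l ++ l') T = pathLengths l T ++ pathLengths l' (pathEnd l T) := by
  induction l generalizing T with
  | nil => rfl
  | cons s l ih => simp [pathLengths, pathEnd, ih]

theorem pathEnd_append (l l' : List (Fin r)) (T : Crystal r μ) :
    pathEnd (l ++ l') T = pathEnd l' (pathEnd l T) := by
  induction l generalizing T with
  | nil => rfl
  | cons s l ih => simp [pathEnd, ih]

theorem length_pathLengths (l : List (Fin r)) (T : Crystal r μ) :
    (pathLengths l T).length = l.length := by
  induction l generalizing T with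
  | nil => rfl
  | cons s l ih => simp [pathLengths, ih]

/-- The `Γ`-array of a pattern. -/
def gam (T : Crystal r μ) (i j : ℕ) : ℤ := ∑ k ∈ Finset.Icc j r, (T.a i k - T.a (i - 1) k)

/-- `U` agrees with `T` above row `i₀`, the next `t` rows repeat row `i₀ - 1` of `T`, and the
remaining ones row `i₀`. -/
def IsState (T U : Crystal r μ) (i₀ t : ℕ) : Prop :=
  ∀ i j, i ≤ j → j ≤ r →
    U.a i j = if i < i₀ then T.a i j else if i < i₀ + t then T.a (i₀ - 1) j else T.a i₀ j

/-- The list `[k - 1, …, 0]`. -/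
def descending (r : ℕ) : (k : ℕ) → k ≤ r → List (Fin r)
  | 0, _ => []
  | k + 1, h => ⟨k, h⟩ :: descending r k (by omega)

theorem length_descending {k : ℕ} (hk : k ≤ r) : (descending r k hk).length = k := by
  induction k with
  | zero => rfl
  | succ k ih => simp [descending, ih]

/-- The label `k` acts on row `i + 1 + t`, a copy of row `i + 1` of `T` lying under a copy of row
`i`. Since the rows below are still copies of row `i + 1`, `string_eq` applies. -/
theorem IsState.step {T U : Crystal r μ} {i t k : ℕ} (h : IsState T U (i + 1) t) (hk : k < r)
    (hkt : i + t + k + 1 = r) : (phi ⟨k, hk⟩ U : ℤ) = T.gam (i + 1) (i + 1 + t) ∧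
      IsState T (stringEnd ⟨k, hk⟩ U) (i + 1) (t + 1) := by
  have hs : (((⟨k, hk⟩ : Fin r).rev : Fin r) : ℕ) = i + t := by
    simp only [Fin.val_rev]; omega
  obtain ⟨h1, h2⟩ := string_eq ⟨k, hk⟩ hs U (by
    intro l hl hlr
    rw [h _ _ (by omega) hlr, h _ _ (by omega) hlr, if_neg (by omega), if_neg (by omega),
      if_neg (by omega), if_neg (by omega)])
  have habove : ∀ j, i + t + 1 ≤ j → j ≤ r → U.a (i + t) j = T.a i j := by
    intro j hj hjr
    rw [h _ _ (by omega) hjr]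
    by_cases ht : t = 0
    · subst ht
      rw [if_pos (by omega), add_zero]
    · rw [if_neg (by omega), if_pos (by omega)]
      rfl
  constructor
  · rw [h1, gam, show i + 1 + t = i + t + 1 by omega]
    refine Finset.sum_congr rfl fun j hj => ?_
    rw [Finset.mem_Icc] at hj
    rw [habove j hj.1 hj.2, h _ _ (by omega) hj.2, if_neg (by omega), if_neg (by omega)]
    rfl
  · intro i' j hij hj
    rw [h2]
    by_cases hc : i' = i + t + 1 ∧ i + t + 1 ≤ j ∧ j ≤ r
    · rw [if_pos hc, habove j hc.2.1 hj, if_neg (by omega), if_pos (by omega)]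
      rfl
    · rw [if_neg hc, h i' j hij hj]
      by_cases h1 : i' < i + 1
      · rw [if_pos h1, if_pos h1]
      · rw [if_neg h1, if_neg h1]
        by_cases h2 : i' < i + 1 + t
        · rw [if_pos h2, if_pos (by omega)]
        · rw [if_neg h2, if_neg (by omega)]

theorem IsState.block {T : Crystal r μ} {i : ℕ} (k : ℕ) : ∀ {U : Crystal r μ} {t : ℕ},
    IsState T U (i + 1) t → ∀ hkt : i + t + k = r,
      (∀ u < k, ((pathLengths (descending r k (by omega)) U).getD u 0 : ℤ) =
        T.gam (i + 1) (i + 1 + t + u)) ∧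
      IsState T (pathEnd (descending r k (by omega)) U) (i + 1) (t + k) := by
  induction k with
  | zero => exact fun h _ => ⟨by omega, h⟩
  | succ k ih =>
    intro U t h hkt
    obtain ⟨h1, h2⟩ := h.step (k := k) (by omega) (by omega)
    obtain ⟨h3, h4⟩ := ih h2 (by omega)
    refine ⟨fun u hu => ?_, ?_⟩
    · cases u with
      | zero => simpa [descending, pathLengths] using h1
      | succ u =>
        have := h3 u (by omega)
        simp only [descending, pathLengths, List.getD_cons_succ]
        rw [this]
        congr 1
        omega
    · simp only [descending, pathEnd]
      rw [show t + (k + 1) = t + 1 + k by omega]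
      exact h4

/-- The first `k` blocks of the favourite word. -/
def favouritePrefix (r : ℕ) : (k : ℕ) → k ≤ r → List (Fin r)
  | 0, _ => []
  | k + 1, h => favouritePrefix r k (by omega) ++ descending r (k + 1) h

theorem range_filter_le (m r : ℕ) (h : m < r) :
    (List.range r).filter (fun s => s ≤ m) = List.range (m + 1) := by
  induction r, h using Nat.le_induction with
  | base =>
    rw [List.filter_eq_self]
    intro a ha
    simp at ha ⊢
    omega
  | succ k hk ih =>
    rw [List.range_succ, List.filter_append, ih, List.filter_singleton]
    simp [show ¬k ≤ m by omega]

theorem filter_finRange_reverse {m : ℕ} (hm : m < r) :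
    ((List.finRange r).filter (fun s => s ≤ (⟨m, hm⟩ : Fin r))).reverse =
      descending r (m + 1) hm := by
  rw [List.reverse_eq_iff]
  apply List.map_injective_iff.2 Fin.val_injective
  have hd : ∀ k (hk : k ≤ r), (descending r k hk).reverse.map Fin.val = List.range k := by
    intro k hk
    induction k with
    | zero => rfl
    | succ k ih => rw [descending, List.reverse_cons, List.map_append, ih, List.range_succ]; rfl
  have hf : ((List.finRange r).filter (fun s => s ≤ (⟨m, hm⟩ : Fin r))).map Fin.val =
      ((List.finRange r).map Fin.val).filter (fun s => s ≤ m) := by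
    rw [List.filter_map]
    rfl
  rw [hd, hf, List.map_coe_finRange_eq_range, range_filter_le m r hm]

theorem favouriteWord_eq : favouriteWord r = favouritePrefix r r le_rfl := by
  have key : ∀ k (hk : k ≤ r), ((List.finRange r).take k).flatMap
      (fun m => ((List.finRange r).filter (fun s => s ≤ m)).reverse) = favouritePrefix r k hk := by
    intro k hk
    induction k with
    | zero => rfl
    | succ k ih =>
      rw [List.take_succ_eq_append_getElem (by simpa using hk), List.flatMap_append, ih (by omega),
        favouritePrefix, ← filter_finRange_reverse hk]
      simp
  have := key r le_rfl
  rwa [List.take_of_length_le (by simp)] at this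

/-- The blocks read the pattern from the bottom row upwards. After `k` blocks all rows from `r - k`
on repeat row `r - k` of `T`, the situation in which the next block yields the `Γ`-row `r - k`. The
offset `binom(m+1, 2)` counts the labels of the earlier blocks. -/
theorem favouritePrefix_spec (T : Crystal r μ) (k : ℕ) (hk : k ≤ r) :
    (pathLengths (favouritePrefix r k hk) T).length = (k + 1).choose 2 ∧
      (∀ m < k, ∀ t ≤ m, ((pathLengths (favouritePrefix r k hk) T).getD
        ((m + 1).choose 2 + t) 0 : ℤ) = T.gam (r - m) (r - m + t)) ∧
      IsState T (pathEnd (favouritePrefix r k hk) T) (r - k) 0 := by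
  induction k with
  | zero =>
    refine ⟨rfl, by omega, ?_⟩
    intro i j hij hj
    simp only [favouritePrefix, pathEnd]
    split_ifs with h
    · rfl
    · omega
    · rw [show i = r - 0 by omega]
  | succ k ih =>
    obtain ⟨h1, h2, h3⟩ := ih (by omega)
    have hrk : r - k = (r - (k + 1)) + 1 := by omega
    rw [hrk] at h3
    obtain ⟨h4, h5⟩ := IsState.block (k + 1) h3 (by omega)
    have hch : ∀ m, (m + 1 + 1).choose 2 = (m + 1).choose 2 + (m + 1) := by
      intro m
      rw [Nat.choose_succ_succ' (m + 1) 1, Nat.choose_one_right, add_comm]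
    simp only [favouritePrefix, pathLengths_append, pathEnd_append]
    refine ⟨?_, ?_, ?_⟩
    · rw [List.length_append, h1, length_pathLengths, length_descending, hch]
    · intro m hm t ht
      by_cases hmk : m < k
      · rw [List.getD_append _ _ _ _ (by
          rw [h1]
          have : (m + 1 + 1).choose 2 ≤ (k + 1).choose 2 := Nat.choose_le_choose 2 (by omega)
          rw [hch] at this
          omega)]
        exact h2 m hmk t ht
      · obtain rfl : m = k := by omega
        rw [List.getD_append_right _ _ _ _ (by rw [h1]; omega), h1, Nat.add_sub_cancel_left,
          h4 t (by omega), hrk, add_zero]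
    · intro i j hij hj
      rw [h5 i j hij hj]
      by_cases hi : i < r - (k + 1)
      · rw [if_pos (by omega), if_pos hi]
      · rw [if_neg hi, add_zero, if_neg hi]
        by_cases hi' : i < r - (k + 1) + 1
        · rw [if_pos hi', show i = r - (k + 1) by omega]
        · rw [if_neg hi', if_pos (by omega)]
          rfl

theorem bzl_eq_gam (T : Crystal r μ) {i j : ℕ} (hi : 1 ≤ i) (hij : i ≤ j) (hj : j ≤ r) :
    (T.bzl i j : ℤ) = T.gam i j := by
  rw [bzl, if_pos ⟨hi, hij, hj⟩, favouriteWord_eq]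
  have := (favouritePrefix_spec T r le_rfl).2.1 (r - i) (by omega) (j - i) (by omega)
  rw [show r - i + 1 = r + 1 - i by omega, show r - (r - i) = i by omega,
    show i + (j - i) = j by omega] at this
  exact this

theorem gam_eq_add (T : Crystal r μ) (i : ℕ) {j : ℕ} (hj : j ≤ r) :
    T.gam i j = (T.a i j - T.a (i - 1) j) + T.gam i (j + 1) := by
  unfold gam
  rw [sum_Icc_eq_add _ hj]

theorem gam_top (T : Crystal r μ) (i : ℕ) : T.gam i (r + 1) = 0 := by
  unfold gam
  rw [Finset.Icc_eq_empty (by omega), Finset.sum_empty]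

theorem bzl_eq_gam_succ (T : Crystal r μ) {i j : ℕ} (hi : 1 ≤ i) (hij : i ≤ j) (hj : j ≤ r) :
    (T.bzl i (j + 1) : ℤ) = T.gam i (j + 1) := by
  by_cases h : j + 1 ≤ r
  · exact bzl_eq_gam T hi (by omega) h
  · rw [show j + 1 = r + 1 by omega, gam_top, bzl, if_neg (by omega)]
    rfl

theorem patternOfArray_bzl (T : Crystal r μ) {i j : ℕ} (hij : i ≤ j) (hj : j ≤ r) :
    patternOfArray μ T.bzl i j = T.a i j := by
  induction i generalizing j with
  | zero =>
    rw [patternOfArray, dif_pos (by omega)]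
    exact (T.top ⟨j, by omega⟩).symm
  | succ i ih =>
    rw [patternOfArray, ih (by omega) hj, bzl_eq_gam T (by omega) hij hj,
      bzl_eq_gam_succ T (by omega) hij hj, gam_eq_add T (i + 1) hj]
    simp only [Nat.add_sub_cancel]
    ring

end Crystal

end

/-! ### Matching the row polynomials with interleaving rows, and the recursion for the crystal sum.
-/

section

variable {n r : ℕ}

/-! ### Rows as finite sums -/

/-- The factor of a Gelfand-Tsetlin coefficient, as a function of two adjacent `Γ`-entries and the
difference of the two entries above. -/
noncomputable def entryWeight (gFlat hFlat : ℕ → ℂ) (γ k : ℕ) (D : ℤ) : ℂ :=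
  if (γ : ℤ) = k ∧ (k : ℤ) < γ + D then 1
  else if (γ : ℤ) < k ∧ (k : ℤ) < γ + D then hFlat k
  else if (γ : ℤ) < k ∧ (k : ℤ) = γ + D then gFlat k
  else 0

/-- The antidominant exponents are the pattern entries minus a staircase, so a gap `δ` between
exponents is a gap `δ + 1` between pattern entries. -/
theorem entryWeight_eq_rowWeight (v : ℂ) (g : ZMod n → ℂ) {δ : ℤ} (hδ : 0 ≤ δ) {γ k : ℕ}
    (hk : γ ≤ k) :
    entryWeight (gFlatOf v g) (hFlatOf n v) γ k (δ + 1) = rowWeight n v g δ γ k := by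
  unfold entryWeight rowWeight
  by_cases h1 : k = γ
  · rw [if_pos h1, if_pos (by omega)]
  · rw [if_neg h1, if_neg (by omega)]
    by_cases h2 : (k : ℤ) < γ + δ + 1
    · rw [if_pos h2, if_pos (by omega)]
    · rw [if_neg h2, if_neg (by omega)]
      by_cases h3 : (k : ℤ) = γ + δ + 1
      · rw [if_pos h3, if_pos (by omega)]
      · rw [if_neg h3, if_neg (by omega)]

theorem entryWeight_self (gFlat hFlat : ℕ → ℂ) (γ : ℕ) : entryWeight gFlat hFlat γ γ 0 = 0 := by
  unfold entryWeight
  rw [if_neg (by omega), if_neg (by omega), if_neg (by omega)]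

/-- The rows that interleave `μ`. -/
noncomputable def rowSet {R : ℕ} (μ : Weight R) : Finset (Fin R → ℤ) :=
  Fintype.piFinset fun j => Finset.Icc (μ j.succ) (μ j.castSucc)

theorem mem_rowSet {R : ℕ} {μ : Weight R} {β : Fin R → ℤ} :
    β ∈ rowSet μ ↔ ∀ j, μ j.succ ≤ β j ∧ β j ≤ μ j.castSucc := by
  simp [rowSet]

/-- The `Γ`-entries of the row `β` below `μ`. -/
def rowGamma {R : ℕ} (μ : Weight R) (β : Fin R → ℤ) (j : ℕ) : ℕ :=
  (∑ k : Fin R, if j ≤ k then β k - μ k.succ else 0).toNat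

/-- The contribution of the row `β` below `μ` to the Gelfand-Tsetlin coefficient. -/
noncomputable def rowCoeff (gFlat hFlat : ℕ → ℂ) {R : ℕ} (μ : Weight R) (β : Fin R → ℤ) : ℂ :=
  ∏ j : Fin R, entryWeight gFlat hFlat (rowGamma μ β (j + 1)) (rowGamma μ β j)
    (μ j.castSucc - μ j.succ)

/-- The monomial attached to the row `β`. -/
noncomputable def rowMonomial (r : ℕ) {R : ℕ} (β : Fin R → ℤ) : RatFun r :=
  ∏ j : Fin R, xvar r (R - 1 - j) ^ (β j - (R - 1 - j : ℕ))

/-- The antidominant exponents `i ↦ μ_{R-i} - i`. -/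
def antiShift {R : ℕ} (μ : Weight R) (i : ℕ) : ℤ := μ ⟨R - i, by omega⟩ - i

theorem antiShift_tail {R : ℕ} (μ : Weight (R + 1)) {i : ℕ} (hi : i ≤ R) :
    antiShift (fun j : Fin (R + 1) => μ j.succ) i = antiShift μ i := by
  have h : (⟨R - i, by omega⟩ : Fin (R + 1)).succ = ⟨R + 1 - i, by omega⟩ :=
    Fin.ext (by simp only [Fin.val_succ]; omega)
  simp only [antiShift, h]

theorem rowPoly_congr (v : ℂ) (g : ZMod n → ℂ) {κ κ' : ℕ → ℤ} {R : ℕ} (h : ∀ i ≤ R, κ i = κ' i)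
    (k : ℕ) : rowPoly n r v g κ R k = rowPoly n r v g κ' R k := by
  induction R generalizing k with
  | zero => rfl
  | succ R ih =>
    rw [rowPoly, rowPoly, h (R + 1) le_rfl, h R (by omega)]
    exact Finset.sum_congr rfl fun γ _ => by rw [ih fun i hi => h i (by omega)]

theorem rowBound_congr {κ κ' : ℕ → ℤ} {R : ℕ} (h : ∀ i ≤ R, κ i = κ' i) :
    rowBound κ R = rowBound κ' R := by
  induction R with
  | zero => rfl
  | succ R ih =>
    rw [rowBound, rowBound, h (R + 1) le_rfl, h R (by omega), ih fun i hi => h i (by omega)]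

theorem sum_rowSet_succ {R : ℕ} {M : Type*} [AddCommMonoid M] (μ : Weight (R + 1))
    (f : (Fin (R + 1) → ℤ) → M) :
    ∑ β ∈ rowSet μ, f β = ∑ β ∈ rowSet (fun j : Fin (R + 1) => μ j.succ),
      ∑ b ∈ Finset.Icc (μ 1) (μ 0), f (Fin.cons b β) := by
  rw [← Finset.sum_product' _ _ fun β b => f (Fin.cons b β)]
  refine Finset.sum_nbij' (fun β => (Fin.tail β, β 0)) (fun p => Fin.cons p.2 p.1) ?_ ?_ ?_ ?_ ?_
  · intro β hβ
    rw [mem_rowSet] at hβ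
    rw [Finset.mem_product, mem_rowSet, Finset.mem_Icc]
    exact ⟨fun j => hβ j.succ, hβ 0⟩
  · intro p hp
    rw [Finset.mem_product, mem_rowSet, Finset.mem_Icc] at hp
    rw [mem_rowSet]
    intro j
    refine Fin.cases ?_ (fun j => ?_) j
    · exact hp.2
    · exact hp.1 j
  · intro β _
    exact Fin.cons_self_tail β
  · intro p _
    rfl
  · intro β _
    simp only [Fin.cons_self_tail]

theorem rowSum_nonneg {R : ℕ} {μ : Weight R} {β : Fin R → ℤ} (h : β ∈ rowSet μ) (j : ℕ) :
    0 ≤ ∑ k : Fin R, if j ≤ k then β k - μ k.succ else 0 := by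
  rw [mem_rowSet] at h
  refine Finset.sum_nonneg fun k _ => ?_
  have := h k
  split_ifs <;> omega

theorem rowGamma_cons_succ {R : ℕ} (μ : Weight (R + 1)) (β : Fin R → ℤ) (b : ℤ) (j : ℕ) :
    rowGamma μ (Fin.cons b β) (j + 1) = rowGamma (fun j : Fin (R + 1) => μ j.succ) β j := by
  unfold rowGamma
  rw [Fin.sum_univ_succ]
  simp

theorem rowGamma_cons_zero {R : ℕ} (μ : Weight (R + 1)) {β : Fin R → ℤ}
    (hβ : β ∈ rowSet (fun j : Fin (R + 1) => μ j.succ)) {b : ℤ} (hb : μ 1 ≤ b) :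
    (rowGamma μ (Fin.cons b β) 0 : ℤ) =
      rowGamma (fun j : Fin (R + 1) => μ j.succ) β 0 + (b - μ 1) := by
  have h := rowSum_nonneg hβ 0
  unfold rowGamma
  rw [Fin.sum_univ_succ]
  simp only [zero_le, if_true, Fin.cons_zero, Fin.cons_succ, Fin.succ_zero_eq_one] at h ⊢
  omega

theorem rowMonomial_cons {R : ℕ} (β : Fin R → ℤ) (b : ℤ) :
    rowMonomial r (Fin.cons b β : Fin (R + 1) → ℤ) =
      xvar r R ^ (b - R) * rowMonomial r β := by
  unfold rowMonomial
  rw [Fin.prod_univ_succ]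
  simp only [Fin.val_zero, Nat.add_sub_cancel, Nat.sub_zero, Fin.cons_zero, Fin.cons_succ,
    Fin.val_succ]
  congr 1
  refine Finset.prod_congr rfl fun j _ => ?_
  rw [show R - (↑j + 1) = R - 1 - (j : ℕ) by omega]

theorem rowMonomial_eq {R : ℕ} (β : Weight R) :
    rowMonomial r β = initialMonomial r (antiShift β) R := by
  unfold rowMonomial initialMonomial
  rw [Finset.prod_range, ← Equiv.prod_comp Fin.revPerm]
  refine Finset.prod_congr rfl fun j _ => ?_
  simp only [Fin.revPerm_apply, antiShift, Fin.val_rev]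
  rw [show R + 1 - 1 - (R + 1 - (↑j + 1)) = (j : ℕ) by omega]
  congr 3
  exact Fin.ext (by simp only [Fin.val_rev]; omega)

/-- Unrolls the recursion of `rowPoly` into a sum over interleaving rows. The test function `F` of
the first `Γ`-entry is what makes the induction close: summing out the leftmost entry of `β`
produces a new test function. -/
theorem sum_rowPoly (v : ℂ) (g : ZMod n → ℂ) {R : ℕ} (μ : Weight R)
    (hμ : ∀ j : Fin R, μ j.succ < μ j.castSucc) (F : ℕ → RatFun r) :
    ∑ k ∈ Finset.range (rowBound (antiShift μ) R + 1), rowPoly n r v g (antiShift μ) R k * F k =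
      ∑ β ∈ rowSet μ, const (rowCoeff (gFlatOf v g) (hFlatOf n v) μ β) *
        (rowMonomial r β * F (rowGamma μ β 0)) := by
  induction R generalizing F with
  | zero =>
    have : rowSet μ = {Fin.elim0} := by
      ext β
      rw [mem_rowSet, Finset.mem_singleton]
      exact ⟨fun _ => funext fun j => j.elim0, fun _ j => j.elim0⟩
    rw [this]
    simp [rowBound, rowPoly, rowCoeff, rowMonomial, rowGamma, const_one]
  | succ R ih =>
    set μ' : Weight R := fun j => μ j.succ with hμ'
    have hc : ∀ i ≤ R, antiShift μ' i = antiShift μ i := fun i hi => antiShift_tail μ hi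
    have h01 : μ 1 < μ 0 := hμ 0
    set δ := antiShift μ (R + 1) - antiShift μ R with hδ
    have hδ' : δ + 1 = μ 0 - μ 1 := by
      simp only [hδ, antiShift]
      have e0 : (⟨R + 1 - (R + 1), by omega⟩ : Fin (R + 1 + 1)) = 0 := by simp
      have e1 : (⟨R + 1 - R, by omega⟩ : Fin (R + 1 + 1)) = 1 := by simp
      rw [e0, e1]
      push_cast
      ring
    have hR1 : antiShift μ R = μ 1 - R := by
      simp only [antiShift]
      have e1 : (⟨R + 1 - R, by omega⟩ : Fin (R + 1 + 1)) = 1 := by simp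
      rw [e1]
    -- The leftmost entry `b` corresponds to the first `Γ`-entry `k = γ + (b - μ 1)`; the weight
    -- vanishes for `k` outside the range so obtained.
    let F' : ℕ → RatFun r := fun γ => ∑ b ∈ Finset.Icc (μ 1) (μ 0),
      const (rowWeight n v g δ γ (γ + (b - μ 1).toNat)) *
        (xvar r R ^ (b - R) * F (γ + (b - μ 1).toNat))
    have hF' : ∀ γ ≤ rowBound (antiShift μ) R,
        F' γ = ∑ k ∈ Finset.range (rowBound (antiShift μ) (R + 1) + 1),
          if γ ≤ k then const (rowWeight n v g δ γ k) *
            (xvar r R ^ (antiShift μ R - γ + k) * F k) else 0 := by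
      intro γ hγ
      rw [← Finset.sum_filter]
      have hsub : (Finset.Icc γ (γ + (δ + 1).toNat)) ⊆
          (Finset.range (rowBound (antiShift μ) (R + 1) + 1)).filter (fun k => γ ≤ k) := by
        intro k hk
        rw [Finset.mem_Icc] at hk
        rw [Finset.mem_filter, Finset.mem_range, rowBound, ← hδ]
        omega
      rw [← Finset.sum_subset hsub]
      · refine Finset.sum_nbij' (fun b => γ + (b - μ 1).toNat) (fun k => μ 1 + (k - γ : ℕ))
          ?_ ?_ ?_ ?_ ?_
        · intro b hb
          rw [Finset.mem_Icc] at hb ⊢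
          omega
        · intro k hk
          rw [Finset.mem_Icc] at hk ⊢
          omega
        · intro b hb
          rw [Finset.mem_Icc] at hb
          omega
        · intro k hk
          rw [Finset.mem_Icc] at hk
          omega
        · intro b hb
          rw [Finset.mem_Icc] at hb
          have : antiShift μ R - γ + (γ + (b - μ 1).toNat : ℕ) = b - R := by
            rw [hR1]
            omega
          rw [this]
      · intro k hk hk'
        rw [Finset.mem_filter] at hk
        rw [Finset.mem_Icc] at hk'
        rw [rowWeight, if_neg (by omega), if_neg (by omega), if_neg (by omega), const_zero,
          zero_mul]
    have step : ∑ k ∈ Finset.range (rowBound (antiShift μ) (R + 1) + 1),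
        rowPoly n r v g (antiShift μ) (R + 1) k * F k =
        ∑ γ ∈ Finset.range (rowBound (antiShift μ') R + 1),
          rowPoly n r v g (antiShift μ') R γ * F' γ := by
      rw [rowBound_congr hc]
      have e1 : ∀ k, rowPoly n r v g (antiShift μ) (R + 1) k * F k =
          ∑ γ ∈ Finset.range (rowBound (antiShift μ) R + 1), rowPoly n r v g (antiShift μ) R γ *
            (if γ ≤ k then const (rowWeight n v g δ γ k) *
              (xvar r R ^ (antiShift μ R - γ + k) * F k) else 0) := by
        intro k
        rw [rowPoly, Finset.sum_mul, ← hδ]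
        have e2 : ∑ γ ∈ Finset.range (rowBound (antiShift μ) R + 1),
            rowPoly n r v g (antiShift μ) R γ * (if γ ≤ k then const (rowWeight n v g δ γ k) *
              (xvar r R ^ (antiShift μ R - γ + k) * F k) else 0) =
            ∑ γ ∈ Finset.range (rowBound (antiShift μ) R + k + 1),
            rowPoly n r v g (antiShift μ) R γ * (if γ ≤ k then const (rowWeight n v g δ γ k) *
              (xvar r R ^ (antiShift μ R - γ + k) * F k) else 0) := by
          refine Finset.sum_subset (Finset.range_subset_range.2 (by omega)) fun γ _ hγ => ?_
          rw [Finset.mem_range] at hγ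
          rw [rowPoly_eq_zero v g _ (by omega), zero_mul]
        rw [e2, ← Finset.sum_subset (Finset.range_subset_range.2
          (show k + 1 ≤ rowBound (antiShift μ) R + k + 1 by omega))]
        · refine Finset.sum_congr rfl fun γ hγ => ?_
          rw [Finset.mem_range] at hγ
          rw [if_pos (by omega)]
          ring
        · intro γ _ hγ
          rw [Finset.mem_range] at hγ
          rw [if_neg (by omega), mul_zero]
      rw [Finset.sum_congr rfl fun k _ => e1 k, Finset.sum_comm]
      refine Finset.sum_congr rfl fun γ hγ => ?_
      rw [Finset.mem_range] at hγ
      rw [hF' γ (by omega), rowPoly_congr v g hc, Finset.mul_sum]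
    rw [step, ih μ' (fun j => hμ j.succ) F', sum_rowSet_succ]
    refine Finset.sum_congr rfl fun β hβ => ?_
    rw [Finset.mul_sum, Finset.mul_sum]
    refine Finset.sum_congr rfl fun b hb => ?_
    rw [Finset.mem_Icc] at hb
    have hg0 : rowGamma μ (Fin.cons b β) 0 = rowGamma μ' β 0 + (b - μ 1).toNat := by
      have : (rowGamma μ (Fin.cons b β) 0 : ℤ) = rowGamma μ' β 0 + (b - μ 1) :=
        rowGamma_cons_zero μ hβ hb.1
      omega
    have hcoef : rowCoeff (gFlatOf v g) (hFlatOf n v) μ (Fin.cons b β) =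
        rowWeight n v g δ (rowGamma μ' β 0) (rowGamma μ' β 0 + (b - μ 1).toNat) *
          rowCoeff (gFlatOf v g) (hFlatOf n v) μ' β := by
      unfold rowCoeff
      rw [Fin.prod_univ_succ, ← entryWeight_eq_rowWeight v g (by omega) (by omega), hδ',
        ← hg0]
      simp only [Fin.val_zero, Fin.val_succ, rowGamma_cons_succ]
      rfl
    rw [hg0, hcoef, rowMonomial_cons, const_mul]
    ring

/-! ### Recursion for the sum over the crystal -/

namespace Crystal

variable {R : ℕ}

theorem gtFactor_bzl (gFlat hFlat : ℕ → ℂ) {μ : Weight R} (T : Crystal R μ) {i j : ℕ} (hi : 1 ≤ i)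
    (hij : i ≤ j) (hj : j ≤ R) :
    gtFactor gFlat hFlat μ T.bzl i j =
      entryWeight gFlat hFlat (T.gam i (j + 1)).toNat (T.gam i j).toNat
        (T.a (i - 1) (j - 1) - T.a (i - 1) j) := by
  unfold gtFactor entryWeight
  rw [← bzl_eq_gam T hi hij hj, ← bzl_eq_gam_succ T hi hij hj,
    patternOfArray_bzl T (by omega) (by omega), patternOfArray_bzl T (by omega) hj]
  simp only [Int.toNat_natCast, add_sub_assoc]

/-- The pattern with first row `μ` and second row that of a smaller pattern. -/
def extend {μ : Weight (R + 1)} {β : Weight R} (hβ : β ∈ rowSet μ) (T : Crystal R β) :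
    Crystal (R + 1) μ where
  a
    | 0, j => if h : j < R + 2 then μ ⟨j, h⟩ else 0
    | _ + 1, 0 => 0
    | i + 1, j + 1 => T.a i j
  top := fun j => dif_pos j.2
  interleave := by
    intro i j hij hj
    cases i with
    | zero =>
      have h := mem_rowSet.1 hβ ⟨j, hj⟩
      have ht := T.top ⟨j, hj⟩
      simp only at ht
      simp only [ht, dif_pos (show j < R + 2 by omega), dif_pos (show j + 1 < R + 2 by omega)]
      exact ⟨h.2, h.1⟩
    | succ i =>
      obtain ⟨j, rfl⟩ : ∃ j', j = j' + 1 := ⟨j - 1, by omega⟩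
      exact T.interleave i j (by omega) (by omega)
  outside := by
    intro i j hij
    match i, j with
    | 0, j => exact dif_neg (by omega)
    | i + 1, 0 => rfl
    | i + 1, j + 1 => exact T.outside i j (by omega)

/-- The pattern without its first row. -/
def restrict {μ : Weight (R + 1)} (T : Crystal (R + 1) μ) :
    Crystal R (fun j => T.a 1 (j + 1)) where
  a := fun i j => T.a (i + 1) (j + 1)
  top := fun _ => rfl
  interleave := fun i j hij hj => T.interleave (i + 1) (j + 1) (by omega) (by omega)
  outside := fun i j h => T.outside (i + 1) (j + 1) (by omega)

theorem row_mem_rowSet {μ : Weight (R + 1)} (T : Crystal (R + 1) μ) :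
    (fun j : Fin (R + 1) => T.a 1 (j + 1)) ∈ rowSet μ := by
  rw [mem_rowSet]
  intro j
  have h := T.interleave 0 j (by omega) (by omega)
  have h1 := T.top j.castSucc
  have h2 := T.top j.succ
  simp only [Fin.val_castSucc, Fin.val_succ] at h1 h2
  rw [h1, h2] at h
  exact ⟨h.2, h.1⟩

theorem sum_succ {M : Type*} [AddCommMonoid M] {μ : Weight (R + 1)} (f : Crystal (R + 1) μ → M) :
    ∑ T, f T = ∑ β : rowSet μ, ∑ T : Crystal R (β : Fin (R + 1) → ℤ), f (extend β.2 T) := by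
  rw [← Fintype.sum_sigma']
  symm
  refine Function.Bijective.sum_comp (g := f)
    (e := fun x : Σ β : rowSet μ, Crystal R (β : Fin (R + 1) → ℤ) => extend x.1.2 x.2) ⟨?_, ?_⟩
  · rintro ⟨⟨β, hβ⟩, T⟩ ⟨⟨β', hβ'⟩, T'⟩ h
    have ha : T.a = T'.a := by
      funext i j
      exact congrFun (congrFun (congrArg Crystal.a h) (i + 1)) (j + 1)
    have hb : β = β' := by
      funext j
      exact (T.top j).symm.trans ((congrFun (congrFun ha 0) j).trans (T'.top j))
    subst hb
    rw [ext_a ha]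
  · intro T
    refine ⟨⟨⟨_, T.row_mem_rowSet⟩, T.restrict⟩, ext_a ?_⟩
    funext i j
    match i, j with
    | 0, j =>
      change (if h : j < R + 2 then μ ⟨j, h⟩ else 0) = _
      split_ifs with h
      · exact (T.top ⟨j, h⟩).symm
      · exact (T.outside 0 j (by omega)).symm
    | i + 1, 0 => exact (T.outside (i + 1) 0 (by omega)).symm
    | i + 1, j + 1 => rfl

theorem sum_Icc_succ_succ {M : Type*} [AddCommMonoid M] (f : ℕ → M) (i R : ℕ) :
    ∑ j ∈ Finset.Icc (i + 1) (R + 1), f j = ∑ j ∈ Finset.Icc i R, f (j + 1) := by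
  rw [← Finset.map_add_right_Icc, Finset.sum_map]
  rfl

theorem prod_Icc_succ_succ {M : Type*} [CommMonoid M] (f : ℕ → M) (i R : ℕ) :
    ∏ j ∈ Finset.Icc (i + 1) (R + 1), f j = ∏ j ∈ Finset.Icc i R, f (j + 1) := by
  rw [← Finset.map_add_right_Icc, Finset.prod_map]
  rfl

theorem prod_Icc_zero {M : Type*} [CommMonoid M] (f : ℕ → M) (R : ℕ) :
    ∏ j ∈ Finset.Icc 0 R, f j = ∏ j : Fin (R + 1), f j := by
  rw [← Finset.prod_range f]
  congr 1
  ext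
  simp only [Finset.mem_Icc, Finset.mem_range]
  omega

variable {μ : Weight (R + 1)} {β : Weight R} (hβ : β ∈ rowSet μ) (T : Crystal R β)

theorem extend_zero {j : ℕ} (hj : j < R + 2) : (extend hβ T).a 0 j = μ ⟨j, hj⟩ :=
  (extend hβ T).top ⟨j, hj⟩

theorem gam_extend_succ (i j : ℕ) (hi : 1 ≤ i) :
    (extend hβ T).gam (i + 1) (j + 1) = T.gam i j := by
  obtain ⟨i, rfl⟩ : ∃ i', i = i' + 1 := ⟨i - 1, by omega⟩
  unfold gam
  rw [sum_Icc_succ_succ]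
  rfl

theorem gam_extend_one (j : ℕ) : ((extend hβ T).gam 1 (j + 1)).toNat = rowGamma μ β j := by
  unfold gam rowGamma
  congr 1
  have h : Finset.Icc j R = (Finset.range (R + 1)).filter (j ≤ ·) := by
    ext
    simp only [Finset.mem_Icc, Finset.mem_filter, Finset.mem_range]
    omega
  rw [sum_Icc_succ_succ, h, Finset.sum_filter, Finset.sum_range]
  refine Finset.sum_congr rfl fun k _ => ?_
  rw [Nat.sub_self, extend_zero hβ T (by omega : (k : ℕ) + 1 < R + 2)]
  split_ifs
  · exact congrArg (· - _) (T.top k)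
  · rfl

/-- The factors with `i = 1` see only `μ` and the row `β`; the factors with `i > 1` are those of the
smaller pattern, with both indices shifted by one. -/
theorem gtCoeff_extend (gFlat hFlat : ℕ → ℂ) :
    gtCoeff gFlat hFlat μ (extend hβ T).bzl =
      rowCoeff gFlat hFlat μ β * gtCoeff gFlat hFlat β T.bzl := by
  unfold gtCoeff
  rw [← Finset.mul_prod_Ioc_eq_prod_Icc (by omega : 1 ≤ R + 1)]
  congr 1
  · rw [prod_Icc_succ_succ, prod_Icc_zero, rowCoeff]
    refine Finset.prod_congr rfl fun j _ => ?_
    rw [gtFactor_bzl _ _ _ le_rfl (by omega) (by omega), gam_extend_one, gam_extend_one]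
    rw [show (j : ℕ) + 1 - 1 = j by omega, Nat.sub_self, extend_zero hβ T (by omega : (j : ℕ) < R + 2),
      extend_zero hβ T (by omega : (j : ℕ) + 1 < R + 2)]
    rfl
  · have : Finset.Ioc 1 (R + 1) = Finset.Icc (1 + 1) (R + 1) := by
      ext
      simp only [Finset.mem_Ioc, Finset.mem_Icc]
      omega
    rw [this, prod_Icc_succ_succ]
    refine Finset.prod_congr rfl fun i hi => ?_
    rw [Finset.mem_Icc] at hi
    rw [prod_Icc_succ_succ]
    refine Finset.prod_congr rfl fun j hj => ?_
    rw [Finset.mem_Icc] at hj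
    rw [gtFactor_bzl _ _ _ (by omega) (by omega) (by omega), gtFactor_bzl _ _ _ hi.1 hj.1 hj.2,
      gam_extend_succ hβ T _ _ hi.1, gam_extend_succ hβ T _ _ hi.1]
    obtain ⟨i, rfl⟩ : ∃ i', i = i' + 1 := ⟨i - 1, by omega⟩
    obtain ⟨j, rfl⟩ : ∃ j', j = j' + 1 := ⟨j - 1, by omega⟩
    rfl

theorem rowSum_extend_succ (i : ℕ) : (extend hβ T).rowSum (i + 1) = T.rowSum i := by
  unfold rowSum
  rw [sum_Icc_succ_succ]
  rfl

theorem wt_extend_castSucc (m : Fin (R + 1)) : (extend hβ T).wt m.castSucc = T.wt m := by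
  unfold wt
  rw [Fin.val_castSucc, show R + 1 - (m : ℕ) = R - m + 1 by omega, rowSum_extend_succ,
    rowSum_extend_succ]

theorem rowSum_zero {r : ℕ} {ν : Weight r} (S : Crystal r ν) : S.rowSum 0 = ∑ j, ν j := by
  have h : Finset.Icc 0 r = Finset.range (r + 1) := by
    ext
    simp only [Finset.mem_Icc, Finset.mem_range]
    omega
  rw [rowSum, h, Finset.sum_range]
  exact Finset.sum_congr rfl fun j _ => S.top j

theorem wt_extend_last : (extend hβ T).wt (Fin.last (R + 1)) = ∑ j, μ j - ∑ j, β j := by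
  unfold wt
  rw [Fin.val_last, Nat.sub_self, rowSum_extend_succ, rowSum_zero, rowSum_zero]

end Crystal

end

/-! ### The two recursions agree: the metaplectic identity. -/

section

variable {n r : ℕ}

/-! ### The Hecke symmetrizer of a monomial as a sum over the crystal -/

theorem initialMonomial_eq_monomial (κ : ℕ → ℤ) {R : ℕ} (hR : R ≤ r) :
    initialMonomial r κ R = monomial fun k => if (k : ℕ) ≤ R then κ k else 0 := by
  have h : (monomial fun k => if (k : ℕ) ≤ R then κ k else 0) =
      ∏ k ∈ Finset.range (r + 1), xvar r k ^ (if k ≤ R then κ k else 0) := by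
    rw [Finset.prod_range]
    exact Finset.prod_congr rfl fun k _ => by rw [xvar_coe]
  rw [h, initialMonomial, ← Finset.prod_subset (Finset.range_subset_range.2 (by omega : R + 1 ≤ r + 1))]
  · refine Finset.prod_congr rfl fun k hk => ?_
    rw [Finset.mem_range] at hk
    rw [if_pos (by omega)]
  · intro k _ hk
    rw [Finset.mem_range] at hk
    rw [if_neg (by omega), zpow_zero]

theorem heckeOp_initialMonomial [NeZero n] {v : ℂ} {g : ZMod n → ℂ} (hg : g 0 = -1) (κ : ℕ → ℤ)
    {R i : ℕ} (hR : R ≤ r) (hi : i < R) (h : κ (i + 1) + 1 = κ i) :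
    heckeOp n r v g i (initialMonomial r κ R) = -initialMonomial r κ R := by
  rw [heckeOp, dif_pos (by omega), initialMonomial_eq_monomial κ hR]
  refine demazureLusztig_monomial_zero hg _ _ ?_
  simp only [Fin.val_succ, Fin.val_castSucc]
  rw [if_pos (by omega), if_pos (by omega), h]

/-- A drop by exactly one puts the monomial in the `-1` eigenspace of `T_i`, and `1 + T_i` is a
right factor of the symmetrizer. -/
theorem symmetrizer_initialMonomial_eq_zero [NeZero n] {v : ℂ} {g : ZMod n → ℂ}
    (hg : IsMetaplecticParameters n v g) (κ : ℕ → ℤ) {R i : ℕ} (hR : R ≤ r) (hi : i < R)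
    (h : κ (i + 1) + 1 = κ i) :
    symmetrizer (heckeOp n r v g) (R + 1) (initialMonomial r κ R) = 0 := by
  obtain ⟨Y, hY⟩ := symmetrizer_dvd (heckeOp_braidFamily (r := r) hg) (R := R + 1) (i := i)
    (by omega) (by omega)
  rw [hY, Module.End.mul_apply, LinearMap.add_apply, Module.End.one_apply,
    heckeOp_initialMonomial hg.1 κ hR hi h, add_neg_cancel, map_zero]

/-- Interleaving between equal neighbours fixes the entry, so `m = Γ = M`: the case of weight `0`.
-/
theorem rowCoeff_eq_zero (gFlat hFlat : ℕ → ℂ) {R : ℕ} {μ : Weight R} {β : Fin R → ℤ}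
    (hβ : β ∈ rowSet μ) {j : Fin R} (hj : μ j.succ = μ j.castSucc) :
    rowCoeff gFlat hFlat μ β = 0 := by
  refine Finset.prod_eq_zero (Finset.mem_univ j) ?_
  have h := mem_rowSet.1 hβ j
  have e : rowGamma μ β j = rowGamma μ β (j + 1) := by
    unfold rowGamma
    congr 1
    refine Finset.sum_congr rfl fun k _ => ?_
    by_cases hk : k = j
    · subst hk
      rw [if_pos le_rfl, if_neg (by omega)]
      omega
    · have hk' : (k : ℕ) ≠ j := fun h => hk (Fin.ext h)
      split_ifs <;> omega
  rw [e, hj, sub_self, entryWeight_self]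

/-- The sum over the crystal, in the first `R + 1` variables. -/
noncomputable def crystalPoly (r : ℕ) (gFlat hFlat : ℕ → ℂ) {R : ℕ} (μ : Weight R) : RatFun r :=
  ∑ T : Crystal R μ, const (gtCoeff gFlat hFlat μ T.bzl) * ∏ m : Fin (R + 1), xvar r m ^ T.wt m

theorem crystalPoly_self (gFlat hFlat : ℕ → ℂ) (μ : Weight r) :
    crystalPoly r gFlat hFlat μ = crystalSum gFlat hFlat μ :=
  Finset.sum_congr rfl fun T _ => by
    congr 1
    exact Finset.prod_congr rfl fun m _ => by rw [xvar_coe]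

theorem crystalPoly_succ (gFlat hFlat : ℕ → ℂ) {R : ℕ} (μ : Weight (R + 1)) :
    crystalPoly r gFlat hFlat μ = ∑ β ∈ rowSet μ, const (rowCoeff gFlat hFlat μ β) *
      (xvar r (R + 1) ^ (∑ j, μ j - ∑ j, β j) * crystalPoly r gFlat hFlat (R := R) β) := by
  rw [crystalPoly, Crystal.sum_succ, ← Finset.sum_coe_sort (rowSet μ)]
  refine Finset.sum_congr rfl fun β _ => ?_
  rw [crystalPoly, Finset.mul_sum, Finset.mul_sum]
  refine Finset.sum_congr rfl fun T _ => ?_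
  rw [Crystal.gtCoeff_extend, Fin.prod_univ_castSucc, Crystal.wt_extend_last, const_mul]
  simp only [Crystal.wt_extend_castSucc, Fin.val_castSucc, Fin.val_last]
  ring

theorem crystalPoly_zero (gFlat hFlat : ℕ → ℂ) (μ : Weight 0) :
    crystalPoly r gFlat hFlat μ = xvar r 0 ^ μ 0 := by
  let T₀ : Crystal 0 μ :=
    { a := fun i j => if i = 0 ∧ j = 0 then μ 0 else 0
      top := fun j => by
        obtain rfl : j = 0 := Fin.eq_zero j
        rfl
      interleave := fun i j _ h => absurd h (Nat.not_lt_zero j)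
      outside := fun i j h => if_neg (by omega) }
  have huniq : ∀ T : Crystal 0 μ, T = T₀ := by
    intro T
    refine Crystal.ext_a ?_
    funext i j
    by_cases h : i = 0 ∧ j = 0
    · obtain ⟨rfl, rfl⟩ := h
      exact T.top 0
    · exact (T.outside i j (by omega)).trans (T₀.outside i j (by omega)).symm
  rw [crystalPoly, Fintype.sum_eq_single T₀ fun T hT => absurd (huniq T) hT]
  have hw : T₀.wt 0 = μ 0 := by
    simp [Crystal.wt, Crystal.rowSum, T₀]
  simp [gtCoeff, const_one, hw]

/-- Peeling off a strict top row leaves rows `β` that are only weakly decreasing. The claim is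
therefore made for weakly decreasing `μ`, and both sides vanish when two neighbours are equal. -/
theorem symmetrizer_eq_crystalPoly [NeZero n] {v : ℂ} {g : ZMod n → ℂ}
    (hg : IsMetaplecticParameters n v g) {R : ℕ} (hR : R ≤ r) (μ : Weight R)
    (hμ : ∀ j : Fin R, μ j.succ ≤ μ j.castSucc) :
    symmetrizer (heckeOp n r v g) (R + 1) (initialMonomial r (antiShift μ) R) =
      initialMonomial r (fun i => -i) R * crystalPoly r (gFlatOf v g) (hFlatOf n v) μ := by
  induction R with
  | zero =>
    rw [crystalPoly_zero]
    simp [symmetrizer, cosetSum, initialMonomial, antiShift]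
  | succ R ih =>
    by_cases hs : ∀ j : Fin (R + 1), μ j.succ < μ j.castSucc
    -- Strict decrease of the integers `μ_j` absorbs the staircase shift and leaves weakly
    -- increasing exponents.
    · have hκ : ∀ i < R + 1, antiShift μ i ≤ antiShift μ (i + 1) := by
        intro i hi
        have h := hs ⟨R - i, by omega⟩
        have e1 : (⟨R - i, by omega⟩ : Fin (R + 1)).succ = ⟨R + 1 - i, by omega⟩ :=
          Fin.ext (by simp only [Fin.val_succ]; omega)
        have e2 : (⟨R - i, by omega⟩ : Fin (R + 1)).castSucc = ⟨R + 1 - (i + 1), by omega⟩ :=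
          Fin.ext (by simp only [Fin.val_castSucc]; omega)
        rw [e1, e2] at h
        have e3 := Nat.cast_succ (R := ℤ) i
        unfold antiShift
        omega
      rw [symmetrizer_initialMonomial hg _ hR hκ,
        sum_rowPoly v g μ hs fun γ => xvar r (R + 1) ^ (antiShift μ (R + 1) - γ), map_sum,
        crystalPoly_succ, Finset.mul_sum]
      refine Finset.sum_congr rfl fun β hβ => ?_
      have hβ' := mem_rowSet.1 hβ
      -- The first `Γ`-entry is `|β| - (|μ| - μ_0)`, so the exponent is the weight of the last
      -- letter, `|μ| - |β|`, shifted by the component `-(R + 1)` of `-w₀ρ`.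
      have hexp : antiShift μ (R + 1) - rowGamma μ β 0 =
          -((R + 1 : ℕ) : ℤ) + (∑ j, μ j - ∑ j, β j) := by
        have h0 := rowSum_nonneg hβ 0
        have e0 : (⟨R + 1 - (R + 1), by omega⟩ : Fin (R + 1 + 1)) = 0 := by simp
        have hsum : ∑ k : Fin (R + 1), (if 0 ≤ (k : ℕ) then β k - μ k.succ else 0) =
            ∑ j, β j - ∑ j : Fin (R + 1), μ j.succ := by
          rw [← Finset.sum_sub_distrib]
          exact Finset.sum_congr rfl fun k _ => if_pos (Nat.zero_le _)
        rw [hsum] at h0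
        rw [rowGamma, hsum, Int.toNat_of_nonneg h0, Fin.sum_univ_succ μ, antiShift, e0]
        ring
      rw [commute_mulLeft_apply (commute_mulLeft_const _), mul_comm (rowMonomial r β),
        commute_mulLeft_apply (symmetrizer_comm_xvar v g le_rfl _), rowMonomial_eq (R := R) β,
        ih (by omega) β fun j => (hβ' j.succ).2.trans (hβ' j.castSucc).1, initialMonomial_succ,
        hexp, zpow_add₀ (xvar_ne_zero _)]
      ring
    -- Equal neighbours of `μ` become a drop by one in the shifted exponents.
    · push Not at hs
      obtain ⟨j, hj⟩ := hs
      have hj' : μ j.succ = μ j.castSucc := le_antisymm (hμ j) hj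
      rw [symmetrizer_initialMonomial_eq_zero hg _ hR (i := R - j) (by omega), crystalPoly_succ,
        Finset.sum_eq_zero, mul_zero]
      · intro β hβ
        rw [rowCoeff_eq_zero _ _ hβ hj', const_zero, zero_mul]
      · have e1 : (⟨R + 1 - (R - j), by omega⟩ : Fin (R + 1 + 1)) = j.succ :=
          Fin.ext (by simp only [Fin.val_succ]; omega)
        have e2 : (⟨R + 1 - (R - j + 1), by omega⟩ : Fin (R + 1 + 1)) = j.castSucc :=
          Fin.ext (by simp only [Fin.val_castSucc]; omega)
        unfold antiShift
        rw [e1, e2, hj']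
        push_cast
        ring

theorem monomial_longElement (lam : Weight r) :
    monomial (weightAct (longElement r) lam) = initialMonomial r (antiShift (lam + rho r)) r := by
  rw [initialMonomial_eq_monomial _ le_rfl]
  congr 1
  funext k
  rw [if_pos (by omega), antiShift]
  simp only [weightAct, longElement, Pi.add_apply, rho]
  have e : (⟨r - k, by omega⟩ : Fin (r + 1)) = (Fin.revPerm : Weyl r)⁻¹ k :=
    Fin.ext (by
      change _ = ((Fin.rev k : Fin (r + 1)) : ℕ)
      simp only [Fin.val_rev]; omega)
  rw [← e]
  push_cast [Nat.cast_sub (show (k : ℕ) ≤ r by omega)]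
  ring

theorem monomial_longElement_rho :
    monomial (-weightAct (longElement r) (rho r)) = initialMonomial r (fun i => -i) r := by
  rw [initialMonomial_eq_monomial _ le_rfl]
  congr 1
  funext k
  rw [if_pos (by omega)]
  change -((r : ℤ) - ((Fin.rev k : Fin (r + 1)) : ℕ)) = _
  rw [Fin.val_rev]
  omega

/-- The main identity, for the Hecke symmetrizer. -/
theorem symmetrizer_monomial [NeZero n] {v : ℂ} {g : ZMod n → ℂ}
    (hg : IsMetaplecticParameters n v g) {lam : Weight r}
    (dominant : ∀ i j : Fin (r + 1), i ≤ j → lam j ≤ lam i) :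
    symmetrizer (heckeOp n r v g) (r + 1) (monomial (weightAct (longElement r) lam)) =
      monomial (-weightAct (longElement r) (rho r)) *
        crystalSum (gFlatOf v g) (hFlatOf n v) (lam + rho r) := by
  rw [monomial_longElement, monomial_longElement_rho, ← crystalPoly_self,
    symmetrizer_eq_crystalPoly hg le_rfl]
  intro j
  have := dominant j.castSucc j.succ (Fin.castSucc_lt_succ).le
  simp only [Pi.add_apply, rho, Fin.val_succ, Fin.val_castSucc]
  omega

theorem sum_demazureLusztigWord [NeZero n] {v : ℂ} {g : ZMod n → ℂ}
    (hg : IsMetaplecticParameters n v g) {lam : Weight r}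
    (dominant : ∀ i j : Fin (r + 1), i ≤ j → lam j ≤ lam i) (word : Weyl r → List (Fin r))
    (hw : ∀ u, IsReducedWord (word u) u) :
    (∑ u : Weyl r, demazureLusztigWord n v g (word u)) (monomial (weightAct (longElement r) lam)) =
      monomial (-weightAct (longElement r) (rho r)) *
        crystalSum (gFlatOf v g) (hFlatOf n v) (lam + rho r) := by
  rw [← symmetrizer_monomial hg dominant, ← sum_reducedWords (demazureLusztig n v g) _
    (heckeOp_coe v g) (heckeOp_braidFamily hg) word hw]
  rfl

end

/-! ### Gauss sums as metaplectic parameters. -/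

section

/-! ### Gauss sums -/

section GaussSums

variable {n : ℕ} {k : Type} [Field k]

theorem mulChar_pow_mod {χ : MulChar k ℂ} (hχ : orderOf χ = n) (a : ℕ) :
    χ ^ ((a : ZMod n).val) = χ ^ a := by
  rw [ZMod.val_natCast, ← hχ, pow_mod_orderOf]

variable [Fintype k]

/-- For a generator `u` of `kˣ` and `q - 1 = 2nm`, the element `u ^ (m * n)` has square `1` but is
not `1`. -/
theorem exists_pow_eq_neg_one [NeZero n] (hq : Fintype.card k ≡ 1 [MOD 2 * n]) :
    ∃ a : k, a ≠ 0 ∧ a ^ n = -1 := by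
  classical
  obtain ⟨u, hu⟩ := IsCyclic.exists_ofOrder_eq_natCard (α := kˣ)
  rw [Nat.card_eq_fintype_card, Fintype.card_units] at hu
  have hcard := Fintype.one_lt_card (α := k)
  obtain ⟨m, hm⟩ := (Nat.modEq_iff_dvd' hcard.le).1 hq.symm
  have hn := NeZero.pos n
  have hm0 : 0 < m := Nat.pos_of_ne_zero fun h => by rw [h, mul_zero] at hm; omega
  refine ⟨(u ^ m : kˣ), Units.ne_zero _, ?_⟩
  have hlt : m * n < orderOf u := by
    have := Nat.mul_pos hm0 hn
    rw [hu, hm, show 2 * n * m = 2 * (m * n) by ring]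
    omega
  have h1 : u ^ (m * n) ≠ 1 := pow_ne_one_of_lt_orderOf (Nat.mul_pos hm0 hn).ne' hlt
  have h2 : (u ^ (m * n)) ^ 2 = 1 := by
    rw [← pow_mul, show m * n * 2 = orderOf u by rw [hu, hm]; ring, pow_orderOf_eq_one]
  have h3 := congrArg (Units.val : kˣ → k) h2
  rw [Units.val_pow_eq_pow_val, Units.val_one] at h3
  rw [← Units.val_pow_eq_pow_val, ← pow_mul]
  exact (sq_eq_one_iff.1 h3).resolve_left fun h => h1 (Units.ext h)

theorem mulChar_neg_one [NeZero n] (hq : Fintype.card k ≡ 1 [MOD 2 * n]) {χ : MulChar k ℂ}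
    (hχ : χ ^ n = 1) : χ (-1) = 1 := by
  obtain ⟨a, ha, ha'⟩ := exists_pow_eq_neg_one hq
  rw [← ha', map_pow, ← MulChar.pow_apply' _ (NeZero.ne n), hχ, MulChar.one_apply (Ne.isUnit ha)]

/-- A Gauss sum times that of the inverse character is `q` up to the sign `χ^j(-1)`, which is `1`
because `-1` is an `n`-th power. -/
theorem isMetaplecticParameters_gauss [NeZero n] {χ : MulChar k ℂ} {ψ : AddChar k ℂ}
    (hq : Fintype.card k ≡ 1 [MOD 2 * n]) (hχ : orderOf χ = n) (hψ : ψ ≠ 1) :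
    IsMetaplecticParameters n (Fintype.card k : ℂ)⁻¹ (gaussParameters n χ ψ) := by
  have hq0 : (Fintype.card k : ℂ) ≠ 0 := Nat.cast_ne_zero.2 Fintype.card_ne_zero
  refine ⟨?_, fun j hj => ?_⟩
  · rw [gaussParameters, ZMod.val_zero, pow_zero, gaussSum_one_left hψ]
  · have hj0 : j.val ≠ 0 := by rwa [Ne, ZMod.val_eq_zero]
    have hne : χ ^ j.val ≠ 1 := pow_ne_one_of_lt_orderOf hj0 (hχ ▸ ZMod.val_lt j)
    have hinv : χ ^ (-j).val = (χ ^ j.val)⁻¹ := by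
      have : NeZero j := ⟨hj⟩
      rw [eq_inv_iff_mul_eq_one, ← pow_add, ZMod.val_neg_of_ne_zero,
        Nat.sub_add_cancel (ZMod.val_lt j).le, ← hχ, pow_orderOf_eq_one]
    have hneg : (χ ^ j.val)⁻¹ (-1) = 1 := by
      rw [← hinv]
      refine mulChar_neg_one hq ?_
      rw [← pow_mul, mul_comm, pow_mul, orderOf_dvd_iff_pow_eq_one.1 hχ.dvd, one_pow]
    rw [gaussParameters, gaussParameters, hinv, ← mul_gaussSum_inv_eq_gaussSum (χ ^ j.val)⁻¹ ψ,
      hneg, one_mul, gaussSum_mul_gaussSum_eq_card hne (AddChar.IsPrimitive.of_ne_one hψ),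
      inv_mul_cancel₀ hq0]

theorem gFlatGauss_eq {χ : MulChar k ℂ} (ψ : AddChar k ℂ) (hχ : orderOf χ = n) :
    gFlatGauss χ ψ = gFlatOf (Fintype.card k : ℂ)⁻¹ (gaussParameters n χ ψ) := by
  funext a
  rw [gFlatGauss, gFlatOf, gaussParameters, mulChar_pow_mod hχ]

theorem hFlatGauss_eq {χ : MulChar k ℂ} (hχ : orderOf χ = n) :
    hFlatGauss χ = hFlatOf n (Fintype.card k : ℂ)⁻¹ := by
  classical
  funext a
  rw [hFlatGauss, hFlatOf]
  split_ifs with h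
  · rw [orderOf_dvd_iff_pow_eq_one.1 (hχ ▸ h), MulChar.sum_one_eq_card_units, Fintype.card_units,
      Nat.cast_sub Fintype.card_pos, Nat.cast_one, mul_sub, mul_one,
      inv_mul_cancel₀ (Nat.cast_ne_zero.2 Fintype.card_ne_zero)]
  · rw [MulChar.sum_eq_zero_of_ne_one fun h1 => h (hχ ▸ orderOf_dvd_of_pow_eq_one h1), mul_zero]

end GaussSums

end

/-! ### Degree one: the symmetrizer in terms of the Weyl antisymmetrizer. -/

section

variable {r : ℕ}

/-! ### The operators in degree one -/

/-- The parameters in degree one. -/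
abbrev unitParameters : ZMod 1 → ℂ := fun _ => -1

theorem isMetaplecticParameters_unit (v : ℂ) : IsMetaplecticParameters 1 v unitParameters :=
  ⟨rfl, fun j hj => absurd (Subsingleton.elim j 0) hj⟩

theorem mem_component_one (f : RatFun r) :
    f ∈ component (QuotientAddGroup.mk 0 : Weight r ⧸ sublattice 1 r) := by
  intro ξ
  have hsub : Subsingleton (Weight r ⧸ sublattice 1 r) :=
    QuotientAddGroup.subsingleton_iff.2 (eq_top_iff.2 fun μ _ i j => by simp)
  have hξ : ∀ a, ξ a = 1 := fun a => by rw [Subsingleton.elim a 0, AddChar.map_zero_eq_one]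
  rw [hξ, one_smul]
  have := ratFun_algHom_ext (φ := (twist ξ).toAlgHom) (ψ := AlgHom.id ℂ _) (fun i => by
    change twist ξ (var i) = var i
    rw [twist_var, hξ, one_smul])
  exact DFunLike.congr_fun this f

/-- For `n = 1` the numerator is `(1 - v) + v (1 - y) = 1 - v y`, which cancels the denominator. -/
theorem chintaGunnells_unit (v : ℂ) (i : Fin r) (f : RatFun r) :
    chintaGunnells 1 v unitParameters i f = ordinaryAct (simpleReflection i) f := by
  rw [chintaGunnells_of_mem 1 v unitParameters i 0 (mem_component_one f)]
  have h := one_sub_const_mul_ne_zero (castSucc_ne_succ' i) one_ne_zero v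
  have : chintaGunnellsFactor 1 v unitParameters i 0 = 1 := by
    simp only [chintaGunnellsFactor, Nat.cast_one, Int.emod_one, neg_zero, zpow_zero, sub_self,
      mul_neg, mul_one, const_neg, const_sub, const_one]
    rw [div_eq_one_iff_eq h]
    ring
  rw [this, mul_one]

theorem one_add_demazureLusztig_unit (v : ℂ) (i : Fin r) (f : RatFun r) :
    f + demazureLusztig 1 v unitParameters i f =
      (1 - const v * (var i.castSucc / var i.succ)) * ((1 - var i.castSucc / var i.succ)⁻¹ *
        (f - var i.castSucc / var i.succ * ordinaryAct (simpleReflection i) f)) := by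
  rw [demazureLusztig_apply, chintaGunnells_unit, pow_one]
  ring

theorem heckeOp_unit_comm (v : ℂ) {h : RatFun r} {i : ℕ}
    (hh : ∀ hi : i < r, ordinaryAct (simpleReflection (⟨i, hi⟩ : Fin r)) h = h) :
    Commute (LinearMap.mulLeft ℂ h) (heckeOp 1 r v unitParameters i) := by
  unfold heckeOp
  split_ifs with hi
  · ext f
    rw [Module.End.mul_apply, Module.End.mul_apply, LinearMap.mulLeft_apply,
      LinearMap.mulLeft_apply, demazureLusztig_apply, demazureLusztig_apply, chintaGunnells_unit,
      chintaGunnells_unit, map_mul, hh hi]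
    ring
  · exact Commute.zero_right _

/-! ### The Weyl denominator -/

/-- The Vandermonde product `∏_{i < j} (x_j - x_i)`. -/
noncomputable def vandermonde (r : ℕ) : RatFun r :=
  (Matrix.vandermonde (var : Fin (r + 1) → RatFun r)).det

theorem vandermonde_ne_zero : vandermonde r ≠ 0 := by
  refine Matrix.det_vandermonde_ne_zero_iff.2 fun i j hij => ?_
  by_contra hne
  exact var_pow_ne hne one_ne_zero 1 (by rw [const_one, one_mul, hij])

theorem ordinaryAct_vandermonde (w : Weyl r) :
    ordinaryAct w (vandermonde r) = ((Equiv.Perm.sign w : ℤ) : RatFun r) * vandermonde r := by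
  rw [vandermonde, AlgEquiv.map_det, ← Matrix.det_permute]
  congr 1
  ext i j
  simp [Matrix.vandermonde_apply, ordinaryAct_var]

theorem sign_mul_self (w : Weyl r) :
    ((Equiv.Perm.sign w : ℤ) : RatFun r) * ((Equiv.Perm.sign w : ℤ) : RatFun r) = 1 := by
  rw [← Int.cast_mul, ← Units.val_mul, Int.units_mul_self, Units.val_one, Int.cast_one]

theorem monomial_longElement_rho_eq :
    monomial (weightAct (longElement r) (rho r)) = ∏ i : Fin (r + 1), var i ^ (i : ℕ) := by
  refine Finset.prod_congr rfl fun i _ => ?_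
  rw [← zpow_natCast]
  congr 1
  change (r : ℤ) - ((Fin.rev i : Fin (r + 1)) : ℕ) = _
  rw [Fin.val_rev]
  omega

/-- The Weyl denominator formula, as the Leibniz expansion of the determinant. -/
theorem vandermonde_eq_sum : vandermonde r = ∑ w : Weyl r, ((Equiv.Perm.sign w : ℤ) : RatFun r) *
    monomial (weightAct w (weightAct (longElement r) (rho r))) := by
  rw [vandermonde, Matrix.det_apply']
  refine Finset.sum_congr rfl fun w _ => ?_
  rw [← ordinaryAct_monomial, monomial_longElement_rho_eq, map_prod]
  congr 1
  refine Finset.prod_congr rfl fun i _ => ?_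
  rw [map_pow, ordinaryAct_var, Matrix.vandermonde_apply]

theorem prod_Ioi_eq {M : Type*} [CommMonoid M] (f : ℕ → ℕ → M) :
    ∏ i : Fin (r + 1), ∏ j ∈ Finset.Ioi i, f i j =
      ∏ j ∈ Finset.range (r + 1), ∏ i ∈ Finset.range j, f i j := by
  rw [Finset.prod_range, Finset.prod_comm' (t' := Finset.univ) (s' := fun j => Finset.Iio j)
    (by simp)]
  refine Finset.prod_congr rfl fun j _ => ?_
  refine Finset.prod_bij (fun i _ => (i : ℕ)) ?_ ?_ ?_ ?_
  · intro i hi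
    rw [Finset.mem_Iio] at hi
    exact Finset.mem_range.2 hi
  · intro a _ b _ h
    exact Fin.ext h
  · intro b hb
    rw [Finset.mem_range] at hb
    exact ⟨⟨b, by omega⟩, Finset.mem_Iio.2 hb, rfl⟩
  · intro _ _
    rfl

theorem prod_var_sub_var :
    ∏ i : Fin (r + 1), ∏ j ∈ Finset.Ioi i, (var i - var j : RatFun r) =
      ((Equiv.Perm.sign (longElement r) : ℤ) : RatFun r) * vandermonde r := by
  rw [← ordinaryAct_vandermonde, vandermonde, Matrix.det_vandermonde, map_prod]
  simp only [map_prod, map_sub, ordinaryAct_var]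
  rw [Finset.prod_sigma', Finset.prod_sigma']
  refine Finset.prod_nbij' (fun p => ⟨p.2.rev, p.1.rev⟩) (fun p => ⟨p.2.rev, p.1.rev⟩)
    ?_ ?_ ?_ ?_ ?_
  · rintro ⟨i, j⟩ h
    simpa using h
  · rintro ⟨i, j⟩ h
    simpa using h
  · rintro ⟨i, j⟩ _
    simp
  · rintro ⟨i, j⟩ _
    simp
  · rintro ⟨i, j⟩ _
    simp [longElement]

/-! ### The antisymmetrizer -/

/-- `f ↦ (∑_w sgn(w) w(x^{w₀ ρ} f)) / ∏_{i < j} (x_j - x_i)`. -/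
noncomputable def antisymmetrizer (f : RatFun r) : RatFun r :=
  ∑ w : Weyl r, ordinaryAct w (monomial (weightAct (longElement r) (rho r)) * f / vandermonde r)

theorem antisymmetrizer_eq (f : RatFun r) : antisymmetrizer f =
    (∑ w : Weyl r, ((Equiv.Perm.sign w : ℤ) : RatFun r) *
      ordinaryAct w (monomial (weightAct (longElement r) (rho r)) * f)) / vandermonde r := by
  rw [antisymmetrizer, Finset.sum_div]
  refine Finset.sum_congr rfl fun w _ => ?_
  have hs := sign_mul_self w
  rw [map_div₀, ordinaryAct_vandermonde, div_eq_div_iff _ vandermonde_ne_zero]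
  · linear_combination (-ordinaryAct w (monomial (weightAct (longElement r) (rho r)) * f) *
      vandermonde r) * hs
  · exact mul_ne_zero (left_ne_zero_of_mul_eq_one hs) vandermonde_ne_zero

theorem antisymmetrizer_one : antisymmetrizer (1 : RatFun r) = 1 := by
  rw [antisymmetrizer_eq]
  simp only [mul_one, ordinaryAct_monomial]
  rw [← vandermonde_eq_sum, div_self vandermonde_ne_zero]

theorem antisymmetrizer_monomial (lam : Weight r) :
    antisymmetrizer (monomial (weightAct (longElement r) lam)) = schur lam := by
  rw [antisymmetrizer_eq, schur, prod_var_sub_var, ← mul_div_mul_left _ _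
    (left_ne_zero_of_mul_eq_one (sign_mul_self (longElement r)))]
  congr 1
  rw [← Equiv.sum_comp (Equiv.mulRight (longElement r)), Finset.mul_sum]
  refine Finset.sum_congr rfl fun w _ => ?_
  have hs := sign_mul_self (longElement r)
  have hrr : longElement r * longElement r = 1 := by
    ext i
    simp [longElement]
  rw [← monomial_add, show weightAct (longElement r) (rho r) + weightAct (longElement r) lam =
    weightAct (longElement r) (lam + rho r) by rw [add_comm]; rfl, ordinaryAct_monomial,
    ← weightAct_mul, Equiv.coe_mulRight, mul_assoc w, hrr, mul_one, Equiv.Perm.sign_mul]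
  push_cast
  linear_combination (((Equiv.Perm.sign w : ℤ) : RatFun r) * monomial (weightAct w (lam + rho r)))
    * hs

/-- The Hecke symmetrizer in degree one. -/
theorem symmetrizer_unit (v : ℂ) (f : RatFun r) :
    symmetrizer (heckeOp 1 r v unitParameters) (r + 1) f =
      symmetrizer (heckeOp 1 r v unitParameters) (r + 1) 1 * antisymmetrizer f := by
  set P := symmetrizer (heckeOp 1 r v unitParameters) (r + 1) with hP
  -- `D` is chosen so that `x^{α_i} σ_i(D) = -D`; then `1 + T_i` annihilates `D (σ_i y - y)`.
  set D : RatFun r := vandermonde r / monomial (weightAct (longElement r) (rho r)) with hD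
  have hsD : ∀ i : Fin r, var i.castSucc / var i.succ * ordinaryAct (simpleReflection i) D = -D := by
    intro i
    have h1 := var_ne_zero (r := r) i.castSucc
    have h2 := var_ne_zero (r := r) i.succ
    have hsg : Equiv.Perm.sign (simpleReflection i) = -1 :=
      Equiv.Perm.sign_swap (castSucc_ne_succ' i)
    have hw : weightAct (longElement r) (rho r) i.succ -
        weightAct (longElement r) (rho r) i.castSucc = 1 := by
      change ((r : ℤ) - ((Fin.rev i.succ : Fin (r + 1)) : ℕ)) -
        ((r : ℤ) - ((Fin.rev i.castSucc : Fin (r + 1)) : ℕ)) = 1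
      simp only [Fin.val_rev, Fin.val_succ, Fin.val_castSucc]
      omega
    rw [hD, map_div₀, ordinaryAct_vandermonde, ordinaryAct_monomial, weightAct_simpleReflection,
      hw, one_smul, monomial_add, monomial_simpleRoot, hsg]
    have h3 := monomial_ne_zero (weightAct (longElement r) (rho r))
    push_cast
    field_simp
  -- Since each `1 + T_i` is a right factor of `P`, the map `y ↦ P (D y)` is unchanged by simple
  -- reflections, hence by all of `W`.
  have hinv : ∀ (w : Weyl r) (y : RatFun r), P (D * ordinaryAct w y) = P (D * y) := by
    intro w
    have hw : w ∈ Submonoid.closure (Set.range fun i : Fin r => Equiv.swap i.castSucc i.succ) := by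
      rw [Equiv.Perm.mclosure_swap_castSucc_succ]
      trivial
    induction hw using Submonoid.closure_induction with
    | one => intro y; rw [ordinaryAct_one]
    | mul a b _ _ ha hb => intro y; rw [ordinaryAct_mul, ha, hb]
    | mem a ha =>
      obtain ⟨i, rfl⟩ := ha
      intro y
      change P (D * ordinaryAct (simpleReflection i) y) = _
      obtain ⟨Y, hY⟩ := symmetrizer_dvd
        (heckeOp_braidFamily (r := r) (isMetaplecticParameters_unit v)) (R := r + 1) (i := i)
        le_rfl (by omega)
      rw [← sub_eq_zero, ← map_sub, ← mul_sub, hP, hY, Module.End.mul_apply, LinearMap.add_apply,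
        Module.End.one_apply, heckeOp_coe, one_add_demazureLusztig_unit,
        map_mul (ordinaryAct _), map_sub (ordinaryAct _), ordinaryAct_simpleReflection_self, ← mul_assoc (var _ / var _), hsD]
      convert map_zero Y
      ring
  have hlin : ∀ h : RatFun r, (∀ w : Weyl r, ordinaryAct w h = h) → ∀ y, P (h * y) = h * P y :=
    fun h hh => commute_mulLeft_apply (commute_symmetrizer fun i _ =>
      heckeOp_unit_comm v fun _ => hh _)
  -- Averaging replaces `y` by its symmetrization, over which `P` is linear; this determines `P (D
  -- y)` up to the fixed factor `P D`, later eliminated by taking `f = 1`.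
  have havg : ∀ y : RatFun r, (Fintype.card (Weyl r) : RatFun r) * P (D * y) =
      (∑ w : Weyl r, ordinaryAct w y) * P D := by
    intro y
    rw [← hlin (∑ w : Weyl r, ordinaryAct w y), ← nsmul_eq_mul, ← Finset.card_univ, ← Finset.sum_const,
      ← Finset.sum_congr rfl fun w _ => hinv w y, ← map_sum, ← Finset.mul_sum, mul_comm D]
    intro w
    rw [map_sum, ← Equiv.sum_comp (Equiv.mulLeft w) fun u => ordinaryAct u y]
    exact Finset.sum_congr rfl fun u _ => by rw [← ordinaryAct_mul]; rfl
  have hcard : (Fintype.card (Weyl r) : RatFun r) ≠ 0 := Nat.cast_ne_zero.2 Fintype.card_ne_zero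
  have hA : ∀ f : RatFun r, (Fintype.card (Weyl r) : RatFun r) * P f =
      antisymmetrizer f * P D := by
    intro f
    have h3 := monomial_ne_zero (weightAct (longElement r) (rho r))
    have := havg (monomial (weightAct (longElement r) (rho r)) * f / vandermonde r)
    rwa [show D * (monomial (weightAct (longElement r) (rho r)) * f / vandermonde r) = f by
      have h4 := vandermonde_ne_zero (r := r)
      rw [hD]; field_simp] at this
  have h1 := hA 1
  rw [antisymmetrizer_one, one_mul] at h1
  refine mul_left_cancel₀ hcard ?_
  rw [hA f, ← h1]
  ring

end

/-! ### The deformed Weyl denominator and Tokuyama's formula. -/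

section

variable {r : ℕ}

/-! ### The Hecke symmetrizer of `1` in degree one -/

/-- For zero exponents only `k = γ` and `k = γ + 1` have nonzero weight, namely `1` and `-v`. The
recursion is that of `(-v)^k` times the elementary symmetric polynomial `e_k(x_0, …, x_{R-1})`. -/
theorem rowPoly_unit (v : ℂ) {R : ℕ} (k : ℕ) :
    rowPoly 1 r v unitParameters (fun _ => 0) (R + 1) k =
      rowPoly 1 r v unitParameters (fun _ => 0) R k -
        const v * xvar r R * (if k = 0 then 0 else
          rowPoly 1 r v unitParameters (fun _ => 0) R (k - 1)) := by
  have h0 : ∀ γ k : ℕ, γ ≤ k → rowWeight 1 v unitParameters (0 - 0) γ k =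
      if k = γ then 1 else if k = γ + 1 then -v else 0 := by
    intro γ k hγ
    unfold rowWeight gFlatOf
    by_cases h1 : k = γ
    · rw [if_pos h1, if_pos h1]
    · rw [if_neg h1, if_neg h1, if_neg (by omega)]
      by_cases h2 : k = γ + 1
      · rw [if_pos (by omega), if_pos h2, mul_neg_one]
      · rw [if_neg (by omega), if_neg h2]
  rw [rowPoly, Finset.sum_range_succ, h0 k k le_rfl, if_pos rfl]
  cases k with
  | zero => simp [const_one]
  | succ k =>
    rw [Finset.sum_range_succ, h0 k (k + 1) (by omega), if_neg (by omega), if_pos rfl,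
      Finset.sum_eq_zero]
    · rw [if_neg (by omega), Nat.add_sub_cancel, const_one, const_neg,
        show (0 : ℤ) - k + (k + 1 : ℕ) = 1 by push_cast; ring,
        show (0 : ℤ) - (k + 1 : ℕ) + (k + 1 : ℕ) = 0 by ring, zpow_one, zpow_zero]
      ring
    · intro γ hγ
      rw [Finset.mem_range] at hγ
      rw [h0 γ (k + 1) (by omega), if_neg (by omega), if_neg (by omega), const_zero, zero_mul]

theorem sum_rowPoly_unit (v : ℂ) (R : ℕ) (y : RatFun r) :
    ∑ γ ∈ Finset.range (rowBound (fun _ => 0) R + 1),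
      rowPoly 1 r v unitParameters (fun _ => 0) R γ * y ^ γ =
    ∏ i ∈ Finset.range R, (1 - const v * xvar r i * y) := by
  induction R with
  | zero => simp [rowBound, rowPoly]
  | succ R ih =>
    have hb : rowBound (fun _ => 0) (R + 1) = rowBound (fun _ => 0) R + 1 := by
      simp [rowBound]
    rw [Finset.prod_range_succ, ← ih, hb, Finset.sum_congr rfl fun γ _ => by rw [rowPoly_unit]]
    simp only [sub_mul, Finset.sum_sub_distrib]
    rw [Finset.sum_range_succ, rowPoly_eq_zero v _ _ (Nat.lt_succ_self _), zero_mul, add_zero,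
      Finset.sum_range_succ' (fun γ => const v * xvar r R * _ * y ^ γ)]
    simp only [if_true, mul_zero, zero_mul, add_zero, Nat.add_sub_cancel, Nat.succ_ne_zero, if_false]
    rw [mul_sub, mul_one, Finset.sum_mul]
    congr 1
    exact Finset.sum_congr rfl fun γ _ => by ring

theorem ordinaryAct_xvar {i k : ℕ} (hi : i < r) (hk : k ≤ r) :
    ordinaryAct (simpleReflection (⟨i, hi⟩ : Fin r)) (xvar r k) =
      xvar r (Equiv.swap i (i + 1) k) := by
  rw [xvar, dif_pos (by omega), ordinaryAct_var, ← xvar_coe]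
  congr 1
  simp only [simpleReflection, Equiv.swap_apply_def, Fin.ext_iff, Fin.val_castSucc, Fin.val_succ]
  split_ifs <;> rfl

/-- The row product is symmetric in `x_0, …, x_{R-1}`, which lets it be taken out of `P_R`. -/
theorem ordinaryAct_rowProd (v : ℂ) {R i : ℕ} (hR : R ≤ r) (hi : i + 1 < R) :
    ordinaryAct (simpleReflection (⟨i, by omega⟩ : Fin r))
      (∏ k ∈ Finset.range R, (1 - const v * xvar r k * (xvar r R)⁻¹)) =
    ∏ k ∈ Finset.range R, (1 - const v * xvar r k * (xvar r R)⁻¹) := by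
  rw [map_prod]
  refine Finset.prod_equiv (Equiv.swap i (i + 1)) ?_ ?_
  · intro k
    rw [Finset.mem_range, Finset.mem_range, Equiv.swap_apply_def]
    split_ifs <;> omega
  · intro k hk
    rw [Finset.mem_range] at hk
    rw [map_sub, map_one, map_mul, map_mul, map_inv₀, map_const, ordinaryAct_xvar _ (by omega),
      ordinaryAct_xvar _ (by omega), Equiv.swap_apply_of_ne_of_ne (a := i) (b := i + 1) (x := R)
        (by omega) (by omega)]

/-- The constant `1` is the antidominant monomial with `κ = 0`. Its row sum is the generating
function `∏ (1 - v x_i / x_R)`, and pulling this out of `P_R` leaves `P_R(1)`. -/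
theorem symmetrizer_unit_one (v : ℂ) {R : ℕ} (hR : R ≤ r + 1) :
    symmetrizer (heckeOp 1 r v unitParameters) R 1 =
      ∏ j ∈ Finset.range R, ∏ k ∈ Finset.range j, (1 - const v * xvar r k * (xvar r j)⁻¹) := by
  induction R with
  | zero => simp [symmetrizer]
  | succ R ih =>
    have h1 : initialMonomial r (fun _ => 0) R = 1 := by simp [initialMonomial]
    have h2 := symmetrizer_initialMonomial (r := r) (isMetaplecticParameters_unit v) (fun _ => 0)
      (R := R) (by omega) fun _ _ => le_rfl
    have h3 : ∑ γ ∈ Finset.range (rowBound (fun _ => 0) R + 1),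
        rowPoly 1 r v unitParameters (fun _ => 0) R γ * xvar r R ^ ((0 : ℤ) - γ) =
        ∏ i ∈ Finset.range R, (1 - const v * xvar r i * (xvar r R)⁻¹) := by
      rw [← sum_rowPoly_unit]
      refine Finset.sum_congr rfl fun γ _ => ?_
      rw [zero_sub, zpow_neg, zpow_natCast, inv_pow]
    rw [h1, h3] at h2
    rw [h2, Finset.prod_range_succ, ← ih (by omega), ← mul_one (∏ _ ∈ _, _),
      commute_mulLeft_apply (commute_symmetrizer fun i hi =>
        heckeOp_unit_comm v fun _ => ordinaryAct_rowProd v (by omega) hi)]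
    ring

/-- The deformation of the Weyl character formula. -/
theorem crystalSum_unit (v : ℂ) {lam : Weight r}
    (dominant : ∀ i j : Fin (r + 1), i ≤ j → lam j ≤ lam i) :
    (∏ i : Fin (r + 1), ∏ j ∈ Finset.Ioi i, (var j - const v * var i)) * schur lam =
      crystalSum (gFlatOf v unitParameters) (hFlatOf 1 v) (lam + rho r) := by
  have h := symmetrizer_monomial (isMetaplecticParameters_unit v) dominant
  rw [symmetrizer_unit, antisymmetrizer_monomial, symmetrizer_unit_one v le_rfl, monomial_neg,
    inv_mul_eq_div] at h
  rw [eq_div_iff (monomial_ne_zero _), monomial_longElement_rho_eq, mul_right_comm] at h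
  rw [← h]
  congr 1
  simp only [← xvar_coe]
  rw [prod_Ioi_eq fun i j => xvar r j - const v * xvar r i,
    ← Finset.prod_range (fun i => xvar r i ^ i), ← Finset.prod_mul_distrib]
  refine Finset.prod_congr rfl fun j _ => ?_
  -- Each of the `j` factors `1 - v x_i / x_j` receives one `x_j` from `x^{w₀ρ} = ∏ x_j^j` and
  -- becomes `x_j - v x_i`.
  have hj : xvar r j ^ j = ∏ _i ∈ Finset.range j, xvar r j := by simp
  rw [hj, ← Finset.prod_mul_distrib]
  refine Finset.prod_congr rfl fun i _ => ?_
  have := xvar_ne_zero (r := r) j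
  field_simp

end

end MetaplecticTokuyama

theorem theorem2p2 (n r : ℕ) [NeZero n] (lam : Weight r)
    (dominant : ∀ i j : Fin (r + 1), i ≤ j → lam j ≤ lam i)
    (effective : 0 ≤ lam (Fin.last r)) :
    -- arbitrary parameters `v, g_0, …, g_{n-1}`, and an arbitrary reduced word of every `u`
    (∀ (v : ℂ) (g : ZMod n → ℂ), IsMetaplecticParameters n v g →
      ∀ word : Weyl r → List (Fin r), (∀ u, IsReducedWord (word u) u) →
        (∑ u : Weyl r, demazureLusztigWord n v g (word u))
            (monomial (weightAct (longElement r) lam)) =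
          monomial (-weightAct (longElement r) (rho r)) *
            crystalSum (gFlatOf v g) (hFlatOf n v) (lam + rho r)) ∧
    -- the parameters given by Gauss sums over a finite field
    (∀ (k : Type) [Field k] [Fintype k] (χ : MulChar k ℂ) (ψ : AddChar k ℂ),
      Fintype.card k ≡ 1 [MOD 2 * n] → orderOf χ = n → ψ ≠ 1 →
      ∀ word : Weyl r → List (Fin r), (∀ u, IsReducedWord (word u) u) →
        (∑ u : Weyl r,
            demazureLusztigWord n (Fintype.card k : ℂ)⁻¹ (gaussParameters n χ ψ) (word u))
            (monomial (weightAct (longElement r) lam)) =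
          monomial (-weightAct (longElement r) (rho r)) *
            crystalSum (gFlatGauss χ ψ) (hFlatGauss χ) (lam + rho r)) ∧
    -- degree one: the deformation of the Weyl character formula
    (∀ v : ℂ,
      (∏ i : Fin (r + 1), ∏ j ∈ Finset.Ioi i, (var j - const v * var i)) * schur lam =
        crystalSum (gFlatOf v (fun _ : ZMod 1 => -1)) (hFlatOf 1 v) (lam + rho r)) := by
  refine ⟨fun v g hg word hw => sum_demazureLusztigWord hg dominant word hw, ?_,
    fun v => crystalSum_unit v dominant⟩
  intro k _ _ χ ψ hq hχ hψ word hw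
  rw [gFlatGauss_eq ψ hχ, hFlatGauss_eq hχ]
  exact sum_demazureLusztigWord (isMetaplecticParameters_gauss hq hχ hψ) dominant word hw
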